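/- Let $G$ be a finite-dimensional real Lie group with Lie algebra $\mathfrak g$, let $J_1,\dots,J_d$ be a basis of $\mathfrak g$ with structure constants $[J_a,J_b]=f_{ab}{}^cJ_c$ (summation over repeated basis indices throughout), and let $P^1,\dots,P^d$ be the dual basis of $\mathfrak g^*$. For $u\in G$ let $\mathrm{Ad}^*(u)$ be the algebraic dual of $\mathrm{Ad}(u)$, with matrix $\mathrm{Ad}^*(u)_a{}^b=\langle P^b,\mathrm{Ad}(u)J_a\rangle$. Let $n,g\ge 0$. Label $n+2g$ copies of $G$ by $M_1,\dots,M_n,A_1,B_1,\dots,A_g,B_g$, and order the labels by $M_1<\dots<M_n<A_1,B_1<\dots<A_g,B_g$, where $A_i$ and $B_i$ are not comparable. Write $u_X$ for the $X$-component of a point of $G^{n+2g}$. For $F\in C^\infty(G^{n+2g})$ let $J_a^{R_X}F=\frac{d}{dt}|_{t=0}F(\dots,u_Xe^{tJ_a},\dots)$ and $J_a^{L_X}F=\frac{d}{dt}|_{t=0}F(\dots,e^{-tJ_a}u_X,\dots)$. **Flower algebra.** Let $\mathcal F=S\big(\bigoplus_{X}\mathfrak g\big)\otimes C^\infty(G^{n+2g})$,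 with generators $j^X_a$ ($=j_a^X\otimes1$, the basis element $J_a$ in the $X$-th copy of $\mathfrak g$) and $F$ ($=1\otimes F$). Let $\{\,,\}$ be the skew biderivation of $\mathcal F$ with $\{F,F'\}=0$ and $$\{j^X_a,j^X_b\}=-f_{ab}{}^cj^X_c,\qquad \{j^{A_i}_a,j^{B_i}_b\}=-f_{ab}{}^cj_c^{B_i},\qquad \{j^X_a,j^Y_b\}=-f_{db}{}^c\,j^Y_c\,(\delta_a^d-\mathrm{Ad}^*(u_X)_a{}^d)\ \ (X<Y),$$ $$\{j^{M_i}_a,F\}=-(J_a^{R_{M_i}}+J_a^{L_{M_i}})F-T^{M_i}_aF,$$ $$\{j^{A_i}_a,F\}=-(J_a^{R_{A_i}}+J_a^{L_{A_i}})F-(J_a^{R_{B_i}}+J_a^{L_{B_i}})F-\mathrm{Ad}^*(u_{B_i}^{-1}u_{A_i})_a{}^bJ_b^{R_{B_i}}F-T^{A_i}_aF,$$ $$\{j^{B_i}_a,F\}=-J_a^{L_{A_i}}F-(J_a^{R_{B_i}}+J_a^{L_{B_i}})F-T^{B_i}_aF,$$ where $T^X_a=(\delta_a^b-\mathrm{Ad}^*(u_X)_a{}^b)\sum_{Y>X}(J_b^{R_Y}+J_b^{L_Y})$.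 **Decoupling transformation.** Write $j^X=(j^X_a)_a$ and let $(\mathrm{Ad}^*(w)v)_a=\mathrm{Ad}^*(w)_a{}^bv_b$. Put $u_{K_i}=u_{B_i}u_{A_i}^{-1}u_{B_i}^{-1}u_{A_i}$ and $$j^{H_i}=(1-\mathrm{Ad}^*(u_{A_i}^{-1}u_{B_i}^{-1}u_{A_i}))j^{A_i}+(\mathrm{Ad}^*(u_{A_i}^{-1}u_{B_i}^{-1}u_{A_i})-\mathrm{Ad}^*(u_{B_i}^{-1}u_{A_i}))j^{B_i},$$ $$s_i=\sum_{k>i}\mathrm{Ad}^*(u_{K_{k-1}}\cdots u_{K_{i+1}})j^{H_k}.$$ Let $K:\mathcal F\to\mathcal F$ be the algebra homomorphism with $K(F)=F$ and $K(j^X_a)=j^{X'}_a$, where $$j^{M_i'}=j^{M_i}-(1-\mathrm{Ad}^*(u_{M_i}))\Big(\sum_{k=i+1}^n\mathrm{Ad}^*(u_{M_{k-1}}\cdots u_{M_{i+1}})j^{M_k}+\sum_{k=1}^g\mathrm{Ad}^*(u_{K_{k-1}}\cdots u_{K_1}u_{M_n}\cdots u_{M_{i+1}})j^{H_k}\Big),$$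 $$j^{A_i'}=j^{A_i}+\mathrm{Ad}^*(u_{A_i}^{-1})(j^{A_i}-j^{B_i})+(\mathrm{Ad}^*(u_{A_i})-\mathrm{Ad}^*(u_{B_i}u_{A_i}^{-1}))s_i,$$ $$j^{B_i'}=j^{B_i}+\mathrm{Ad}^*(u_{A_i}^{-1})(j^{A_i}-j^{B_i})+(\mathrm{Ad}^*(u_{B_i})-\mathrm{Ad}^*(u_{B_i}u_{A_i}^{-1}))s_i.$$ **The groups and Poisson structures.** Let $H=G\ltimes\mathfrak g^*$ with $(u_1,a_1)(u_2,a_2)=(u_1u_2,a_1+\mathrm{Ad}^*(u_1^{-1})a_2)$. For a basis element $Z$ of $\mathfrak h=\mathfrak g\oplus\mathfrak g^*$ put $\tilde Z_Rf(h)=\frac{d}{dt}|_{0}f(he^{tZ})$ and $\tilde Z_Lf(h)=\frac{d}{dt}|_{0}f(e^{-tZ}h)$; these fields are written $\tilde P^a_R,\tilde P^a_L,\tilde J_a^R,\tilde J_a^L$. The Poisson structure of the dual Poisson–Lie group $H^*$, written on $H$, is given by $$B_{H^*}=\tfrac12(\tilde P^a_L\wedge\tilde J_a^L+\tilde P^a_R\wedge\tilde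 J_a^R)+\tilde P^a_R\wedge\tilde J_a^L,$$ and that of the Heisenberg double $D_+(H)$, on $H\times H$, by $$B_{D_+(H)}=\tfrac12\sum_{i=1,2}(\tilde P^a_{R_i}\wedge\tilde J_a^{R_i}+\tilde P^a_{L_i}\wedge\tilde J_a^{L_i})+\tilde P^a_{R_1}\wedge\tilde J_a^{R_2}+\tilde P^a_{L_1}\wedge\tilde J_a^{L_2},$$ where $(V\wedge W)(f,k)=V(f)W(k)-W(f)V(k)$. Elements of $\mathcal F$ are viewed as functions on $H^{n+2g}$: $F$ depends on the $G$-components only, and $j^X_a$ is the function $(u_Y,-\mathrm{Ad}^*(u_Y^{-1})\boldsymbol j_Y)_Y\mapsto\langle\boldsymbol j_X,J_a\rangle$. **Theorem.** The bracket $\{\,,\}$ is a Poisson bracket on $\mathcal F$, and $K$ is bijective; its inverse is the algebra homomorphism fixing all $F$ with $$j^{M_i}\mapsto j^{M_i}+(1-\mathrm{Ad}^*(u_{M_i}))\Big(\sum_{k>i}j^{M_k}+\sum_{k=1}^g h_k\Big),$$ $$j^{X}\mapsto j^{X}-\mathrm{Ad}^*(u_{A_i}^{-1})(j^{A_i}-j^{B_i})+(1-\mathrm{Ad}^*(u_X))\sum_{k>i}h_k\qquad(X=A_i,B_i),$$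 where $h_k=(1-\mathrm{Ad}^*(u_{A_k}^{-1}))j^{A_k}+(\mathrm{Ad}^*(u_{A_k}^{-1})-\mathrm{Ad}^*(u_{B_k}^{-1}u_{A_k}))j^{B_k}$. The brackets of the transformed generators are $$\{j_a^{M_i'},j_b^{M_j'}\}=-\delta_{ij}f_{ab}{}^cj_c^{M_i'},\qquad \{j_a^{M_i'},F\}=-(J_a^{R_{M_i}}+J_a^{L_{M_i}})F,$$ $$\{j_a^{A_i'},j_b^{A_j'}\}=-\delta_{ij}f_{ab}{}^cj_c^{A_i'},\quad \{j_a^{B_i'},j_b^{B_j'}\}=-\delta_{ij}f_{ab}{}^cj_c^{B_i'},\quad \{j_a^{A_i'},j_b^{B_j'}\}=-\delta_{ij}f_{ab}{}^cj_c^{B_i'},$$ $$\{j_a^{A_i'},F\}=-J_a^{R_{A_i}}F-(\delta_a^b+\mathrm{Ad}^*(u_{B_i}^{-1}u_{A_i})_a{}^b)J_b^{R_{B_i}}F,\qquad \{j_a^{B_i'},F\}=-J_a^{R_{B_i}}F,$$ $$\{j_a^{M_i'},j_b^{A_j'}\}=\{j_a^{M_i'},j_b^{B_j'}\}=0,\qquad\{F,F'\}=0.$$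 Moreover the map from $\mathcal F$ to functions on $H^{n+2g}$ is injective, and under it the transported bracket $(\varphi,\psi)\mapsto K^{-1}\{K\varphi,K\psi\}$ is the direct sum of $n$ copies of the Poisson structure $B_{H^*}$ (one on the factor $M_i$ for each puncture) and $g$ copies of the Poisson structure $B_{D_+(H)}$ (one on the factors $(A_i,B_i)$ for each handle). -/

import Mathlib

open scoped Manifold ContDiff TensorProduct

noncomputable section

namespace FlowerAlgebra

/-! ### Finite powers of a manifold and derivatives depending on parameters -/

section Smoothness

variable {E G : Type*} [NormedAddCommGroup E] [NormedSpace ℝ E]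
  [TopologicalSpace G] [ChartedSpace E G]
  {ι : Type*} [Fintype ι]

theorem contMDiffAt_into_pi {F HF M : Type*} [NormedAddCommGroup F] [NormedSpace ℝ F]
    [TopologicalSpace HF] {J : ModelWithCorners ℝ F HF} [TopologicalSpace M] [ChartedSpace HF M]
    {n : ℕ∞ω} {f : M → ι → G} {x : M} :
    ContMDiffAt J (ModelWithCorners.pi fun _ : ι => 𝓘(ℝ, E)) n f x ↔
      ∀ i, ContMDiffAt J 𝓘(ℝ, E) n (fun y => f y i) x := by
  simp only [contMDiffAt_iff, forall_and]
  refine and_congr continuousAt_pi ?_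
  exact contDiffWithinAt_pi

instance isManifold_pi [IsManifold 𝓘(ℝ, E) ∞ G] :
    IsManifold (ModelWithCorners.pi fun _ : ι => 𝓘(ℝ, E)) ∞ (ι → G) := by
  apply isManifold_of_contDiffOn
  rintro e e' ⟨s, hs, rfl⟩ ⟨s', hs', rfl⟩
  refine contDiffOn_pi.2 fun i => ?_
  have h := (contDiffGroupoid ∞ 𝓘(ℝ, E)).compatible (hs i (Set.mem_univ i)) (hs' i (Set.mem_univ i))
  rw [contDiffGroupoid, mem_groupoid_of_pregroupoid] at h
  have h1 : ContDiffOn ℝ ∞ (𝓘(ℝ, E) ∘ ((s i).symm ≫ₕ s' i) ∘ 𝓘(ℝ, E).symm)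
    (𝓘(ℝ, E).symm ⁻¹' ((s i).symm ≫ₕ s' i).source ∩ Set.range 𝓘(ℝ, E)) := h.1
  refine h1.comp (t := _) (contDiff_apply ℝ E i).contDiffOn ?_
  rintro y ⟨⟨hy, hy'⟩, -⟩
  refine ⟨⟨hy i (Set.mem_univ i), hy' i (Set.mem_univ i)⟩, by simp⟩

theorem contMDiff_proj (i : ι) :
    ContMDiff (ModelWithCorners.pi fun _ : ι => 𝓘(ℝ, E)) 𝓘(ℝ, E) ∞ (fun u : ι → G => u i) :=
  fun _ => contMDiffAt_into_pi.1 contMDiffAt_id i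

theorem inTangentCoordinates_const {E' H' M' N : Type*} [NormedAddCommGroup E'] [NormedSpace ℝ E']
    [TopologicalSpace H'] {I' : ModelWithCorners ℝ E' H'} [TopologicalSpace M'] [ChartedSpace H' M']
    [IsManifold I' 1 M'] [IsManifold 𝓘(ℝ, E) 1 G] (v₀ : G) (w : N → M') (ϕ : N → E →L[ℝ] E')
    (x₀ x : N)
    (hw : ∀ ξ : E', (tangentBundleCore I' M').coordChange (achart H' (w x)) (achart H' (w x₀)) (w x) ξ = ξ)
    (hw' : w x ∈ (chartAt H' (w x₀)).source) :
    inTangentCoordinates 𝓘(ℝ, E) I' (fun _ => v₀) w ϕ x₀ x = ϕ x := by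
  rw [inTangentCoordinates_eq (I := 𝓘(ℝ, E)) (I' := I') (fun _ => v₀) w ϕ (mem_chart_source E v₀) hw']
  ext ξ
  simp only [ContinuousLinearMap.comp_apply]
  rw [hw, (tangentBundleCore 𝓘(ℝ, E) G).coordChange_self _ _ (mem_chart_source E v₀)]

theorem contMDiff_partial_real {F HF M : Type*} [NormedAddCommGroup F] [NormedSpace ℝ F]
    [TopologicalSpace HF] {J : ModelWithCorners ℝ F HF} [TopologicalSpace M] [ChartedSpace HF M]
    [IsManifold J ∞ M] [IsManifold 𝓘(ℝ, E) ∞ G] {Φ : M → G → ℝ} (v₀ : G)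
    (hΦ : ContMDiff (J.prod 𝓘(ℝ, E)) 𝓘(ℝ) ∞ (Function.uncurry Φ)) (ξ : E) :
    ContMDiff J 𝓘(ℝ) ∞ (fun x => (mfderiv 𝓘(ℝ, E) 𝓘(ℝ) (Φ x) v₀ : E →L[ℝ] ℝ) ξ) := by
  intro x₀
  have : IsManifold J 1 M := IsManifold.of_le (n := ∞) (by norm_cast)
  have h := ContMDiffAt.mfderiv (m := ∞) Φ (fun _ => v₀) (hΦ (x₀, v₀)) contMDiffAt_const
    (by simp)
  have h2 := h.clm_apply (contMDiffAt_const (c := ξ))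
  refine h2.congr_of_eventuallyEq (Filter.Eventually.of_forall fun x => ?_)
  have key := inTangentCoordinates_const (E := E) (E' := ℝ) (I' := 𝓘(ℝ)) v₀ (fun x => Φ x v₀)
    (fun x => mfderiv 𝓘(ℝ, E) 𝓘(ℝ) (Φ x) v₀) x₀ x
    (fun η => DFunLike.congr_fun
      (TangentBundle.coordChange_model_space (𝕜 := ℝ) (Φ x v₀) (Φ x₀ v₀) (Φ x v₀)) η) (by rw [chartAt_self_eq]; trivial)
  exact (DFunLike.congr_fun key ξ).symm

theorem contMDiff_partial_fixed {F HF M : Type*} [NormedAddCommGroup F] [NormedSpace ℝ F]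
    [TopologicalSpace HF] {J : ModelWithCorners ℝ F HF} [TopologicalSpace M] [ChartedSpace HF M]
    [IsManifold J ∞ M] [IsManifold 𝓘(ℝ, E) ∞ G] {Φ : M → G → G} (v₀ : G)
    (hΦ : ContMDiff (J.prod 𝓘(ℝ, E)) 𝓘(ℝ, E) ∞ (Function.uncurry Φ)) (h₀ : ∀ x, Φ x v₀ = v₀)
    (ξ : E) :
    ContMDiff J 𝓘(ℝ, E) ∞ (fun x => (mfderiv 𝓘(ℝ, E) 𝓘(ℝ, E) (Φ x) v₀ : E →L[ℝ] E) ξ) := by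
  intro x₀
  have : IsManifold J 1 M := IsManifold.of_le (n := ∞) (by norm_cast)
  have h := ContMDiffAt.mfderiv (m := ∞) Φ (fun _ => v₀) (hΦ (x₀, v₀)) contMDiffAt_const
    (by simp)
  have h2 := h.clm_apply (contMDiffAt_const (c := ξ))
  refine h2.congr_of_eventuallyEq (Filter.Eventually.of_forall fun x => ?_)
  have key := inTangentCoordinates_const (E := E) (E' := E) (I' := 𝓘(ℝ, E)) v₀ (fun x => Φ x v₀)
    (fun x => mfderiv 𝓘(ℝ, E) 𝓘(ℝ, E) (Φ x) v₀) x₀ x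
    (by
      simp only [h₀]
      exact (tangentBundleCore 𝓘(ℝ, E) G).coordChange_self _ _ (mem_chart_source E v₀))
    (by simp [h₀])
  exact (DFunLike.congr_fun key ξ).symm

theorem mdifferentiableAt_of_param {F HF N : Type*} [NormedAddCommGroup F] [NormedSpace ℝ F]
    [TopologicalSpace HF] {J : ModelWithCorners ℝ F HF} [TopologicalSpace N] [ChartedSpace HF N]
    {Φ : N → G → ℝ}
    (hΦ : ContMDiff (J.prod 𝓘(ℝ, E)) 𝓘(ℝ) ∞ (Function.uncurry Φ)) (x : N) (v₀ : G) :
    MDifferentiableAt 𝓘(ℝ, E) 𝓘(ℝ) (Φ x) v₀ :=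
  (hΦ.comp (contMDiff_const.prodMk contMDiff_id) :
    ContMDiff 𝓘(ℝ, E) 𝓘(ℝ) ∞ (Φ x)).mdifferentiableAt (by simp)

end Smoothness

/-! ### The Lie group `G`, its Lie algebra and the coadjoint matrices -/

/-- The Lie algebra `𝔤` of `G`. -/
abbrev LieAlg (E G : Type*) [NormedAddCommGroup E] [NormedSpace ℝ E]
    [TopologicalSpace G] [ChartedSpace E G] [Group G] := GroupLieAlgebra 𝓘(ℝ, E) G

section LieGroupData

variable {E G : Type*} [NormedAddCommGroup E] [NormedSpace ℝ E]
  [TopologicalSpace G] [ChartedSpace E G] [Group G] {d : ℕ}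

/-- The structure constants: `⁅J_x, J_y⁆ = ∑ z, f x y z • J_z` for the basis `J = b` of `𝔤`. -/
def structConst (b : Module.Basis (Fin d) ℝ (LieAlg E G)) (x y z : Fin d) : ℝ :=
  b.repr ⁅b x, b y⁆ z

/-- The adjoint action `Ad(u) : 𝔤 → 𝔤`, the derivative at `1` of conjugation by `u`. -/
def Ad (u : G) : LieAlg E G →ₗ[ℝ] LieAlg E G :=
  (mfderiv 𝓘(ℝ, E) 𝓘(ℝ, E) (fun v : G => u * v * u⁻¹) (1 : G) : E →L[ℝ] E).toLinearMap

/-- The matrix `Ad*(u)_x^y = ⟨Ad*(u) P^y, J_x⟩ = ⟨P^y, Ad(u) J_x⟩`, where `Ad*(u)` is the algebraic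
dual of `Ad(u)`, `J = b`, and `P` is the dual basis.  Thus `(Ad*(u) v)_x = ∑ y, Ad*(u)_x^y v_y`. -/
def adStar (b : Module.Basis (Fin d) ℝ (LieAlg E G)) (u : G) (x y : Fin d) : ℝ :=
  b.repr (Ad u (b x)) y

end LieGroupData

/-! ### The loops `M_1, …, M_n, A_1, B_1, …, A_g, B_g` -/

/-- Labels of the generating loops, hence of the copies of `G` (and of `H`). -/
abbrev Loop (n g : ℕ) := Fin n ⊕ (Fin g ⊕ Fin g)

/-- The loop around the `i`-th puncture. -/
abbrev M {n g : ℕ} (i : Fin n) : Loop n g := Sum.inl i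

/-- The first loop of the `i`-th handle. -/
abbrev A {n g : ℕ} (i : Fin g) : Loop n g := Sum.inr (Sum.inl i)

/-- The second loop of the `i`-th handle. -/
abbrev B {n g : ℕ} (i : Fin g) : Loop n g := Sum.inr (Sum.inr i)

/-- `X < Y` in the order `M_1 < … < M_n < A_1, B_1 < … < A_g, B_g` means `level X < level Y`;
the two loops `A_i`, `B_i` of one handle are not comparable. -/
def level {n g : ℕ} : Loop n g → ℕ
  | Sum.inl i => i
  | Sum.inr (Sum.inl i) => n + i
  | Sum.inr (Sum.inr i) => n + i

/-- `(X, Y) = (A_i, B_i)` for some handle `i`. -/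
def IsHandlePair {n g : ℕ} (X Y : Loop n g) : Prop := ∃ i : Fin g, X = A i ∧ Y = B i

/-! ### Smooth functions on `G^(n+2g)` -/

/-- The algebra `C^∞(G^(n+2g))`. -/
abbrev Fun (E G : Type*) [NormedAddCommGroup E] [NormedSpace ℝ E]
    [TopologicalSpace G] [ChartedSpace E G] (n g : ℕ) :=
  C^∞⟮ModelWithCorners.pi (fun _ : Loop n g => 𝓘(ℝ, E)), Loop n g → G; 𝓘(ℝ), ℝ⟯

/-- Smooth maps `G^(n+2g) → G`, a group under pointwise multiplication. -/
abbrev Word (E G : Type*) [NormedAddCommGroup E] [NormedSpace ℝ E]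
    [TopologicalSpace G] [ChartedSpace E G] (n g : ℕ) :=
  C^∞⟮ModelWithCorners.pi (fun _ : Loop n g => 𝓘(ℝ, E)), Loop n g → G; 𝓘(ℝ, E), G⟯

section Functions

variable {E G : Type*} [NormedAddCommGroup E] [NormedSpace ℝ E]
  [TopologicalSpace G] [ChartedSpace E G] [Group G] [LieGroup 𝓘(ℝ, E) ∞ G]
  {d n g : ℕ}

/-- The coordinate map `(u_{M_1}, …, u_{B_g}) ↦ u_X`. -/
def hol (X : Loop n g) : Word E G n g := ⟨fun u => u X, contMDiff_proj X⟩

theorem contMDiff_Ad (ξ : E) :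
    ContMDiff 𝓘(ℝ, E) 𝓘(ℝ, E) ∞ (fun u : G =>
      (mfderiv 𝓘(ℝ, E) 𝓘(ℝ, E) (fun v : G => u * v * u⁻¹) (1 : G) : E →L[ℝ] E) ξ) :=
  contMDiff_partial_fixed (E := E) (J := 𝓘(ℝ, E)) (Φ := fun u v : G => u * v * u⁻¹)
    (1 : G) ((contMDiff_fst.mul contMDiff_snd).mul contMDiff_fst.inv) (by simp) ξ

theorem contMDiff_adStar [FiniteDimensional ℝ E] (b : Module.Basis (Fin d) ℝ (LieAlg E G)) (x y : Fin d) :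
    ContMDiff 𝓘(ℝ, E) 𝓘(ℝ) ∞ (fun u : G => adStar b u x y) := by
  let l : E →ₗ[ℝ] ℝ := b.coord y
  have hl : ContMDiff 𝓘(ℝ, E) 𝓘(ℝ) ∞ (fun ξ : E => LinearMap.toContinuousLinearMap l ξ) :=
    (LinearMap.toContinuousLinearMap l).contMDiff
  have h := contMDiff_Ad (E := E) (G := G) (b x)
  exact hl.comp h

/-- The function `(u_{M_1}, …, u_{B_g}) ↦ Ad*(w(u_{M_1}, …, u_{B_g}))_x^y` in `C^∞(G^(n+2g))`. -/
def adFun [FiniteDimensional ℝ E] (b : Module.Basis (Fin d) ℝ (LieAlg E G)) (w : Word E G n g) (x y : Fin d) :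
    Fun E G n g :=
  ⟨fun u => adStar b (w u) x y, (contMDiff_adStar b x y).comp w.contMDiff⟩

theorem contMDiff_updateR (F : Fun E G n g) (X : Loop n g) :
    ContMDiff ((ModelWithCorners.pi fun _ : Loop n g => 𝓘(ℝ, E)).prod 𝓘(ℝ, E)) 𝓘(ℝ) ∞
      (Function.uncurry fun (u : Loop n g → G) (v : G) =>
        F (Function.update u X (u X * v))) := by
  refine F.contMDiff.comp fun p => contMDiffAt_into_pi.2 fun i => ?_
  by_cases h : i = X
  · subst h
    simpa using! (((contMDiff_proj i).comp contMDiff_fst).mul contMDiff_snd) p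
  · simpa [h] using! ((contMDiff_proj i).comp contMDiff_fst) p

theorem contMDiff_updateL (F : Fun E G n g) (X : Loop n g) :
    ContMDiff ((ModelWithCorners.pi fun _ : Loop n g => 𝓘(ℝ, E)).prod 𝓘(ℝ, E)) 𝓘(ℝ) ∞
      (Function.uncurry fun (u : Loop n g → G) (v : G) =>
        F (Function.update u X (v⁻¹ * u X))) := by
  refine F.contMDiff.comp fun p => contMDiffAt_into_pi.2 fun i => ?_
  by_cases h : i = X
  · subst h
    simpa using! (contMDiff_snd.inv.mul ((contMDiff_proj i).comp contMDiff_fst)) p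
  · simpa [h] using! ((contMDiff_proj i).comp contMDiff_fst) p

/-- The derivation `ξ^{R_X}` of `C^∞(G^(n+2g))`, for `ξ ∈ 𝔤`: the derivative of
`F(…, u_X e^{tξ}, …)` at `t = 0`. -/
def derivR (X : Loop n g) (ξ : LieAlg E G) : Fun E G n g →ₗ[ℝ] Fun E G n g where
  toFun F := ⟨fun u => (mfderiv 𝓘(ℝ, E) 𝓘(ℝ)
      (fun v : G => F (Function.update u X (u X * v))) (1 : G) : E →L[ℝ] ℝ) ξ,
    contMDiff_partial_real (E := E) (1 : G) (contMDiff_updateR F X) ξ⟩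
  map_add' F F' := by
    ext u
    exact DFunLike.congr_fun (mfderiv_add (mdifferentiableAt_of_param (contMDiff_updateR F X) u 1)
      (mdifferentiableAt_of_param (contMDiff_updateR F' X) u 1)) ξ
  map_smul' c F := by
    ext u
    exact DFunLike.congr_fun (const_smul_mfderiv
      (mdifferentiableAt_of_param (contMDiff_updateR F X) u 1) c) ξ

/-- The derivation `ξ^{L_X}` of `C^∞(G^(n+2g))`, for `ξ ∈ 𝔤`: the derivative of
`F(…, e^{-tξ} u_X, …)` at `t = 0`. -/
def derivL (X : Loop n g) (ξ : LieAlg E G) : Fun E G n g →ₗ[ℝ] Fun E G n g where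
  toFun F := ⟨fun u => (mfderiv 𝓘(ℝ, E) 𝓘(ℝ)
      (fun v : G => F (Function.update u X (v⁻¹ * u X))) (1 : G) : E →L[ℝ] ℝ) ξ,
    contMDiff_partial_real (E := E) (1 : G) (contMDiff_updateL F X) ξ⟩
  map_add' F F' := by
    ext u
    exact DFunLike.congr_fun (mfderiv_add (mdifferentiableAt_of_param (contMDiff_updateL F X) u 1)
      (mdifferentiableAt_of_param (contMDiff_updateL F' X) u 1)) ξ
  map_smul' c F := by
    ext u
    exact DFunLike.congr_fun (const_smul_mfderiv
      (mdifferentiableAt_of_param (contMDiff_updateL F X) u 1) c) ξ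

end Functions

/-! ### The commutative algebra `S(⊕ 𝔤) ⊗ C^∞(G^(n+2g))` -/

/-- The algebra `S(⊕_X 𝔤) ⊗ C^∞(G^(n+2g))` underlying the flower algebra. -/
abbrev Flower (E G : Type*) [NormedAddCommGroup E] [NormedSpace ℝ E]
    [TopologicalSpace G] [ChartedSpace E G] [Group G] (n g : ℕ) :=
  SymmetricAlgebra ℝ (Loop n g → LieAlg E G) ⊗[ℝ] Fun E G n g

section Algebra

variable {E G : Type*} [NormedAddCommGroup E] [NormedSpace ℝ E] [FiniteDimensional ℝ E]
  [TopologicalSpace G] [ChartedSpace E G] [Group G] [LieGroup 𝓘(ℝ, E) ∞ G]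
  {d n g : ℕ} (b : Module.Basis (Fin d) ℝ (LieAlg E G))

/-- The basis of `⊕_X 𝔤` consisting of the `j^X_x`. -/
def loopBasis (n g : ℕ) :
    Module.Basis (Σ _ : Loop n g, Fin d) ℝ (Loop n g → LieAlg E G) :=
  Pi.basis fun _ => b

/-- The generator `j^X_x ⊗ 1`. -/
def gen (X : Loop n g) (x : Fin d) : Flower E G n g :=
  SymmetricAlgebra.ι ℝ (Loop n g → LieAlg E G) (loopBasis b n g ⟨X, x⟩) ⊗ₜ[ℝ] (1 : Fun E G n g)

/-- The element `1 ⊗ F`. -/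
def fn (F : Fun E G n g) : Flower E G n g :=
  (1 : SymmetricAlgebra ℝ (Loop n g → LieAlg E G)) ⊗ₜ[ℝ] F

/-- `Ad*(w)` acting on a covector `v = (v_x)` with entries in the flower algebra:
`(Ad*(w) v)_x = ∑ y, Ad*(w)_x^y v_y`. -/
def act (w : Word E G n g) (v : Fin d → Flower E G n g) (x : Fin d) : Flower E G n g :=
  ∑ y, fn (adFun b w x y) * v y

/-! ### Poisson brackets -/

/-- `br` is a Poisson bracket on the commutative algebra `R`. -/
structure IsPoissonBracket {R : Type*} [CommRing R] [Algebra ℝ R] (br : R → R → R) : Prop where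
  add_left : ∀ φ ψ χ, br (φ + ψ) χ = br φ χ + br ψ χ
  smul_left : ∀ (c : ℝ) φ ψ, br (c • φ) ψ = c • br φ ψ
  skew : ∀ φ ψ, br φ ψ = -br ψ φ
  leibniz : ∀ φ ψ χ, br φ (ψ * χ) = br φ ψ * χ + ψ * br φ χ
  jacobi : ∀ φ ψ χ, br φ (br ψ χ) + br ψ (br χ φ) + br χ (br φ ψ) = 0

/-- The partial derivative `∂/∂j^X_x` on `S(⊕ 𝔤) ⊗ C^∞(G^(n+2g))`: polynomials in the `j^X_x`
are differentiated, elements of `C^∞(G^(n+2g))` are treated as constants. -/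
def dGen (X : Loop n g) (x : Fin d) : Flower E G n g →ₗ[ℝ] Flower E G n g :=
  let e := SymmetricAlgebra.equivMvPolynomial (loopBasis b n g)
  LinearMap.rTensor (Fun E G n g)
    (e.symm.toLinearMap ∘ₗ (MvPolynomial.pderiv ⟨X, x⟩).toLinearMap ∘ₗ e.toLinearMap)

/-- Extension of a derivation of `C^∞(G^(n+2g))` to `S(⊕ 𝔤) ⊗ C^∞(G^(n+2g))` by zero on
`S(⊕ 𝔤)`. -/
def dFun (D : Fun E G n g →ₗ[ℝ] Fun E G n g) : Flower E G n g →ₗ[ℝ] Flower E G n g :=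
  LinearMap.lTensor (SymmetricAlgebra ℝ (Loop n g → LieAlg E G)) D

/-- The tail `∑ y, (δ_x^y - Ad*(u_X)_x^y) ∑_{Y > X} (J_y^{R_Y} + J_y^{L_Y})`. -/
def tailDeriv (X : Loop n g) (x : Fin d) : Fun E G n g →ₗ[ℝ] Fun E G n g :=
  ∑ y, LinearMap.mulLeft ℝ ((if x = y then 1 else 0) - adFun b (hol X) x y) ∘ₗ
    ∑ Y : Loop n g, if level X < level Y then derivR Y (b y) + derivL Y (b y) else 0

/-- The derivation `F ↦ {j^X_x, F}` of `C^∞(G^(n+2g))` in the flower algebra. -/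
def flowerGenFun (X : Loop n g) (x : Fin d) : Fun E G n g →ₗ[ℝ] Fun E G n g :=
  match X with
  | Sum.inl i => -(derivR (M i) (b x) + derivL (M i) (b x)) - tailDeriv b (M i) x
  | Sum.inr (Sum.inl i) =>
      -(derivR (A i) (b x) + derivL (A i) (b x)) - (derivR (B i) (b x) + derivL (B i) (b x))
        - (∑ y, LinearMap.mulLeft ℝ (adFun b ((hol (B i))⁻¹ * hol (A i)) x y) ∘ₗ derivR (B i) (b y))
        - tailDeriv b (A i) x
  | Sum.inr (Sum.inr i) =>
      -derivL (A i) (b x) - (derivR (B i) (b x) + derivL (B i) (b x)) - tailDeriv b (B i) x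

/-- The brackets `{j^X_x, j^Y_y}` of the flower algebra in the cases `X = Y`, `(X, Y) = (A_i, B_i)`
and `X < Y`. -/
def flowerGenGenAux (X Y : Loop n g) (x y : Fin d) : Flower E G n g :=
  if level X < level Y then
    -∑ z, ∑ w, structConst b w y z •
      (gen b Y z * fn ((if x = w then 1 else 0) - adFun b (hol X) x w))
  else -∑ z, structConst b x y z • gen b Y z

open Classical in
/-- The brackets `{j^X_x, j^Y_y}` of the flower algebra. -/
def flowerGenGen (X Y : Loop n g) (x y : Fin d) : Flower E G n g :=
  if X = Y ∨ IsHandlePair X Y ∨ level X < level Y then flowerGenGenAux b X Y x y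
  else -flowerGenGenAux b Y X y x

/-- The Poisson bracket of the flower algebra: the biderivation with `{F, F'} = 0` for
`F, F' ∈ C^∞(G^(n+2g))` and with the brackets `{j^X_x, j^Y_y}` and `{j^X_x, F}` given by
`flowerGenGen` and `flowerGenFun`. -/
def flowerBracket (φ ψ : Flower E G n g) : Flower E G n g :=
  (∑ X, ∑ x, ∑ Y, ∑ y, dGen b X x φ * dGen b Y y ψ * flowerGenGen b X Y x y)
    + ∑ X, ∑ x, (dGen b X x φ * dFun (flowerGenFun b X x) ψ
      - dFun (flowerGenFun b X x) φ * dGen b X x ψ)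

/-! ### The decoupling transformation -/

/-- The product `w_{k_r} ⋯ w_{k_1}` over the indices `k_1 < … < k_r` satisfying `p`, taken in
decreasing order of the index from left to right. -/
def descProd {m : ℕ} (p : Fin m → Prop) [DecidablePred p] (w : Fin m → Word E G n g) :
    Word E G n g :=
  (((List.finRange m).filter fun k => decide (p k)).reverse.map w).prod

/-- `u_{K_i} = u_{B_i} u_{A_i}⁻¹ u_{B_i}⁻¹ u_{A_i}`. -/
def uK (i : Fin g) : Word E G n g :=
  hol (B i) * (hol (A i))⁻¹ * (hol (B i))⁻¹ * hol (A i)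

/-- `j^{H_i} = (1 - Ad*(u_A⁻¹ u_B⁻¹ u_A)) j^{A_i} + (Ad*(u_A⁻¹ u_B⁻¹ u_A) - Ad*(u_B⁻¹ u_A)) j^{B_i}`,
where `A = A_i`, `B = B_i`. -/
def genH (i : Fin g) : Fin d → Flower E G n g :=
  let a : Word E G n g := hol (A i)
  let c : Word E G n g := hol (B i)
  (gen b (A i) - act b (a⁻¹ * c⁻¹ * a) (gen b (A i)))
    + (act b (a⁻¹ * c⁻¹ * a) (gen b (B i)) - act b (c⁻¹ * a) (gen b (B i)))

/-- `∑_{k>i} Ad*(u_{M_{k-1}} ⋯ u_{M_{i+1}}) j^{M_k}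
  + ∑_k Ad*(u_{K_{k-1}} ⋯ u_{K_1} u_{M_n} ⋯ u_{M_{i+1}}) j^{H_k}`. -/
def tailM (i : Fin n) : Fin d → Flower E G n g :=
  (∑ k : Fin n, if i < k then
      act b (descProd (fun l => i < l ∧ l < k) fun l => hol (M l)) (gen b (M k)) else 0)
    + ∑ k : Fin g, act b (descProd (fun l => l < k) uK * descProd (fun l => i < l) fun l => hol (M l))
        (genH b k)

/-- `∑_{k>i} Ad*(u_{K_{k-1}} ⋯ u_{K_{i+1}}) j^{H_k}`. -/
def tailH (i : Fin g) : Fin d → Flower E G n g :=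
  ∑ k : Fin g, if i < k then act b (descProd (fun l => i < l ∧ l < k) uK) (genH b k) else 0

/-- The transformed generators `j^{X'}_x`. -/
def primed (X : Loop n g) : Fin d → Flower E G n g :=
  match X with
  | Sum.inl i => gen b (M i) - (tailM b i - act b (hol (M i)) (tailM b i))
  | Sum.inr (Sum.inl i) =>
      gen b (A i) + act b (hol (A i))⁻¹ (gen b (A i) - gen b (B i))
        + (act b (hol (A i)) (tailH b i) - act b (hol (B i) * (hol (A i))⁻¹) (tailH b i))
  | Sum.inr (Sum.inr i) =>
      gen b (B i) + act b (hol (A i))⁻¹ (gen b (A i) - gen b (B i))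
        + (act b (hol (B i)) (tailH b i) - act b (hol (B i) * (hol (A i))⁻¹) (tailH b i))

/-- `(1 - Ad*(u_{A_k}⁻¹)) j^{A_k} + (Ad*(u_{A_k}⁻¹) - Ad*(u_{B_k}⁻¹ u_{A_k})) j^{B_k}`. -/
def invH (k : Fin g) : Fin d → Flower E G n g :=
  (gen b (A k) - act b (hol (A k))⁻¹ (gen b (A k)))
    + (act b (hol (A k))⁻¹ (gen b (B k)) - act b ((hol (B k))⁻¹ * hol (A k)) (gen b (B k)))

/-- `∑_{k>i} j^{M_k}` plus the sum of `invH k` over all handles `k`. -/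
def invTailM (i : Fin n) : Fin d → Flower E G n g :=
  (∑ k : Fin n, if i < k then gen b (M k) else 0) + ∑ k : Fin g, invH b k

/-- The sum of `invH k` over the handles `k > i`. -/
def invTailH (i : Fin g) : Fin d → Flower E G n g :=
  ∑ k : Fin g, if i < k then invH b k else 0

/-- The images of the generators `j^X_x` under the inverse decoupling transformation. -/
def unprimed (X : Loop n g) : Fin d → Flower E G n g :=
  match X with
  | Sum.inl i => gen b (M i) + (invTailM b i - act b (hol (M i)) (invTailM b i))
  | Sum.inr (Sum.inl i) =>
      gen b (A i) - act b (hol (A i))⁻¹ (gen b (A i) - gen b (B i))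
        + (invTailH b i - act b (hol (A i)) (invTailH b i))
  | Sum.inr (Sum.inr i) =>
      gen b (B i) - act b (hol (A i))⁻¹ (gen b (A i) - gen b (B i))
        + (invTailH b i - act b (hol (B i)) (invTailH b i))

/-- The algebra endomorphism with `1 ⊗ F ↦ 1 ⊗ F` and `j^X_x ⊗ 1 ↦ v X x`. -/
def substHom (v : Loop n g → Fin d → Flower E G n g) : Flower E G n g →ₐ[ℝ] Flower E G n g :=
  Algebra.TensorProduct.lift
    (SymmetricAlgebra.lift ((loopBasis b n g).constr ℝ fun p => v p.1 p.2))
    Algebra.TensorProduct.includeRight (fun _ _ => Commute.all _ _)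

/-- The decoupling transformation `K`. -/
def decoupling : Flower E G n g →ₐ[ℝ] Flower E G n g := substHom b (primed b)

/-- The explicit inverse of the decoupling transformation. -/
def decouplingInv : Flower E G n g →ₐ[ℝ] Flower E G n g := substHom b (unprimed b)

end Algebra

/-! ### The group `H = G ⋉ 𝔤*` and the Poisson structures of `H*` and `D_+(H)` -/

/-- The manifold underlying `H = G ⋉ 𝔤*`, with elements `(u, a)`. -/
abbrev HGroup (E G : Type*) [NormedAddCommGroup E] [NormedSpace ℝ E]
    [TopologicalSpace G] [ChartedSpace E G] [Group G] := G × Module.Dual ℝ (LieAlg E G)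

section PoissonStructures

variable {E G : Type*} [NormedAddCommGroup E] [NormedSpace ℝ E]
  [TopologicalSpace G] [ChartedSpace E G] [Group G] {d n g : ℕ}

/-- The multiplication `(u₁, a₁) (u₂, a₂) = (u₁ u₂, a₁ + Ad*(u₁⁻¹) a₂)` of `H`, where
`Ad*(u) a = a ∘ Ad(u)`. -/
def hmul (h k : HGroup E G) : HGroup E G := (h.1 * k.1, h.2 + k.2 ∘ₗ Ad h.1⁻¹)

/-- The covector `j ∈ 𝔤*` with `h = (u, -Ad*(u⁻¹) j)`, that is, `j = -Ad*(u) a` for `h = (u, a)`. -/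
def momentum (h : HGroup E G) : Module.Dual ℝ (LieAlg E G) := -(h.2 ∘ₗ Ad h.1)

variable (b : Module.Basis (Fin d) ℝ (LieAlg E G))

/-- The left-invariant vector field of `P^x`: the derivative of `f(h · tP^x)` at `t = 0`. -/
def PR (x : Fin d) (f : HGroup E G → ℝ) (h : HGroup E G) : ℝ :=
  deriv (fun t : ℝ => f (hmul h (1, t • b.coord x))) 0

/-- The right-invariant vector field of `P^x`: the derivative of `f((-tP^x) · h)` at `t = 0`. -/
def PL (x : Fin d) (f : HGroup E G → ℝ) (h : HGroup E G) : ℝ :=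
  deriv (fun t : ℝ => f (hmul (1, -(t • b.coord x)) h)) 0

/-- The left-invariant vector field of `J_x`: the derivative of `f(h · e^{tJ_x})` at `t = 0`. -/
def JR (x : Fin d) (f : HGroup E G → ℝ) (h : HGroup E G) : ℝ :=
  (mfderiv 𝓘(ℝ, E) 𝓘(ℝ) (fun v : G => f (hmul h (v, 0))) (1 : G) : E →L[ℝ] ℝ) (b x)

/-- The right-invariant vector field of `J_x`: the derivative of `f(e^{-tJ_x} · h)` at `t = 0`. -/
def JL (x : Fin d) (f : HGroup E G → ℝ) (h : HGroup E G) : ℝ :=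
  (mfderiv 𝓘(ℝ, E) 𝓘(ℝ) (fun v : G => f (hmul (v⁻¹, 0) h)) (1 : G) : E →L[ℝ] ℝ) (b x)

/-- The vector field `V` on `H` acting on the first factor of `H × H`. -/
def onFst (V : (HGroup E G → ℝ) → HGroup E G → ℝ)
    (f : HGroup E G × HGroup E G → ℝ) (p : HGroup E G × HGroup E G) : ℝ :=
  V (fun h => f (h, p.2)) p.1

/-- The vector field `V` on `H` acting on the second factor of `H × H`. -/
def onSnd (V : (HGroup E G → ℝ) → HGroup E G → ℝ)
    (f : HGroup E G × HGroup E G → ℝ) (p : HGroup E G × HGroup E G) : ℝ :=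
  V (fun h => f (p.1, h)) p.2

/-- The value `V(f) W(k) - W(f) V(k)` of the bivector `V ∧ W` on two functions. -/
def wedge {Q : Type*} (V W : (Q → ℝ) → Q → ℝ) (f k : Q → ℝ) (q : Q) : ℝ :=
  V f q * W k q - W f q * V k q

/-- The Poisson bracket of the dual Poisson–Lie group `H*`, written on `H`; its bivector is
`½ (P_L^x ∧ J^L_x + P_R^x ∧ J^R_x) + P_R^x ∧ J^L_x`, summed over `x`. -/
def dualBracket (f k : HGroup E G → ℝ) (h : HGroup E G) : ℝ :=
  ∑ x, ((1 / 2 : ℝ) * (wedge (PL b x) (JL b x) f k h + wedge (PR b x) (JR b x) f k h)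
    + wedge (PR b x) (JL b x) f k h)

/-- The Poisson bracket of the Heisenberg double `D_+(H)` on `H × H`; its bivector is
`½ (P_{R₁}^x ∧ J^{R₁}_x + P_{L₁}^x ∧ J^{L₁}_x + P_{R₂}^x ∧ J^{R₂}_x + P_{L₂}^x ∧ J^{L₂}_x)
  + P_{R₁}^x ∧ J^{R₂}_x + P_{L₁}^x ∧ J^{L₂}_x`, summed over `x`. -/
def heisBracket (f k : HGroup E G × HGroup E G → ℝ) (p : HGroup E G × HGroup E G) : ℝ :=
  ∑ x, ((1 / 2 : ℝ) *
      (wedge (onFst (PR b x)) (onFst (JR b x)) f k p + wedge (onFst (PL b x)) (onFst (JL b x)) f k p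
        + wedge (onSnd (PR b x)) (onSnd (JR b x)) f k p
        + wedge (onSnd (PL b x)) (onSnd (JL b x)) f k p)
    + wedge (onFst (PR b x)) (onSnd (JR b x)) f k p
    + wedge (onFst (PL b x)) (onSnd (JL b x)) f k p)

/-- The direct sum on `H^(n+2g)` of `n` copies of the Poisson structure of `H*` (one on the factor
of each puncture) and `g` copies of that of `D_+(H)` (one on the two factors of each handle). -/
def directSumBracket (f k : (Loop n g → HGroup E G) → ℝ) (h : Loop n g → HGroup E G) : ℝ :=
  (∑ i : Fin n, dualBracket b (fun p => f (Function.update h (M i) p))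
      (fun p => k (Function.update h (M i) p)) (h (M i)))
    + ∑ i : Fin g, heisBracket b
        (fun p => f (Function.update (Function.update h (A i) p.1) (B i) p.2))
        (fun p => k (Function.update (Function.update h (A i) p.1) (B i) p.2)) (h (A i), h (B i))

/-- The linear functions on `H^(n+2g)` given by elements of `⊕_X 𝔤` through the momenta. -/
def realizeLin : (Loop n g → LieAlg E G) →ₗ[ℝ] ((Loop n g → HGroup E G) → ℝ) where
  toFun ξ h := ∑ X, momentum (h X) (ξ X)
  map_add' ξ η := by
    funext h
    simp [Finset.sum_add_distrib]
  map_smul' c ξ := by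
    funext h
    simp only [Pi.smul_apply, map_smul, RingHom.id_apply, Finset.smul_sum]

/-- The functions on `H^(n+2g)` given by smooth functions of the `G`-components. -/
def realizeFun : Fun E G n g →ₐ[ℝ] ((Loop n g → HGroup E G) → ℝ) where
  toFun F h := F fun X => (h X).1
  map_one' := rfl
  map_mul' _ _ := rfl
  map_zero' := rfl
  map_add' _ _ := rfl
  commutes' _ := rfl

/-- The elements of `S(⊕ 𝔤) ⊗ C^∞(G^(n+2g))` as functions on `H^(n+2g)`: the generator `j^X_x`
is the function `(u_Y, -Ad*(u_Y⁻¹) j_Y)_Y ↦ ⟨j_X, J_x⟩`. -/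
def realize : Flower E G n g →ₐ[ℝ] ((Loop n g → HGroup E G) → ℝ) :=
  Algebra.TensorProduct.lift (SymmetricAlgebra.lift realizeLin) realizeFun
    (fun _ _ => Commute.all _ _)

end PoissonStructures

end FlowerAlgebra

end

open FlowerAlgebra

/-! The Jacobi identity of the flower bracket is never checked on its own generators. It is pulled
back from a simpler bracket on the same algebra, `decBracket`, for which distinct punctures and
handles commute, along the injective homomorphism `decouplingInv`.

For a decoupled bracket, replace j^A by j^A - j^B at each handle. Then generators at distinct loops
commute, generators at one loop close under the bracket of 𝔤 up to sign, and their actions on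
functions are mutually commuting families of derivations obeying the same relations (`freeFun_self`,
`freeFun_commute`). The Jacobiator of a skew biderivation is a derivation in each slot, so Jacobi on
these generators is enough (`IsSkewBiderivation.isPoissonBracket`).

The link between the two brackets is the total momentum of a block: j^M for a puncture, h_k for a
handle. It conjugates the holonomies of its own block simultaneously, acts on the momenta of that
block by the coadjoint action, and commutes with every other block (`IsDecoupled.blockMom_actsOn`,
`IsDecoupled.actsOn_zero_of_mem_blockAlg`). The image of j^X under the inverse transformation is a
local term plus (1 - Ad*(u_X)) applied to the sum of the total momenta of all later blocks. If X <
Y, the local term and Ad*(u_X) commute with the image of j^Y, while the sum of momenta acts on it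
covariantly; this produces the factor δ - Ad*(u_X) in the flower relations
(`IsDecoupled.coupledGen_of_lt`). Inside one block the relation comes down to one matrix identity
for the coefficient of the tail (`IsDecoupled.coupledGen_of_blockOf_eq`).

Bijectivity is a telescoping argument. The tails in the definition of K satisfy x_i = v_i + Ad*(w_i)
x_{i+1}, and in terms of the transformed generators the difference x_i - x_{i+1} is the total
momentum of block i. Both compositions are computed for generators J in an arbitrary algebra R
(`decoupledGen_coupledGen`, `coupledGen_decoupledGen`) and transferred to K by naturality under
algebra homomorphisms.

For the geometric statement, the invariant vector fields on H^(n+2g) act on realized elements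
through explicit derivations of the flower algebra. Their values on generators show that the direct
sum bracket obeys the decoupled relations, so it agrees with `decBracket`. The realization is
injective because, over fixed holonomies, the momenta take arbitrary values and a polynomial
vanishing everywhere is zero.

The analytic input is `dOne_lie`, the Lie bracket as a commutator of derivatives at 1, together with
`exists_dOne_eq`, by which smooth functions detect elements of 𝔤. They give the multiplicativity of
Ad, its derivative ad, and its compatibility with the bracket. -/

noncomputable section

namespace FlowerAlgebra

set_option linter.unusedSectionVars false

/-! ### Differentiation at the identity of G. -/

section DerivativeAtOne

variable {E G : Type*} [NormedAddCommGroup E] [NormedSpace ℝ E]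
  [TopologicalSpace G] [ChartedSpace E G] [Group G]

/-- The derivative of `φ : G → ℝ` at `1` in the direction `ξ ∈ 𝔤`. -/
def dOne (φ : G → ℝ) (ξ : LieAlg E G) : ℝ :=
  (mfderiv 𝓘(ℝ, E) 𝓘(ℝ) φ (1 : G) : E →L[ℝ] ℝ) ξ

theorem dOne_add_right (φ : G → ℝ) (ξ η : LieAlg E G) : dOne φ (ξ + η) = dOne φ ξ + dOne φ η :=
  map_add (mfderiv 𝓘(ℝ, E) 𝓘(ℝ) φ (1 : G) : E →L[ℝ] ℝ) ξ η

theorem dOne_smul_right (φ : G → ℝ) (c : ℝ) (ξ : LieAlg E G) : dOne φ (c • ξ) = c * dOne φ ξ :=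
  map_smul (mfderiv 𝓘(ℝ, E) 𝓘(ℝ) φ (1 : G) : E →L[ℝ] ℝ) c ξ

/-- `dOne φ` as a linear functional on `𝔤`. -/
def dOneLin (φ : G → ℝ) : LieAlg E G →ₗ[ℝ] ℝ where
  toFun := dOne φ
  map_add' := dOne_add_right φ
  map_smul' := dOne_smul_right φ

theorem dOne_const (c : ℝ) (ξ : LieAlg E G) : dOne (fun _ : G => c) ξ = 0 := by
  unfold dOne
  rw [mfderiv_const]
  rfl

theorem dOne_add {φ ψ : G → ℝ} (hφ : MDifferentiableAt 𝓘(ℝ, E) 𝓘(ℝ) φ (1 : G))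
    (hψ : MDifferentiableAt 𝓘(ℝ, E) 𝓘(ℝ) ψ (1 : G)) (ξ : LieAlg E G) :
    dOne (fun v => φ v + ψ v) ξ = dOne φ ξ + dOne ψ ξ :=
  DFunLike.congr_fun (mfderiv_add hφ hψ) ξ

theorem dOne_mul {φ ψ : G → ℝ} (hφ : MDifferentiableAt 𝓘(ℝ, E) 𝓘(ℝ) φ (1 : G))
    (hψ : MDifferentiableAt 𝓘(ℝ, E) 𝓘(ℝ) ψ (1 : G)) (ξ : LieAlg E G) :
    dOne (fun v => φ v * ψ v) ξ = φ 1 * dOne ψ ξ + ψ 1 * dOne φ ξ := by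
  have h := (hφ.hasMFDerivAt.mul hψ.hasMFDerivAt).mfderiv
  exact DFunLike.congr_fun h ξ

theorem dOne_smul {φ : G → ℝ} (hφ : MDifferentiableAt 𝓘(ℝ, E) 𝓘(ℝ) φ (1 : G)) (c : ℝ)
    (ξ : LieAlg E G) : dOne (fun v => c * φ v) ξ = c * dOne φ ξ :=
  DFunLike.congr_fun (const_smul_mfderiv hφ c) ξ

theorem dOne_congr {φ ψ : G → ℝ} (h : φ =ᶠ[nhds 1] ψ) (ξ : LieAlg E G) : dOne φ ξ = dOne ψ ξ := by
  have e := h.mfderiv_eq (I := 𝓘(ℝ, E)) (I' := 𝓘(ℝ))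
  exact DFunLike.congr_fun e ξ

/-- The tangent space at 1 is modelled on E through the preferred chart at 1, so computing in that
chart involves no change of coordinates. -/
theorem dOne_eq_fderiv {φ : G → ℝ} (hφ : MDifferentiableAt 𝓘(ℝ, E) 𝓘(ℝ) φ (1 : G))
    (ξ : LieAlg E G) :
    dOne φ ξ = fderiv ℝ (fun x : E => φ ((chartAt E (1 : G)).symm x)) (chartAt E (1 : G) 1) ξ := by
  have h := hφ.mfderiv
  simp only [writtenInExtChartAt, extChartAt, mfld_simps, fderivWithin_univ] at h
  exact DFunLike.congr_fun h ξ

end DerivativeAtOne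

/-! ### Second derivatives, the diagonal, inversion and conjugation. -/

section LieGroupDerivative

variable {E G : Type*} [NormedAddCommGroup E] [NormedSpace ℝ E]
  [TopologicalSpace G] [ChartedSpace E G] [Group G]

theorem contDiffAt_chart_symm {F : Type*} [NormedAddCommGroup F] [NormedSpace ℝ F]
    [IsManifold 𝓘(ℝ, E) ∞ G] {φ : G → F} (hφ : ContMDiff 𝓘(ℝ, E) 𝓘(ℝ, F) ∞ φ) (u : G) :
    ContDiffAt ℝ ∞ (fun x : E => φ ((chartAt E u).symm x)) (chartAt E u u) := by
  have h := (contMDiffAt_iff.1 (hφ u)).2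
  simp only [extChartAt, mfld_simps, contDiffWithinAt_univ] at h
  exact h

theorem contDiffAt_chart_symm₂ {F : Type*} [NormedAddCommGroup F] [NormedSpace ℝ F]
    [IsManifold 𝓘(ℝ, E) ∞ G] {Φ : G → G → F}
    (hΦ : ContMDiff (𝓘(ℝ, E).prod 𝓘(ℝ, E)) 𝓘(ℝ, F) ∞ (Function.uncurry Φ)) (u v : G) :
    ContDiffAt ℝ ∞ (fun p : E × E => Φ ((chartAt E u).symm p.1) ((chartAt E v).symm p.2))
      (chartAt E u u, chartAt E v v) := by
  have h := (contMDiffAt_iff.1 (hΦ (u, v))).2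
  simp only [extChartAt, mfld_simps] at h
  rw [Prod.map_id, Set.range_id, contDiffWithinAt_univ] at h
  exact h

variable {F HF M : Type*} [NormedAddCommGroup F] [NormedSpace ℝ F]
    [TopologicalSpace HF] {J : ModelWithCorners ℝ F HF} [TopologicalSpace M] [ChartedSpace HF M]

theorem contMDiff_dOne [IsManifold J ∞ M] [IsManifold 𝓘(ℝ, E) ∞ G] {Φ : M → G → ℝ}
    (hΦ : ContMDiff (J.prod 𝓘(ℝ, E)) 𝓘(ℝ) ∞ (Function.uncurry Φ)) (ξ : LieAlg E G) :
    ContMDiff J 𝓘(ℝ) ∞ (fun x => dOne (Φ x) ξ) :=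
  contMDiff_partial_real (1 : G) hΦ ξ

/-- Expresses an iterated partial derivative through the full second derivative, whose symmetry then
permits interchanging the two variables. -/
theorem fderiv_mixed {Ψ : E × E → ℝ} {x y : E} (h : ContDiffAt ℝ ∞ Ψ (x, y)) (ξ η : E) :
    fderiv ℝ (fun x' => fderiv ℝ (fun y' => Ψ (x', y')) y η) x ξ
      = fderiv ℝ (fderiv ℝ Ψ) (x, y) (ξ, 0) (0, η) := by
  -- The inner derivative is taken at points near (x, y), so differentiability is needed on a
  -- neighbourhood.
  have hd : ∀ᶠ p in nhds (x, y), DifferentiableAt ℝ Ψ p := by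
    have := (h.of_le (m := 1) (by norm_cast)).eventually (by simp)
    exact this.mono fun p hp => hp.differentiableAt (by simp)
  have hc : Filter.Tendsto (fun x' : E => (x', y)) (nhds x) (nhds (x, y)) :=
    (Continuous.prodMk_left y).tendsto x
  have e : (fun x' => fderiv ℝ (fun y' => Ψ (x', y')) y η) =ᶠ[nhds x]
      fun x' => fderiv ℝ Ψ (x', y) (0, η) := by
    filter_upwards [hc.eventually hd] with x' hx'
    have h1 : HasFDerivAt (fun y' : E => (x', y')) (ContinuousLinearMap.inr ℝ E E) y :=
      hasFDerivAt_prodMk_right x' y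
    have := (hx'.hasFDerivAt.comp y h1).fderiv
    simp only [Function.comp_def] at this
    rw [this]; simp
  rw [e.fderiv_eq]
  have h2 : DifferentiableAt ℝ (fderiv ℝ Ψ) (x, y) :=
    (h.fderiv_right (m := 1) (by norm_cast)).differentiableAt (by simp)
  have h1 : HasFDerivAt (fun x' : E => (x', y)) (ContinuousLinearMap.inl ℝ E E) x :=
    hasFDerivAt_prodMk_left x y
  have h3 := (h2.hasFDerivAt.comp x h1).clm_apply (hasFDerivAt_const ((0, η) : E × E) x)
  have h4 := h3.fderiv
  simp only [Function.comp_def] at h4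
  rw [h4]; simp

theorem fderiv_mixed_swap {Ψ : E × E → ℝ} {x y : E} (h : ContDiffAt ℝ ∞ Ψ (x, y)) (ξ η : E) :
    fderiv ℝ (fun x' => fderiv ℝ (fun y' => Ψ (x', y')) y η) x ξ
      = fderiv ℝ (fun y' => fderiv ℝ (fun x' => Ψ (x', y')) x ξ) y η := by
  have hs : ContDiffAt ℝ ∞ (fun q : E × E => Ψ (q.2, q.1)) (y, x) :=
    ContDiffAt.comp (g := Ψ) (y, x) h (contDiffAt_snd.prodMk contDiffAt_fst)
  have hd : ∀ᶠ p in nhds (x, y), DifferentiableAt ℝ Ψ p := by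
    have := (h.of_le (m := 1) (by norm_cast)).eventually (by simp)
    exact this.mono fun p hp => hp.differentiableAt (by simp)
  have hc : Filter.Tendsto (fun y' : E => (x, y')) (nhds y) (nhds (x, y)) :=
    (Continuous.prodMk_right x).tendsto y
  have e : (fun y' => fderiv ℝ (fun x' => Ψ (x', y')) x ξ) =ᶠ[nhds y]
      fun y' => fderiv ℝ Ψ (x, y') (ξ, 0) := by
    filter_upwards [hc.eventually hd] with y' hy'
    have h1 : HasFDerivAt (fun x' : E => (x', y')) (ContinuousLinearMap.inl ℝ E E) x :=
      hasFDerivAt_prodMk_left x y'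
    have := (hy'.hasFDerivAt.comp x h1).fderiv
    simp only [Function.comp_def] at this
    rw [this]; simp
  rw [fderiv_mixed h, e.fderiv_eq]
  have h2 : DifferentiableAt ℝ (fderiv ℝ Ψ) (x, y) :=
    (h.fderiv_right (m := 1) (by norm_cast)).differentiableAt (by simp)
  have h1 : HasFDerivAt (fun y' : E => (x, y')) (ContinuousLinearMap.inr ℝ E E) y :=
    hasFDerivAt_prodMk_right x y
  have h3 := ((h2.hasFDerivAt.comp y h1).clm_apply (hasFDerivAt_const ((ξ, 0) : E × E) y)).fderiv
  simp only [Function.comp_def] at h3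
  rw [h3]
  have hsym : IsSymmSndFDerivAt ℝ Ψ (x, y) := h.isSymmSndFDerivAt (by simpa using (by norm_cast))
  simpa using hsym (ξ, 0) (0, η)

variable [LieGroup 𝓘(ℝ, E) ∞ G]

theorem mdifferentiableAt_left {Φ : G → G → ℝ}
    (hΦ : ContMDiff (𝓘(ℝ, E).prod 𝓘(ℝ, E)) 𝓘(ℝ) ∞ (Function.uncurry Φ)) (u v : G) :
    MDifferentiableAt 𝓘(ℝ, E) 𝓘(ℝ) (fun u => Φ u v) u :=
  (hΦ.comp (contMDiff_id.prodMk contMDiff_const) :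
    ContMDiff 𝓘(ℝ, E) 𝓘(ℝ) ∞ (fun u => Φ u v)).mdifferentiableAt (by simp)

theorem dOne_comm {Φ : G → G → ℝ}
    (hΦ : ContMDiff (𝓘(ℝ, E).prod 𝓘(ℝ, E)) 𝓘(ℝ) ∞ (Function.uncurry Φ)) (ξ η : LieAlg E G) :
    dOne (fun v => dOne (fun w => Φ v w) η) ξ = dOne (fun w => dOne (fun v => Φ v w) ξ) η := by
  have : IsManifold 𝓘(ℝ, E) ∞ G := inferInstance
  have hs : ContMDiff (𝓘(ℝ, E).prod 𝓘(ℝ, E)) 𝓘(ℝ) ∞ (Function.uncurry fun w v => Φ v w) :=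
    hΦ.comp (contMDiff_snd.prodMk contMDiff_fst)
  rw [dOne_eq_fderiv ((contMDiff_dOne hΦ η).mdifferentiableAt (by simp)),
    dOne_eq_fderiv ((contMDiff_dOne hs ξ).mdifferentiableAt (by simp))]
  have e1 : ∀ v, dOne (fun w => Φ v w) η = fderiv ℝ (fun y => Φ v ((chartAt E (1 : G)).symm y))
      (chartAt E (1 : G) 1) η :=
    fun v => dOne_eq_fderiv (mdifferentiableAt_of_param hΦ v 1) η
  have e2 : ∀ w, dOne (fun v => Φ v w) ξ = fderiv ℝ (fun y => Φ ((chartAt E (1 : G)).symm y) w)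
      (chartAt E (1 : G) 1) ξ :=
    fun w => dOne_eq_fderiv (mdifferentiableAt_left hΦ 1 w) ξ
  simp only [e1, e2]
  exact fderiv_mixed_swap (contDiffAt_chart_symm₂ hΦ 1 1) _ _

/-- The chain rule along v ↦ (v, v), carried out in the chart: the tangent vector (ξ, ξ) splits as
(ξ, 0) + (0, ξ). Several later product rules on G are instances of this. -/
theorem dOne_diag {Φ : G → G → ℝ}
    (hΦ : ContMDiff (𝓘(ℝ, E).prod 𝓘(ℝ, E)) 𝓘(ℝ) ∞ (Function.uncurry Φ)) (ξ : LieAlg E G) :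
    dOne (fun v => Φ v v) ξ = dOne (fun v => Φ v 1) ξ + dOne (fun w => Φ 1 w) ξ := by
  have hd : ContMDiff 𝓘(ℝ, E) 𝓘(ℝ) ∞ (fun v => Φ v v) := hΦ.comp (contMDiff_id.prodMk contMDiff_id)
  rw [dOne_eq_fderiv (hd.mdifferentiableAt (by simp)), dOne_eq_fderiv (mdifferentiableAt_left hΦ 1 1),
    dOne_eq_fderiv (mdifferentiableAt_of_param hΦ 1 1)]
  have h := contDiffAt_chart_symm₂ hΦ 1 1
  have hh := (h.differentiableAt (by simp)).hasFDerivAt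
  set x₀ := chartAt E (1 : G) 1
  have k0 := (hh.comp x₀ (f := fun x : E => (x, x)) ((hasFDerivAt_id x₀).prodMk (hasFDerivAt_id x₀))).fderiv
  have k1 := (hh.comp x₀ (f := fun x : E => (x, x₀)) (hasFDerivAt_prodMk_left x₀ x₀)).fderiv
  have k2 := (hh.comp x₀ (f := fun x : E => (x₀, x)) (hasFDerivAt_prodMk_right x₀ x₀)).fderiv
  have hx : (chartAt E (1 : G)).symm x₀ = 1 := (chartAt E (1 : G)).left_inv (mem_chart_source E 1)
  simp only [Function.comp_def, hx] at k0 k1 k2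
  rw [k0, k1, k2]
  have e : ∀ ζ : E, ((ζ, ζ) : E × E) = ((ζ, 0) : E × E) + ((0, ζ) : E × E) := fun ζ => by simp
  refine (congrArg _ (e ξ)).trans ?_
  exact map_add (fderiv ℝ _ (x₀, x₀)) ((ξ, 0) : E × E) ((0, ξ) : E × E)

/-- Apply `dOne_diag` to φ(v w⁻¹), which is constant on the diagonal. -/
theorem dOne_inv {φ : G → ℝ} (hφ : ContMDiff 𝓘(ℝ, E) 𝓘(ℝ) ∞ φ) (ξ : LieAlg E G) :
    dOne (fun v => φ v⁻¹) ξ = -dOne φ ξ := by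
  have h : ContMDiff (𝓘(ℝ, E).prod 𝓘(ℝ, E)) 𝓘(ℝ) ∞ (Function.uncurry fun v w : G => φ (v * w⁻¹)) :=
    hφ.comp (contMDiff_fst.mul contMDiff_snd.inv)
  have := dOne_diag h ξ
  simp only [mul_inv_cancel, dOne_const, inv_one, mul_one, one_mul] at this
  linarith

theorem contMDiff_conj (u : G) : ContMDiff 𝓘(ℝ, E) 𝓘(ℝ, E) ∞ (fun v : G => u * v * u⁻¹) :=
  (contMDiff_const.mul contMDiff_id).mul contMDiff_const

theorem dOne_conj {φ : G → ℝ} (hφ : ContMDiff 𝓘(ℝ, E) 𝓘(ℝ) ∞ φ) (u : G) (ξ : LieAlg E G) :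
    dOne (fun v => φ (u * v * u⁻¹)) ξ = dOne φ (Ad u ξ) := by
  have h := mfderiv_comp (I := 𝓘(ℝ, E)) (I' := 𝓘(ℝ, E)) (I'' := 𝓘(ℝ)) (1 : G) (g := φ)
    (f := fun v : G => u * v * u⁻¹)
    (hφ.mdifferentiableAt (by simp)) ((contMDiff_conj u).mdifferentiableAt (by simp))
  have e : u * 1 * u⁻¹ = 1 := by simp
  unfold dOne Ad
  refine (DFunLike.congr_fun h ξ).trans ?_
  -- The chain rule differentiates φ at u·1·u⁻¹, which equals 1 only propositionally; the derivative
  -- is moved to 1 by substitution, all tangent spaces being E.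
  have key : ∀ u', u' = (1 : G) → ∀ ζ : E,
      (mfderiv 𝓘(ℝ, E) 𝓘(ℝ) φ u' : E →L[ℝ] ℝ) ζ = (mfderiv 𝓘(ℝ, E) 𝓘(ℝ) φ 1 : E →L[ℝ] ℝ) ζ := by
    rintro _ rfl _
    rfl
  exact key _ e _

end LieGroupDerivative

/-! ### The Lie bracket as a commutator of derivatives. -/

section LieBracketDerivative

variable {E G : Type*} [NormedAddCommGroup E] [NormedSpace ℝ E]
  [TopologicalSpace G] [ChartedSpace E G] [Group G] [LieGroup 𝓘(ℝ, E) ∞ G]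

/-- The regularity at which `GroupLieAlgebra` carries its Lie algebra structure; later proofs
introduce it as a local instance. -/
theorem lieGroup_minSmoothness : LieGroup 𝓘(ℝ, E) (minSmoothness ℝ 3) G :=
  LieGroup.of_le (n := ∞) (by
    rw [minSmoothness_of_isRCLikeNormedField]; norm_cast)

/-- The representative in the chart at `1` of the left-invariant vector field of `ξ`. -/
def chartField (ξ : LieAlg E G) : E → E :=
  VectorField.mpullbackWithin 𝓘(ℝ, E) 𝓘(ℝ, E) (extChartAt 𝓘(ℝ, E) (1 : G)).symm
    (mulInvariantVectorField (I := 𝓘(ℝ, E)) ξ) (Set.range 𝓘(ℝ, E))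

theorem mulInvariantVectorField_at_one (ξ : LieAlg E G) :
    mulInvariantVectorField (I := 𝓘(ℝ, E)) ξ (1 : G) = ξ := by
  have h : mfderiv 𝓘(ℝ, E) 𝓘(ℝ, E) (fun v : G => 1 * v) (1 : G)
      = mfderiv 𝓘(ℝ, E) 𝓘(ℝ, E) (id : G → G) (1 : G) := by
    congr 1; funext v; simp
  have h2 := h.trans mfderiv_id
  exact DFunLike.congr_fun h2 ξ

theorem chartField_at_one (ξ : LieAlg E G) :
    chartField ξ (extChartAt 𝓘(ℝ, E) (1 : G) 1) = ξ := by
  have h0 : IsManifold 𝓘(ℝ, E) 1 G := IsManifold.of_le (n := ∞) (by norm_cast)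
  have h1 : (extChartAt 𝓘(ℝ, E) (1 : G)).symm (extChartAt 𝓘(ℝ, E) (1 : G) 1) = 1 :=
    extChartAt_to_inv (I := 𝓘(ℝ, E)) (1 : G)
  have h2 := mfderivWithin_extChartAt_symm_inverse_apply (I := 𝓘(ℝ, E)) (x := (1 : G))
    (mulInvariantVectorField (I := 𝓘(ℝ, E)) ξ (1 : G))
  have key : ∀ u : G, u = 1 → (mulInvariantVectorField (I := 𝓘(ℝ, E)) ξ u : E) = ξ := by
    rintro _ rfl
    exact mulInvariantVectorField_at_one ξ
  have h3 : (mulInvariantVectorField (I := 𝓘(ℝ, E)) ξ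
      ((extChartAt 𝓘(ℝ, E) (1 : G)).symm (extChartAt 𝓘(ℝ, E) (1 : G) 1)) : E) = ξ := key _ h1
  have h4 : (ContinuousLinearMap.inverse (mfderivWithin 𝓘(ℝ, E) 𝓘(ℝ, E)
      (extChartAt 𝓘(ℝ, E) (1 : G)).symm (Set.range 𝓘(ℝ, E)) (extChartAt 𝓘(ℝ, E) (1 : G) 1) :
        E →L[ℝ] E)) = ContinuousLinearMap.id ℝ E := by
    have := mfderivWithin_range_extChartAt_symm (I := 𝓘(ℝ, E)) (x := (1 : G))
    exact (congrArg (ContinuousLinearMap.inverse (M := E) (M₂ := E) (R := ℝ)) this).trans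
      ContinuousLinearMap.inverse_id
  exact (DFunLike.congr_fun h4 _).trans h3

/-- The derivative at 1 of the preferred chart is the identity, so the bracket of invariant fields
at 1 is the vector space bracket of their chart representatives. -/
theorem bracket_eq_lieBracket [CompleteSpace E] (ξ η : LieAlg E G) :
    (⁅ξ, η⁆ : LieAlg E G) = VectorField.lieBracket ℝ (chartField ξ) (chartField η)
      (extChartAt 𝓘(ℝ, E) (1 : G) 1) := by
  have h0 : IsManifold 𝓘(ℝ, E) 1 G := IsManifold.of_le (n := ∞) (by norm_cast)
  have h4 : (ContinuousLinearMap.inverse (mfderiv 𝓘(ℝ, E) 𝓘(ℝ, E)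
      (extChartAt 𝓘(ℝ, E) (1 : G)) 1 : E →L[ℝ] E)) = ContinuousLinearMap.id ℝ E := by
    have := mfderiv_extChartAt_self (I := 𝓘(ℝ, E)) (x := (1 : G))
    exact (congrArg (ContinuousLinearMap.inverse (M := E) (M₂ := E) (R := ℝ)) this).trans
      ContinuousLinearMap.inverse_id
  rw [GroupLieAlgebra.bracket_def]
  refine (DFunLike.congr_fun h4 _).trans ?_
  have : (extChartAt 𝓘(ℝ, E) (1 : G)).symm ⁻¹' Set.univ ∩ Set.range 𝓘(ℝ, E) = Set.univ := by simp
  rw [← VectorField.lieBracketWithin_univ, ← this]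
  rfl

theorem differentiableAt_chartField [CompleteSpace E] (ξ : LieAlg E G) :
    DifferentiableAt ℝ (chartField ξ) (extChartAt 𝓘(ℝ, E) (1 : G) 1) := by
  have h0 : IsManifold 𝓘(ℝ, E) 2 G := IsManifold.of_le (n := ∞) (by norm_cast)
  have h3 : LieGroup 𝓘(ℝ, E) (minSmoothness ℝ 3) G := lieGroup_minSmoothness
  have h := (mdifferentiableAt_mulInvariantVectorField (I := 𝓘(ℝ, E)) ξ
    (g := (1 : G))).mdifferentiableWithinAt (s := Set.univ)
  have h' := h.differentiableWithinAt_mpullbackWithin_vectorField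
  have h'' : DifferentiableWithinAt ℝ (chartField ξ)
      ((extChartAt 𝓘(ℝ, E) (1 : G)).symm ⁻¹' Set.univ ∩ Set.range 𝓘(ℝ, E))
      (extChartAt 𝓘(ℝ, E) (1 : G) 1) := h'
  rwa [Set.preimage_univ, Set.univ_inter, modelWithCornersSelf_coe, Set.range_id,
    differentiableWithinAt_univ] at h''

/-- A left-invariant field at u is the pushforward of ξ under left translation, so differentiating φ
along it means differentiating φ(u v) at v = 1. -/
theorem fderiv_chartField {φ : G → ℝ} (hφ : ContMDiff 𝓘(ℝ, E) 𝓘(ℝ) ∞ φ) (ξ : LieAlg E G)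
    {x : E} (hx : x ∈ (extChartAt 𝓘(ℝ, E) (1 : G)).target) :
    fderiv ℝ (fun x : E => φ ((extChartAt 𝓘(ℝ, E) (1 : G)).symm x)) x (chartField (E := E) (G := G) ξ x)
      = dOne (fun v => φ ((extChartAt 𝓘(ℝ, E) (1 : G)).symm x * v)) ξ := by
  have h0 : IsManifold 𝓘(ℝ, E) 1 G := IsManifold.of_le (n := ∞) (by norm_cast)
  set u := (extChartAt 𝓘(ℝ, E) (1 : G)).symm x with hu
  have hd : MDifferentiableAt 𝓘(ℝ, E) 𝓘(ℝ) φ u := hφ.mdifferentiableAt (by simp)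
  have h1 := mfderiv_comp_of_eq (I := 𝓘(ℝ, E)) (I' := 𝓘(ℝ, E)) (I'' := 𝓘(ℝ)) (x := (1 : G)) (g := φ)
    (f := fun v : G => u * v) (y := u) hd
    ((contMDiff_const.mul contMDiff_id : ContMDiff 𝓘(ℝ, E) 𝓘(ℝ, E) ∞
      (fun v : G => u * v)).mdifferentiableAt (by simp)) (by simp)
  have hs := mdifferentiableWithinAt_extChartAt_symm (I := 𝓘(ℝ, E)) (x := (1 : G)) hx
  have h2 := mfderiv_comp_mfderivWithin (I := 𝓘(ℝ, E)) (I' := 𝓘(ℝ, E)) (I'' := 𝓘(ℝ)) (x := x)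
    (s := Set.range 𝓘(ℝ, E)) (g := φ) (f := (extChartAt 𝓘(ℝ, E) (1 : G)).symm) hd hs
    (by simpa using! uniqueMDiffWithinAt_univ 𝓘(ℝ, E))
  have h3 : mfderivWithin 𝓘(ℝ, E) 𝓘(ℝ) (φ ∘ (extChartAt 𝓘(ℝ, E) (1 : G)).symm)
      (Set.range 𝓘(ℝ, E)) x = fderiv ℝ (φ ∘ (extChartAt 𝓘(ℝ, E) (1 : G)).symm) x := by
    rw [mfderivWithin_eq_fderivWithin]; simp; rfl
  have h4 := (isInvertible_mfderivWithin_extChartAt_symm (I := 𝓘(ℝ, E)) (x := (1 : G)) hx)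
  have h5 := h4.self_comp_inverse
  have e1 : fderiv ℝ (φ ∘ (extChartAt 𝓘(ℝ, E) (1 : G)).symm) x (chartField (E := E) (G := G) ξ x)
      = (mfderiv 𝓘(ℝ, E) 𝓘(ℝ) φ u : E →L[ℝ] ℝ) ((mfderivWithin 𝓘(ℝ, E) 𝓘(ℝ, E)
        (extChartAt 𝓘(ℝ, E) (1 : G)).symm (Set.range 𝓘(ℝ, E)) x : E →L[ℝ] E) (chartField (E := E) (G := G) ξ x)) :=
    DFunLike.congr_fun (h3.symm.trans h2) (chartField (E := E) (G := G) ξ x)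
  -- The chart representative is defined with the inverse of the derivative of the inverse chart, so
  -- the two cancel and leave the invariant field.
  have e2 : (mfderivWithin 𝓘(ℝ, E) 𝓘(ℝ, E)
        (extChartAt 𝓘(ℝ, E) (1 : G)).symm (Set.range 𝓘(ℝ, E)) x : E →L[ℝ] E) (chartField (E := E) (G := G) ξ x)
        = mulInvariantVectorField (I := 𝓘(ℝ, E)) ξ u :=
    DFunLike.congr_fun h5 _
  have e3 := DFunLike.congr_fun h1 ξ
  rw [e2] at e1
  have key : ∀ u', u' = u → ∀ ζ : E,
      (mfderiv 𝓘(ℝ, E) 𝓘(ℝ) φ u' : E →L[ℝ] ℝ) ζ = (mfderiv 𝓘(ℝ, E) 𝓘(ℝ) φ u : E →L[ℝ] ℝ) ζ := by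
    rintro _ rfl _
    rfl
  exact e1.trans (e3.trans (key _ (mul_one u) _)).symm

/-- In the chart at 1 this is the formula for the derivative of a function along the bracket of two
vector fields, with each directional derivative rewritten by left-invariance. -/
theorem dOne_lie [CompleteSpace E] {φ : G → ℝ} (hφ : ContMDiff 𝓘(ℝ, E) 𝓘(ℝ) ∞ φ) (ξ η : LieAlg E G) :
    dOne φ ⁅ξ, η⁆ = dOne (fun v => dOne (fun w => φ (v * w)) η) ξ
      - dOne (fun v => dOne (fun w => φ (v * w)) ξ) η := by
  have hm : ContMDiff (𝓘(ℝ, E).prod 𝓘(ℝ, E)) 𝓘(ℝ) ∞ (Function.uncurry fun v w : G => φ (v * w)) :=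
    hφ.comp (contMDiff_fst.mul contMDiff_snd)
  rw [dOne_eq_fderiv (hφ.mdifferentiableAt (by simp)),
    dOne_eq_fderiv ((contMDiff_dOne hm η).mdifferentiableAt (by simp)),
    dOne_eq_fderiv ((contMDiff_dOne hm ξ).mdifferentiableAt (by simp))]
  have hp : ContDiffAt ℝ ∞ (fun x : E => φ ((chartAt E (1 : G)).symm x)) (chartAt E (1 : G) 1) :=
    contDiffAt_chart_symm hφ 1
  have key := VectorField.fderiv_apply_lieBracket (V := chartField ξ) (W := chartField η) hp
    (by rw [minSmoothness_of_isRCLikeNormedField]; norm_cast)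
    (differentiableAt_chartField η) (differentiableAt_chartField ξ)
  -- The identity must hold near the base point, since both sides are differentiated once more.
  have ev : ∀ ζ : LieAlg E G, (fun x => fderiv ℝ (fun x : E => φ ((chartAt E (1 : G)).symm x)) x
      (chartField ζ x)) =ᶠ[nhds (chartAt E (1 : G) 1)]
      fun x => dOne (fun v => φ ((chartAt E (1 : G)).symm x * v)) ζ := by
    intro ζ
    have ht : (extChartAt 𝓘(ℝ, E) (1 : G)).target ∈ nhds (extChartAt 𝓘(ℝ, E) (1 : G) 1) :=
      extChartAt_target_mem_nhds (1 : G)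
    filter_upwards [ht] with x hx
    exact fderiv_chartField hφ ζ hx
  rw [(ev ξ).fderiv_eq, (ev η).fderiv_eq] at key
  have c1 := chartField_at_one ξ
  have c2 := chartField_at_one η
  have c3 := bracket_eq_lieBracket ξ η
  simp only [extChartAt, mfld_simps] at c1 c2 c3
  rw [c1, c2, ← c3] at key
  exact key

/-- Compose l with the chart at 1 and cut off by a bump function. This makes a linear functional on
𝔤 accessible to the calculus of smooth functions on G. -/
theorem exists_dOne_eq [FiniteDimensional ℝ E] (l : LieAlg E G →ₗ[ℝ] ℝ) :
    ∃ φ : G → ℝ, ContMDiff 𝓘(ℝ, E) 𝓘(ℝ) ∞ φ ∧ ∀ ξ, dOne φ ξ = l ξ := by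
  -- G is locally Euclidean, hence T1; a T1 topological group is Hausdorff, as the bump function
  -- argument requires.
  have : T1Space G := ChartedSpace.t1Space E G
  have : IsTopologicalGroup G := topologicalGroup_of_lieGroup 𝓘(ℝ, E) ∞
  have : T2Space G := inferInstance
  let lc : E →L[ℝ] ℝ := LinearMap.toContinuousLinearMap (l : E →ₗ[ℝ] ℝ)
  let f : SmoothBumpFunction 𝓘(ℝ, E) (1 : G) := Classical.arbitrary _
  have hc : ContMDiffOn 𝓘(ℝ, E) 𝓘(ℝ) ∞ (fun v : G => lc (extChartAt 𝓘(ℝ, E) (1 : G) v))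
      (chartAt E (1 : G)).source :=
    lc.contMDiff.comp_contMDiffOn contMDiffOn_extChartAt
  have hs : ContMDiff 𝓘(ℝ, E) 𝓘(ℝ) ∞ (fun v : G => f v • lc (extChartAt 𝓘(ℝ, E) (1 : G) v)) :=
    f.contMDiff_smul hc
  refine ⟨_, hs, fun ξ => ?_⟩
  have e : (fun v : G => f v • lc (extChartAt 𝓘(ℝ, E) (1 : G) v)) =ᶠ[nhds 1]
      fun v => lc (extChartAt 𝓘(ℝ, E) (1 : G) v) := by
    filter_upwards [f.eventuallyEq_one] with v hv
    simp [hv]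
  have hd : MDifferentiableAt 𝓘(ℝ, E) 𝓘(ℝ) (fun v : G => lc (extChartAt 𝓘(ℝ, E) (1 : G) v)) 1 :=
    (hs.mdifferentiableAt (by simp)).congr_of_eventuallyEq e.symm
  rw [dOne_congr e, dOne_eq_fderiv hd]
  have e2 : (fun x : E => lc (extChartAt 𝓘(ℝ, E) (1 : G) ((chartAt E (1 : G)).symm x)))
      =ᶠ[nhds (chartAt E (1 : G) 1)] lc := by
    filter_upwards [(chartAt E (1 : G)).open_target.mem_nhds (mem_chart_target E (1 : G))] with x hx
    simp [extChartAt, (chartAt E (1 : G)).right_inv hx]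
  rw [e2.fderiv_eq, lc.fderiv]
  rfl

end LieBracketDerivative

/-! ### The adjoint action, its derivative and its matrix. -/

section AdjointAction

variable {E G : Type*} [NormedAddCommGroup E] [NormedSpace ℝ E] [FiniteDimensional ℝ E]
  [TopologicalSpace G] [ChartedSpace E G] [Group G] [LieGroup 𝓘(ℝ, E) ∞ G]

/-- The dual separates points of 𝔤, and every functional is the derivative of a smooth function.
Identities in 𝔤 can therefore be tested on functions. -/
theorem eq_of_forall_dOne {ξ η : LieAlg E G}
    (h : ∀ φ : G → ℝ, ContMDiff 𝓘(ℝ, E) 𝓘(ℝ) ∞ φ → dOne φ ξ = dOne φ η) : ξ = η := by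
  have h2 : ∀ l : Module.Dual ℝ (LieAlg E G), l (ξ - η) = 0 := by
    intro l
    obtain ⟨φ, hφ, hl⟩ := exists_dOne_eq (E := E) (G := G) l
    rw [map_sub, ← hl, ← hl, h φ hφ, sub_self]
  exact sub_eq_zero.1 ((Module.forall_dual_apply_eq_zero_iff ℝ _).1 h2)

theorem Ad_mul (u v : G) (ξ : LieAlg E G) : Ad (u * v) ξ = Ad u (Ad v ξ) := by
  refine eq_of_forall_dOne fun φ hφ => ?_
  rw [← dOne_conj hφ, ← dOne_conj hφ]
  refine Eq.trans ?_ (dOne_conj (hφ.comp (contMDiff_conj u)) v ξ)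
  congr 1
  funext w
  simp [mul_assoc]

theorem Ad_one (ξ : LieAlg E G) : Ad (1 : G) ξ = ξ := by
  refine eq_of_forall_dOne fun φ hφ => ?_
  rw [← dOne_conj hφ]
  simp

theorem Ad_inv_apply (u : G) (ξ : LieAlg E G) : Ad u⁻¹ (Ad u ξ) = ξ := by
  rw [← Ad_mul, inv_mul_cancel, Ad_one]

theorem contMDiff_dual_Ad (l : LieAlg E G →ₗ[ℝ] ℝ) (η : LieAlg E G) :
    ContMDiff 𝓘(ℝ, E) 𝓘(ℝ) ∞ (fun u : G => l (Ad u η)) := by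
  let l' : E →ₗ[ℝ] ℝ := l
  have hl : ContMDiff 𝓘(ℝ, E) 𝓘(ℝ) ∞ (fun ξ : E => LinearMap.toContinuousLinearMap l' ξ) :=
    (LinearMap.toContinuousLinearMap l').contMDiff
  exact hl.comp (contMDiff_Ad (E := E) (G := G) η)

/-- Write l as the derivative of φ, so that l(Ad(v)η) is the derivative of φ(v w v⁻¹) in w. Varying
the two occurrences of v separately gives the two terms of `dOne_lie`, the inverse supplying the
minus sign. -/
theorem dOne_Ad (l : LieAlg E G →ₗ[ℝ] ℝ) (ξ η : LieAlg E G) :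
    dOne (fun v : G => l (Ad v η)) ξ = l ⁅ξ, η⁆ := by
  have : CompleteSpace E := FiniteDimensional.complete ℝ E
  obtain ⟨φ, hφ, hl⟩ := exists_dOne_eq (E := E) (G := G) l
  simp only [← hl]
  have h3 : ContMDiff ((𝓘(ℝ, E).prod 𝓘(ℝ, E)).prod 𝓘(ℝ, E)) 𝓘(ℝ) ∞
      (Function.uncurry fun (p : G × G) w => φ (p.1 * w * p.2⁻¹)) :=
    hφ.comp (((contMDiff_fst.comp contMDiff_fst).mul contMDiff_snd).mul
      (contMDiff_snd.comp contMDiff_fst).inv)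
  -- The factors v and v'⁻¹ become independent variables; `dOne_diag` puts them together again.
  have h2 : ContMDiff (𝓘(ℝ, E).prod 𝓘(ℝ, E)) 𝓘(ℝ) ∞
      (Function.uncurry fun v v' : G => dOne (fun w => φ (v * w * v'⁻¹)) η) :=
    contMDiff_dOne h3 η
  have hd := dOne_diag h2 ξ
  have hs : ContMDiff (𝓘(ℝ, E).prod 𝓘(ℝ, E)) 𝓘(ℝ) ∞
      (Function.uncurry fun v w : G => φ (w * v⁻¹)) :=
    hφ.comp (contMDiff_snd.mul contMDiff_fst.inv)
  have hc := dOne_comm hs ξ η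
  have e : ∀ w, dOne (fun v => φ (w * v⁻¹)) ξ = -dOne (fun v => φ (w * v)) ξ := fun w =>
    dOne_inv (φ := fun v => φ (w * v)) (hφ.comp (contMDiff_const.mul contMDiff_id)) ξ
  have hm : ContMDiff (𝓘(ℝ, E).prod 𝓘(ℝ, E)) 𝓘(ℝ) ∞ (Function.uncurry fun v w : G => φ (v * w)) :=
    hφ.comp (contMDiff_fst.mul contMDiff_snd)
  have hn := dOne_smul ((contMDiff_dOne hm ξ).mdifferentiableAt (x := 1) (by simp)) (-1) η
  simp only [e] at hc
  simp only [neg_one_mul] at hn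
  simp only [inv_one, mul_one, one_mul] at hd
  rw [hc, hn] at hd
  rw [dOne_lie hφ]
  simp only [← dOne_conj hφ]
  rw [hd]
  ring

/-- Both sides arise by differentiating Ad(u v u⁻¹) Ad(u) η = Ad(u) Ad(v) η at v = 1 in the
direction ξ. -/
theorem Ad_lie (u : G) (ξ η : LieAlg E G) : Ad u ⁅ξ, η⁆ = ⁅Ad u ξ, Ad u η⁆ := by
  refine eq_of_forall_dOne fun φ hφ => ?_
  have h1 := dOne_Ad (dOneLin φ ∘ₗ Ad u) ξ η
  have h2 := dOne_Ad (dOneLin φ) (Ad u ξ) (Ad u η)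
  refine h1.symm.trans (Eq.trans ?_ h2)
  rw [← dOne_conj (contMDiff_dual_Ad _ _)]
  congr 1
  funext v
  simp only [LinearMap.comp_apply]
  rw [← Ad_mul, ← Ad_mul]
  simp

theorem dOne_Ad_inv (l : LieAlg E G →ₗ[ℝ] ℝ) (ξ η : LieAlg E G) :
    dOne (fun v : G => l (Ad v⁻¹ η)) ξ = -l ⁅ξ, η⁆ := by
  rw [← dOne_Ad]
  exact dOne_inv (contMDiff_dual_Ad l η) ξ

variable {d : ℕ} (b : Module.Basis (Fin d) ℝ (LieAlg E G))

theorem lie_eq_sum (x y : Fin d) : ⁅b x, b y⁆ = ∑ z, structConst b x y z • b z :=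
  (b.sum_repr _).symm

theorem Ad_eq_sum (u : G) (x : Fin d) : Ad u (b x) = ∑ y, adStar b u x y • b y :=
  (b.sum_repr _).symm

theorem lie_sum_right (ξ : LieAlg E G) (c : Fin d → ℝ) :
    ⁅ξ, ∑ y, c y • b y⁆ = ∑ y, c y • ⁅ξ, b y⁆ := by
  have : CompleteSpace E := FiniteDimensional.complete ℝ E
  have h3 : LieGroup 𝓘(ℝ, E) (minSmoothness ℝ 3) G := lieGroup_minSmoothness
  rw [LieModule.toEnd_apply_apply ℝ (LieAlg E G) (LieAlg E G) ξ _ |>.symm, map_sum]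
  simp

theorem lie_sum_left (ξ : LieAlg E G) (c : Fin d → ℝ) :
    ⁅∑ y, c y • b y, ξ⁆ = ∑ y, c y • ⁅b y, ξ⁆ := by
  have : CompleteSpace E := FiniteDimensional.complete ℝ E
  have h3 : LieGroup 𝓘(ℝ, E) (minSmoothness ℝ 3) G := lieGroup_minSmoothness
  rw [← lie_skew, lie_sum_right, ← Finset.sum_neg_distrib]
  simp_rw [← smul_neg, lie_skew]

theorem structConst_skew (x y z : Fin d) : structConst b x y z = -structConst b y x z := by
  have : CompleteSpace E := FiniteDimensional.complete ℝ E
  have h3 : LieGroup 𝓘(ℝ, E) (minSmoothness ℝ 3) G := lieGroup_minSmoothness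
  unfold structConst
  rw [← lie_skew, map_neg]
  rfl

theorem structConst_jacobi (x y z k : Fin d) :
    ∑ c, structConst b y z c * structConst b x c k =
      ∑ c, structConst b x y c * structConst b c z k
        + ∑ c, structConst b x z c * structConst b y c k := by
  have : CompleteSpace E := FiniteDimensional.complete ℝ E
  have h3 : LieGroup 𝓘(ℝ, E) (minSmoothness ℝ 3) G := lieGroup_minSmoothness
  have h := congrArg (fun ξ => b.repr ξ k) (leibniz_lie (b x) (b y) (b z))
  simp only [lie_eq_sum b y z, lie_eq_sum b x y, lie_eq_sum b x z, lie_sum_left, lie_sum_right] at h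
  simpa [structConst] using h

/-- The lower index is expanded first, so matrix multiplication reverses the order of group
multiplication. This reversal recurs in `adFun_mul` and `adW_mul`. -/
theorem adStar_mul (u v : G) (x y : Fin d) :
    adStar b (u * v) x y = ∑ c, adStar b v x c * adStar b u c y := by
  unfold adStar
  rw [Ad_mul]
  conv_lhs => rw [Ad_eq_sum b v x, map_sum]
  simp [adStar]

theorem adStar_one (x y : Fin d) : adStar b (1 : G) x y = if x = y then 1 else 0 := by
  unfold adStar
  rw [Ad_one]
  simp [Finsupp.single_apply]

/-- The coordinate form of `Ad_lie`: the structure constants are invariant under the adjoint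
matrices. -/
theorem adStar_structConst (u : G) (x y k : Fin d) :
    ∑ p, ∑ q, adStar b u x p * adStar b u y q * structConst b p q k
      = ∑ c, structConst b x y c * adStar b u c k := by
  have h := congrArg (fun ξ => b.repr ξ k) (Ad_lie u (b x) (b y))
  simp only [lie_eq_sum b x y, Ad_eq_sum b u x, Ad_eq_sum b u y, lie_sum_left, lie_sum_right,
    Finset.smul_sum] at h
  simp only [map_sum, map_smul, Finsupp.coe_finsetSum, Finset.sum_apply,
    smul_eq_mul, Finsupp.coe_smul, Pi.smul_apply] at h
  rw [show (∑ c, structConst b x y c * adStar b u c k) = ∑ c, structConst b x y c * b.repr (Ad u (b c)) k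
    from rfl, h, Finset.sum_comm]
  refine Finset.sum_congr rfl fun q _ => Finset.sum_congr rfl fun p _ => ?_
  simp only [structConst]
  ring

end AdjointAction

/-! ### Commutation rules of the invariant derivations of C^∞(G^(n+2g)). -/

section FunctionDerivations

variable {E G : Type*} [NormedAddCommGroup E] [NormedSpace ℝ E]
  [TopologicalSpace G] [ChartedSpace E G] [Group G] [LieGroup 𝓘(ℝ, E) ∞ G] {n g : ℕ}

theorem derivR_apply (X : Loop n g) (ξ : LieAlg E G) (F : Fun E G n g) (u : Loop n g → G) :
    derivR X ξ F u = dOne (fun v => F (Function.update u X (u X * v))) ξ := rfl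

theorem derivL_apply (X : Loop n g) (ξ : LieAlg E G) (F : Fun E G n g) (u : Loop n g → G) :
    derivL X ξ F u = dOne (fun v => F (Function.update u X (v⁻¹ * u X))) ξ := rfl

theorem derivR_mul (X : Loop n g) (ξ : LieAlg E G) (F F' : Fun E G n g) :
    derivR X ξ (F * F') = F * derivR X ξ F' + F' * derivR X ξ F := by
  ext u
  have h := dOne_mul (mdifferentiableAt_of_param (contMDiff_updateR F X) u 1)
    (mdifferentiableAt_of_param (contMDiff_updateR F' X) u 1) ξ
  simp only [mul_one, Function.update_eq_self] at h
  exact h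

theorem derivL_mul (X : Loop n g) (ξ : LieAlg E G) (F F' : Fun E G n g) :
    derivL X ξ (F * F') = F * derivL X ξ F' + F' * derivL X ξ F := by
  ext u
  have h := dOne_mul (mdifferentiableAt_of_param (contMDiff_updateL F X) u 1)
    (mdifferentiableAt_of_param (contMDiff_updateL F' X) u 1) ξ
  simp only [inv_one, one_mul, Function.update_eq_self] at h
  exact h

section Update

variable {F HF M : Type*} [NormedAddCommGroup F] [NormedSpace ℝ F]
    [TopologicalSpace HF] {J : ModelWithCorners ℝ F HF} [TopologicalSpace M] [ChartedSpace HF M]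

theorem contMDiff_update {f : M → Loop n g → G} {k : M → G}
    (hf : ContMDiff J (ModelWithCorners.pi fun _ : Loop n g => 𝓘(ℝ, E)) ∞ f)
    (hk : ContMDiff J 𝓘(ℝ, E) ∞ k) (X : Loop n g) :
    ContMDiff J (ModelWithCorners.pi fun _ : Loop n g => 𝓘(ℝ, E)) ∞
      (fun p => Function.update (f p) X (k p)) := by
  refine fun p => contMDiffAt_into_pi.2 fun i => ?_
  by_cases h : i = X
  · subst h
    simpa using! hk p
  · simpa [h] using! contMDiffAt_into_pi.1 (hf p) i

end Update

theorem contMDiff_updateTwo (F : Fun E G n g) (u : Loop n g → G) (X Y : Loop n g) {f k : G → G}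
    (hf : ContMDiff 𝓘(ℝ, E) 𝓘(ℝ, E) ∞ f) (hk : ContMDiff 𝓘(ℝ, E) 𝓘(ℝ, E) ∞ k) :
    ContMDiff (𝓘(ℝ, E).prod 𝓘(ℝ, E)) 𝓘(ℝ) ∞
      (Function.uncurry fun v w => F (Function.update (Function.update u X (f v)) Y (k w))) :=
  F.contMDiff.comp (contMDiff_update (contMDiff_update contMDiff_const (hf.comp contMDiff_fst) X)
    (hk.comp contMDiff_snd) Y)

theorem contMDiff_updateOne (F : Fun E G n g) (u : Loop n g → G) (X : Loop n g) :
    ContMDiff 𝓘(ℝ, E) 𝓘(ℝ) ∞ (fun v => F (Function.update u X v)) :=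
  F.contMDiff.comp (contMDiff_update contMDiff_const contMDiff_id X)

theorem contMDiff_mul_left_const (u : G) : ContMDiff 𝓘(ℝ, E) 𝓘(ℝ, E) ∞ (fun v : G => u * v) :=
  contMDiff_const.mul contMDiff_id

theorem contMDiff_inv_mul_const (u : G) : ContMDiff 𝓘(ℝ, E) 𝓘(ℝ, E) ∞ (fun v : G => v⁻¹ * u) :=
  (contMDiff_inv 𝓘(ℝ, E) ∞).mul contMDiff_const

theorem derivR_derivR_of_ne {X Y : Loop n g} (h : X ≠ Y) (ξ η : LieAlg E G) (F : Fun E G n g) :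
    derivR X ξ (derivR Y η F) = derivR Y η (derivR X ξ F) := by
  ext u
  simp only [derivR_apply, Function.update_of_ne h, Function.update_of_ne h.symm]
  rw [dOne_comm (contMDiff_updateTwo F u X Y (contMDiff_mul_left_const _) (contMDiff_mul_left_const _))]
  simp only [Function.update_comm h]

theorem derivL_derivL_of_ne {X Y : Loop n g} (h : X ≠ Y) (ξ η : LieAlg E G) (F : Fun E G n g) :
    derivL X ξ (derivL Y η F) = derivL Y η (derivL X ξ F) := by
  ext u
  simp only [derivL_apply, Function.update_of_ne h, Function.update_of_ne h.symm]
  rw [dOne_comm (contMDiff_updateTwo F u X Y (contMDiff_inv_mul_const _) (contMDiff_inv_mul_const _))]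
  simp only [Function.update_comm h]

/-- Left and right translations commute, even on the same factor, so no hypothesis on X and Y is
needed. -/
theorem derivR_derivL (X Y : Loop n g) (ξ η : LieAlg E G) (F : Fun E G n g) :
    derivR X ξ (derivL Y η F) = derivL Y η (derivR X ξ F) := by
  ext u
  by_cases h : X = Y
  · subst h
    simp only [derivR_apply, derivL_apply, Function.update_self, Function.update_idem]
    rw [dOne_comm]
    · simp only [mul_assoc]
    · refine F.contMDiff.comp (contMDiff_update contMDiff_const ?_ X)
      exact contMDiff_snd.inv.mul (contMDiff_const.mul contMDiff_fst)
  · simp only [derivR_apply, derivL_apply, Function.update_of_ne h, Function.update_of_ne (Ne.symm h)]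
    rw [dOne_comm (contMDiff_updateTwo F u X Y (contMDiff_mul_left_const _)
      (contMDiff_inv_mul_const _))]
    simp only [Function.update_comm h]

theorem derivR_lie [CompleteSpace E] (X : Loop n g) (ξ η : LieAlg E G) (F : Fun E G n g) :
    derivR X ⁅ξ, η⁆ F = derivR X ξ (derivR X η F) - derivR X η (derivR X ξ F) := by
  ext u
  have h := dOne_lie (φ := fun t => F (Function.update u X (u X * t)))
    ((contMDiff_updateOne F u X).comp (contMDiff_mul_left_const (u X))) ξ η
  simp only [← mul_assoc] at h
  rw [derivR_apply, h]
  change _ = derivR X ξ (derivR X η F) u - derivR X η (derivR X ξ F) u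
  simp only [derivR_apply, Function.update_self, Function.update_idem]

/-- The inverse in v⁻¹ u_X reverses the order of composition, so the bracket appears with the same
sign as for right translations. -/
theorem derivL_lie [CompleteSpace E] (X : Loop n g) (ξ η : LieAlg E G) (F : Fun E G n g) :
    derivL X ⁅ξ, η⁆ F = derivL X ξ (derivL X η F) - derivL X η (derivL X ξ F) := by
  ext u
  have h := dOne_lie (φ := fun t => F (Function.update u X (t⁻¹ * u X)))
    ((contMDiff_updateOne F u X).comp (contMDiff_inv_mul_const (u X))) ξ η
  simp only [mul_inv_rev, mul_assoc] at h
  rw [derivL_apply, h]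
  change _ = derivL X ξ (derivL X η F) u - derivL X η (derivL X ξ F) u
  simp only [derivL_apply, Function.update_self, Function.update_idem]

/-- Evaluation at a point as a linear map. -/
theorem Fun_sum_apply {ι : Type*} (s : Finset ι) (f : ι → Fun E G n g) (u : Loop n g → G) :
    (∑ i ∈ s, f i) u = ∑ i ∈ s, f i u :=
  map_sum (ContMDiffMap.evalRingHom u : Fun E G n g →+* ℝ) f s

variable [FiniteDimensional ℝ E] {d : ℕ} (b : Module.Basis (Fin d) ℝ (LieAlg E G))

theorem dOne_sum_right (φ : G → ℝ) (c : Fin d → ℝ) :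
    dOne φ (∑ y, c y • b y) = ∑ y, c y * dOne φ (b y) := by
  change dOneLin φ _ = ∑ y, c y * dOneLin φ (b y)
  simp

theorem derivR_lie_basis (X : Loop n g) (x y : Fin d) (F : Fun E G n g) :
    derivR X (b x) (derivR X (b y) F) - derivR X (b y) (derivR X (b x) F)
      = ∑ z, structConst b x y z • derivR X (b z) F := by
  have : CompleteSpace E := FiniteDimensional.complete ℝ E
  rw [← derivR_lie, lie_eq_sum]
  ext u
  rw [Fun_sum_apply, derivR_apply, dOne_sum_right]
  rfl

theorem derivL_lie_basis (X : Loop n g) (x y : Fin d) (F : Fun E G n g) :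
    derivL X (b x) (derivL X (b y) F) - derivL X (b y) (derivL X (b x) F)
      = ∑ z, structConst b x y z • derivL X (b z) F := by
  have : CompleteSpace E := FiniteDimensional.complete ℝ E
  rw [← derivL_lie, lie_eq_sum]
  ext u
  rw [Fun_sum_apply, derivL_apply, dOne_sum_right]
  rfl

theorem adFun_mul (w₁ w₂ : Word E G n g) (x y : Fin d) :
    adFun b (w₁ * w₂) x y = ∑ c, adFun b w₂ x c * adFun b w₁ c y := by
  ext u
  rw [Fun_sum_apply]
  exact adStar_mul b (w₁ u) (w₂ u) x y

theorem adFun_one (x y : Fin d) :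
    adFun b (1 : Word E G n g) x y = if x = y then 1 else 0 := by
  ext u
  refine (adStar_one b x y).trans ?_
  split_ifs <;> rfl

theorem adFun_structConst (w : Word E G n g) (x y k : Fin d) :
    ∑ p, ∑ q, structConst b p q k • (adFun b w x p * adFun b w y q)
      = ∑ c, structConst b x y c • adFun b w c k := by
  ext u
  simp only [Fun_sum_apply]
  refine Eq.trans ?_ (adStar_structConst b (w u) x y k)
  refine Finset.sum_congr rfl fun p _ => Finset.sum_congr rfl fun q _ => ?_
  exact mul_comm _ _

/-- From v⁻¹ u = u (u⁻¹ v u)⁻¹: conjugation contributes Ad(u⁻¹) and inversion the sign. -/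
theorem derivL_eq_derivR (X : Loop n g) (x : Fin d) (F : Fun E G n g) :
    derivL X (b x) F = -∑ c, adFun b (hol X)⁻¹ x c * derivR X (b c) F := by
  ext u
  have hφ : ContMDiff 𝓘(ℝ, E) 𝓘(ℝ) ∞ (fun t : G => F (Function.update u X (u X * t))) :=
    (contMDiff_updateOne F u X).comp (contMDiff_mul_left_const (u X))
  have h1 := dOne_conj (hφ.comp (contMDiff_inv 𝓘(ℝ, E) ∞)) (u X)⁻¹ (b x)
  have h2 := dOne_inv hφ (Ad (u X)⁻¹ (b x))
  have h3 := h1.trans h2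
  rw [Ad_eq_sum b, dOne_sum_right] at h3
  have e : derivL X (b x) F u = dOne ((fun v => ((fun t : G => F (Function.update u X (u X * t))) ∘
      fun v => v⁻¹) ((u X)⁻¹ * v * (u X)⁻¹⁻¹))) (b x) := by
    rw [derivL_apply]
    congr 1
    funext v
    simp [mul_assoc]
  rw [e, h3]
  change _ = -((∑ c, adFun b (hol X)⁻¹ x c * derivR X (b c) F : Fun E G n g) u)
  rw [Fun_sum_apply]
  rfl

/-- Differentiate Ad(u v) = Ad(u) Ad(v) with `dOne_Ad`; the structure constants attach to the lower
index. For left translations they attach to the upper index. -/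
theorem derivR_adFun_hol (X : Loop n g) (a x y : Fin d) :
    derivR X (b a) (adFun b (hol X) x y) = ∑ c, structConst b a x c • adFun b (hol X) c y := by
  ext u
  have h := dOne_Ad (b.coord y ∘ₗ Ad (u X)) (b a) (b x)
  rw [Fun_sum_apply, derivR_apply]
  have e : (fun v : G => adFun b (hol X) x y (Function.update u X (u X * v)))
      = fun v => (b.coord y ∘ₗ Ad (u X)) (Ad v (b x)) := by
    funext v
    change adStar b (Function.update u X (u X * v) X) x y = _
    simp [adStar, Ad_mul]
  rw [e, h, lie_eq_sum, map_sum]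
  simp only [map_smul]
  rfl

theorem derivL_adFun_hol (X : Loop n g) (a x y : Fin d) :
    derivL X (b a) (adFun b (hol X) x y) = -∑ c, structConst b a c y • adFun b (hol X) x c := by
  ext u
  have h := dOne_Ad_inv (b.coord y) (b a) (Ad (u X) (b x))
  change _ = -((∑ c, structConst b a c y • adFun b (hol X) x c : Fun E G n g) u)
  rw [Fun_sum_apply, derivL_apply]
  have e : (fun v : G => adFun b (hol X) x y (Function.update u X (v⁻¹ * u X)))
      = fun v => b.coord y (Ad v⁻¹ (Ad (u X) (b x))) := by
    funext v
    change adStar b (Function.update u X (v⁻¹ * u X) X) x y = _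
    simp [adStar, Ad_mul]
  rw [e, h, Ad_eq_sum b, lie_sum_right, map_sum]
  simp only [map_smul]
  congr 1
  refine Finset.sum_congr rfl fun c _ => ?_
  exact mul_comm _ _

theorem derivR_adFun_of_forall {X : Loop n g} (ξ : LieAlg E G) {w : Word E G n g}
    (hw : ∀ u v, w (Function.update u X v) = w u) (x y : Fin d) :
    derivR X ξ (adFun b w x y) = 0 := by
  ext u
  rw [derivR_apply]
  refine (congrArg (dOne · ξ) (?_ : _ = fun _ : G => adFun b w x y u)).trans (dOne_const _ ξ)
  funext v
  change adStar b (w (Function.update u X (u X * v))) x y = _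
  rw [hw]
  rfl

theorem derivL_adFun_of_forall {X : Loop n g} (ξ : LieAlg E G) {w : Word E G n g}
    (hw : ∀ u v, w (Function.update u X v) = w u) (x y : Fin d) :
    derivL X ξ (adFun b w x y) = 0 := by
  ext u
  rw [derivL_apply]
  refine (congrArg (dOne · ξ) (?_ : _ = fun _ : G => adFun b w x y u)).trans (dOne_const _ ξ)
  funext v
  change adStar b (w (Function.update u X (v⁻¹ * u X))) x y = _
  rw [hw]
  rfl

end FunctionDerivations

/-! ### Skew biderivations and reduction to generators. -/

section SkewBiderivations

variable {R : Type*} [CommRing R] [Algebra ℝ R]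

/-- A skew-symmetric biderivation: a Poisson bracket up to the Jacobi identity. -/
structure IsSkewBiderivation (br : R → R → R) : Prop where
  add_left : ∀ φ ψ χ, br (φ + ψ) χ = br φ χ + br ψ χ
  smul_left : ∀ (c : ℝ) φ ψ, br (c • φ) ψ = c • br φ ψ
  skew : ∀ φ ψ, br φ ψ = -br ψ φ
  leibniz : ∀ φ ψ χ, br φ (ψ * χ) = br φ ψ * χ + ψ * br φ χ

namespace IsSkewBiderivation

variable {br : R → R → R} (h : IsSkewBiderivation br)
include h

theorem add_right (φ ψ χ : R) : br φ (ψ + χ) = br φ ψ + br φ χ := by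
  rw [h.skew, h.add_left, h.skew ψ, h.skew χ]; ring

theorem smul_right (c : ℝ) (φ ψ : R) : br φ (c • ψ) = c • br φ ψ := by
  rw [h.skew, h.smul_left, h.skew ψ, smul_neg, neg_neg]

theorem leibniz_left (φ ψ χ : R) : br (φ * ψ) χ = br φ χ * ψ + φ * br ψ χ := by
  rw [h.skew, h.leibniz, h.skew χ φ, h.skew χ ψ]; ring

/-- The derivation `{φ, ·}`. -/
def der (φ : R) : Derivation ℝ R R :=
  Derivation.mk' { toFun := br φ, map_add' := h.add_right φ, map_smul' := fun c ψ => h.smul_right c φ ψ }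
    (fun a c => by simp [h.leibniz]; ring)

theorem der_apply (φ ψ : R) : h.der φ ψ = br φ ψ := rfl

theorem zero_right (φ : R) : br φ 0 = 0 := map_zero (h.der φ)

theorem zero_left (φ : R) : br 0 φ = 0 := by rw [h.skew, h.zero_right, neg_zero]

theorem neg_right (φ ψ : R) : br φ (-ψ) = -br φ ψ := map_neg (h.der φ) ψ

theorem neg_left (φ ψ : R) : br (-φ) ψ = -br φ ψ := by
  rw [h.skew, h.neg_right, h.skew ψ, neg_neg]

theorem sub_right (φ ψ χ : R) : br φ (ψ - χ) = br φ ψ - br φ χ := map_sub (h.der φ) ψ χ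

theorem sub_left (φ ψ χ : R) : br (φ - ψ) χ = br φ χ - br ψ χ := by
  rw [h.skew, h.sub_right, h.skew χ φ, h.skew χ ψ]; ring

theorem sum_right {ι : Type*} (φ : R) (s : Finset ι) (f : ι → R) :
    br φ (∑ i ∈ s, f i) = ∑ i ∈ s, br φ (f i) := map_sum (h.der φ) f s

theorem sum_left {ι : Type*} (φ : R) (s : Finset ι) (f : ι → R) :
    br (∑ i ∈ s, f i) φ = ∑ i ∈ s, br (f i) φ := by
  rw [h.skew, h.sum_right, ← Finset.sum_neg_distrib]
  exact Finset.sum_congr rfl fun i _ => (h.skew _ _).symm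

/-- A skew biderivation satisfies the Jacobi identity if it does so on a set of generators. -/
theorem isPoissonBracket {S : Set R}
    (hS : ∀ p : R → Prop, (∀ s ∈ S, p s) → (∀ φ ψ, p φ → p ψ → p (φ + ψ)) →
      (∀ φ ψ, p φ → p ψ → p (φ * ψ)) → ∀ φ, p φ)
    (hJ : ∀ φ ∈ S, ∀ ψ ∈ S, ∀ χ ∈ S, br φ (br ψ χ) + br ψ (br χ φ) + br χ (br φ ψ) = 0) :
    IsPoissonBracket br where
  add_left := h.add_left
  smul_left := h.smul_left
  skew := h.skew
  leibniz := h.leibniz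
  jacobi := by
    -- For fixed φ and ψ the Jacobiator is a derivation in the third argument: the mixed terms of
    -- the Leibniz rule cancel by skew symmetry. Cyclic rotation then extends the identity from the
    -- generators one slot at a time.
    have step : ∀ φ ψ, (∀ χ ∈ S, br φ (br ψ χ) + br ψ (br χ φ) + br χ (br φ ψ) = 0) →
        ∀ χ, br φ (br ψ χ) + br ψ (br χ φ) + br χ (br φ ψ) = 0 := by
      intro φ ψ hs
      refine hS _ hs ?_ ?_
      · intro χ χ' h1 h2
        rw [h.add_right ψ, h.add_right φ, h.add_left χ χ' φ, h.add_right ψ, h.add_left χ χ']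
        linear_combination h1 + h2
      · intro χ χ' h1 h2
        rw [h.leibniz ψ, h.add_right φ, h.leibniz, h.leibniz, h.leibniz_left χ χ' φ, h.add_right ψ,
          h.leibniz, h.leibniz, h.leibniz_left χ χ']
        have e1 := h.skew φ χ
        have e2 := h.skew φ χ'
        linear_combination h1 * χ' + χ * h2 + br ψ χ * e2 + br ψ χ' * e1
    intro φ ψ χ
    refine step φ ψ (fun s hs => ?_) χ
    have h2 := step s φ (fun t ht => ?_) ψ
    · linear_combination h2
    · have h3 := step t s (fun r hr => hJ t ht s hs r hr) φ
      linear_combination h3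

end IsSkewBiderivation

/-- A skew biderivation that is carried by an injective homomorphism to a Poisson bracket is a
Poisson bracket. -/
theorem IsPoissonBracket.of_injective {R' : Type*} [CommRing R'] [Algebra ℝ R']
    {br : R → R → R} {br' : R' → R' → R'} (h : IsSkewBiderivation br) (h' : IsPoissonBracket br')
    (f : R →ₐ[ℝ] R') (hf : Function.Injective f) (hbr : ∀ φ ψ, br' (f φ) (f ψ) = f (br φ ψ)) :
    IsPoissonBracket br where
  add_left := h.add_left
  smul_left := h.smul_left
  skew := h.skew
  leibniz := h.leibniz
  jacobi φ ψ χ := hf (by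
    simp only [map_add, map_zero, ← hbr]
    exact h'.jacobi _ _ _)

/-- A homomorphism intertwines two skew biderivations if it does so on generators. -/
theorem IsSkewBiderivation.map_bracket {R' : Type*} [CommRing R'] [Algebra ℝ R']
    {br : R → R → R} {br' : R' → R' → R'} (h : IsSkewBiderivation br) (h' : IsSkewBiderivation br')
    (f : R →ₐ[ℝ] R') {S : Set R}
    (hS : ∀ p : R → Prop, (∀ s ∈ S, p s) → (∀ φ ψ, p φ → p ψ → p (φ + ψ)) →
      (∀ φ ψ, p φ → p ψ → p (φ * ψ)) → ∀ φ, p φ)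
    (hf : ∀ φ ∈ S, ∀ ψ ∈ S, br' (f φ) (f ψ) = f (br φ ψ)) (φ ψ : R) :
    br' (f φ) (f ψ) = f (br φ ψ) := by
  -- The second argument is extended with the first fixed; skew symmetry exchanges the roles.
  have step : ∀ φ, (∀ ψ ∈ S, br' (f φ) (f ψ) = f (br φ ψ)) → ∀ ψ, br' (f φ) (f ψ) = f (br φ ψ) := by
    intro φ hs
    refine hS _ hs ?_ ?_
    · intro χ χ' h1 h2
      rw [map_add, h'.add_right, h1, h2, h.add_right, map_add]
    · intro χ χ' h1 h2
      rw [map_mul, h'.leibniz, h1, h2, h.leibniz, map_add, map_mul, map_mul]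
  refine step φ (fun s hs => ?_) ψ
  rw [h'.skew, step s (fun t ht => hf s hs t ht) φ, h.skew φ, map_neg]

theorem IsSkewBiderivation.add {br br' : R → R → R} (h : IsSkewBiderivation br)
    (h' : IsSkewBiderivation br') : IsSkewBiderivation fun φ ψ => br φ ψ + br' φ ψ where
  add_left φ ψ χ := by simp only [h.add_left, h'.add_left]; ring
  smul_left c φ ψ := by simp only [h.smul_left, h'.smul_left, smul_add]
  skew φ ψ := by rw [h.skew φ, h'.skew φ]; ring
  leibniz φ ψ χ := by simp only [h.leibniz, h'.leibniz]; ring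

theorem IsSkewBiderivation.const_smul {br : R → R → R} (h : IsSkewBiderivation br) (r : ℝ) :
    IsSkewBiderivation fun φ ψ => r • br φ ψ where
  add_left φ ψ χ := by simp only [h.add_left, smul_add]
  smul_left c φ ψ := by rw [h.smul_left, smul_comm]
  skew φ ψ := by rw [h.skew φ, smul_neg]
  leibniz φ ψ χ := by simp only [h.leibniz, smul_add, smul_mul_assoc, mul_smul_comm]

theorem IsSkewBiderivation.sum {ι : Type*} [Fintype ι] {br : ι → R → R → R}
    (h : ∀ i, IsSkewBiderivation (br i)) : IsSkewBiderivation fun φ ψ => ∑ i, br i φ ψ where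
  add_left φ ψ χ := by simp only [(h _).add_left, Finset.sum_add_distrib]
  smul_left c φ ψ := by simp only [(h _).smul_left, Finset.smul_sum]
  skew φ ψ := by
    rw [← Finset.sum_neg_distrib]
    exact Finset.sum_congr rfl fun i _ => (h i).skew φ ψ
  leibniz φ ψ χ := by
    simp only [(h _).leibniz, Finset.sum_add_distrib, Finset.sum_mul, Finset.mul_sum]

/-- The wedge product of two derivations is a skew biderivation. -/
theorem isSkewBiderivation_wedge {δ ε : R →ₗ[ℝ] R} (hδ : ∀ φ ψ, δ (φ * ψ) = φ * δ ψ + ψ * δ φ)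
    (hε : ∀ φ ψ, ε (φ * ψ) = φ * ε ψ + ψ * ε φ) :
    IsSkewBiderivation fun φ ψ => δ φ * ε ψ - ε φ * δ ψ where
  add_left φ ψ χ := by simp only [map_add]; ring
  smul_left c φ ψ := by simp only [map_smul, smul_mul_assoc, smul_sub]
  skew φ ψ := by ring
  leibniz φ ψ χ := by rw [hδ, hε]; ring

theorem isSkewBiderivation_matrix {ι : Type*} [Fintype ι] {π : ι → ι → R} {δ : ι → R →ₗ[ℝ] R}
    (hπ : ∀ i j, π i j = -π j i) (hδ : ∀ i φ ψ, δ i (φ * ψ) = φ * δ i ψ + ψ * δ i φ) :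
    IsSkewBiderivation fun φ ψ => ∑ i, ∑ j, δ i φ * δ j ψ * π i j where
  add_left φ ψ χ := by simp only [map_add, add_mul, Finset.sum_add_distrib]
  smul_left c φ ψ := by simp only [map_smul, smul_mul_assoc, Finset.smul_sum]
  skew φ ψ := by
    rw [Finset.sum_comm, ← Finset.sum_neg_distrib]
    refine Finset.sum_congr rfl fun i _ => ?_
    rw [← Finset.sum_neg_distrib]
    refine Finset.sum_congr rfl fun j _ => ?_
    rw [hπ j i]
    ring
  leibniz φ ψ χ := by
    rw [Finset.sum_mul, Finset.mul_sum, ← Finset.sum_add_distrib]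
    refine Finset.sum_congr rfl fun i _ => ?_
    rw [Finset.sum_mul, Finset.mul_sum, ← Finset.sum_add_distrib]
    refine Finset.sum_congr rfl fun j _ => ?_
    rw [hδ]
    ring

theorem rTensor_mul {A B : Type*} [CommRing A] [Algebra ℝ A] [CommRing B] [Algebra ℝ B]
    {δ : A →ₗ[ℝ] A} (hδ : ∀ a a', δ (a * a') = a * δ a' + a' * δ a) (φ ψ : A ⊗[ℝ] B) :
    LinearMap.rTensor B δ (φ * ψ) = φ * LinearMap.rTensor B δ ψ + ψ * LinearMap.rTensor B δ φ := by
  induction φ with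
  | zero => simp
  | add φ φ' h h' => rw [add_mul, map_add, h, h', map_add]; ring
  | tmul a c =>
    induction ψ with
    | zero => simp
    | add φ φ' h h' => rw [mul_add, map_add, h, h', map_add]; ring
    | tmul a' c' => simp [hδ, TensorProduct.add_tmul, mul_comm c' c]

theorem lTensor_mul {A B : Type*} [CommRing A] [Algebra ℝ A] [CommRing B] [Algebra ℝ B]
    {δ : B →ₗ[ℝ] B} (hδ : ∀ a a', δ (a * a') = a * δ a' + a' * δ a) (φ ψ : A ⊗[ℝ] B) :
    LinearMap.lTensor A δ (φ * ψ) = φ * LinearMap.lTensor A δ ψ + ψ * LinearMap.lTensor A δ φ := by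
  induction φ with
  | zero => simp
  | add φ φ' h h' => rw [add_mul, map_add, h, h', map_add]; ring
  | tmul a c =>
    induction ψ with
    | zero => simp
    | add φ φ' h h' => rw [mul_add, map_add, h, h', map_add]; ring
    | tmul a' c' => simp [hδ, TensorProduct.tmul_add, mul_comm a' a]

end SkewBiderivations

/-! ### The flower algebra through its generators. -/

section FlowerGenerators

variable {E G : Type*} [NormedAddCommGroup E] [NormedSpace ℝ E] [FiniteDimensional ℝ E]
  [TopologicalSpace G] [ChartedSpace E G] [Group G] [LieGroup 𝓘(ℝ, E) ∞ G]
  {d n g : ℕ} (b : Module.Basis (Fin d) ℝ (LieAlg E G))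

/-- The inclusion of `C^∞(G^(n+2g))` into the flower algebra. -/
def fnHom : Fun E G n g →ₐ[ℝ] Flower E G n g := Algebra.TensorProduct.includeRight

theorem fnHom_apply (F : Fun E G n g) : fnHom F = fn F := rfl

theorem fn_sub (F F' : Fun E G n g) : fn (F - F') = fn F - fn F' := map_sub fnHom F F'
theorem fn_neg (F : Fun E G n g) : fn (-F) = -fn F := map_neg fnHom F
theorem fn_smul (c : ℝ) (F : Fun E G n g) : fn (c • F) = c • fn F := map_smul fnHom c F
theorem fn_zero : fn (0 : Fun E G n g) = 0 := map_zero fnHom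
theorem fn_one : fn (1 : Fun E G n g) = 1 := map_one fnHom

/-- The flower algebra is generated by the `j^X_x` and the functions. -/
theorem flower_induction {p : Flower E G n g → Prop} (hgen : ∀ X x, p (gen b X x))
    (hfn : ∀ F, p (fn F)) (hadd : ∀ φ ψ, p φ → p ψ → p (φ + ψ))
    (hmul : ∀ φ ψ, p φ → p ψ → p (φ * ψ)) (φ : Flower E G n g) : p φ := by
  have hS : ∀ s : SymmetricAlgebra ℝ (Loop n g → LieAlg E G), p (s ⊗ₜ[ℝ] (1 : Fun E G n g)) := by
    intro s
    induction s using SymmetricAlgebra.induction with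
    | algebraMap r =>
      -- A scalar crosses the tensor product and becomes a constant function.
      have : (algebraMap ℝ (SymmetricAlgebra ℝ (Loop n g → LieAlg E G)) r) ⊗ₜ[ℝ] (1 : Fun E G n g)
          = fn (algebraMap ℝ (Fun E G n g) r) := by
        simp only [fn, Algebra.algebraMap_eq_smul_one, TensorProduct.smul_tmul]
      rw [this]
      exact hfn _
    | ι v =>
      rw [← (loopBasis b n g).sum_repr v, map_sum, TensorProduct.sum_tmul]
      have h0 : p 0 := by simpa [fn_zero] using hfn 0
      refine Finset.sum_induction _ p (fun _ _ => hadd _ _) h0 fun i _ => ?_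
      have : (SymmetricAlgebra.ι ℝ (Loop n g → LieAlg E G)) ((loopBasis b n g).repr v i • loopBasis b n g i)
          ⊗ₜ[ℝ] (1 : Fun E G n g) = fn ((loopBasis b n g).repr v i • 1) * gen b i.1 i.2 := by
        rw [fn_smul, fn_one, smul_mul_assoc, one_mul, map_smul, ← TensorProduct.smul_tmul']
        rfl
      rw [this]
      exact hmul _ _ (hfn _) (hgen _ _)
    | mul a c ha hc =>
      have : (a * c) ⊗ₜ[ℝ] (1 : Fun E G n g) = a ⊗ₜ 1 * c ⊗ₜ 1 := by simp
      rw [this]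
      exact hmul _ _ ha hc
    | add a c ha hc =>
      rw [TensorProduct.add_tmul]
      exact hadd _ _ ha hc
  induction φ using TensorProduct.induction_on with
  | zero => simpa [fn_zero] using hfn 0
  | add φ ψ h h' => exact hadd _ _ h h'
  | tmul s F =>
    have : s ⊗ₜ[ℝ] F = s ⊗ₜ[ℝ] (1 : Fun E G n g) * fn F := by simp [fn]
    rw [this]
    exact hmul _ _ (hS s) (hfn F)

theorem dGen_mul (X : Loop n g) (x : Fin d) (φ ψ : Flower E G n g) :
    dGen b X x (φ * ψ) = φ * dGen b X x ψ + ψ * dGen b X x φ := by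
  refine rTensor_mul (fun a a' => ?_) φ ψ
  simp

theorem dGen_gen (X Y : Loop n g) (x y : Fin d) :
    dGen b X x (gen b Y y) = if X = Y ∧ x = y then 1 else 0 := by
  have e : dGen b X x (gen b Y y) = ((SymmetricAlgebra.equivMvPolynomial (loopBasis b n g)).symm
      (MvPolynomial.pderiv ⟨X, x⟩ (MvPolynomial.X ⟨Y, y⟩))) ⊗ₜ[ℝ] (1 : Fun E G n g) := by
    simp [dGen, gen]
  rw [e, MvPolynomial.pderiv_X, Pi.single_apply]
  by_cases h : X = Y ∧ x = y
  · obtain ⟨rfl, rfl⟩ := h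
    simp [Algebra.TensorProduct.one_def]
  · rw [if_neg h, if_neg]
    · simp
    · rintro h'
      simp only [Sigma.mk.injEq, heq_eq_eq] at h'
      exact h ⟨h'.1.symm, h'.2.symm⟩

theorem dGen_fn (X : Loop n g) (x : Fin d) (F : Fun E G n g) : dGen b X x (fn F) = 0 := by
  simp [dGen, fn]

theorem dFun_mul {D : Fun E G n g →ₗ[ℝ] Fun E G n g}
    (hD : ∀ F F', D (F * F') = F * D F' + F' * D F) (φ ψ : Flower E G n g) :
    dFun D (φ * ψ) = φ * dFun D ψ + ψ * dFun D φ := lTensor_mul hD φ ψ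

theorem dFun_gen {D : Fun E G n g →ₗ[ℝ] Fun E G n g}
    (hD : ∀ F F', D (F * F') = F * D F' + F' * D F) (X : Loop n g) (x : Fin d) :
    dFun D (gen b X x) = 0 := by
  have h1 : D 1 = 0 := by simpa using hD 1 1
  simp [dFun, gen, h1]

theorem dFun_fn (D : Fun E G n g →ₗ[ℝ] Fun E G n g) (F : Fun E G n g) :
    dFun D (fn F) = fn (D F) := by
  simp [dFun, fn]

/-- The biderivation of the flower algebra with `{F, F'} = 0`, `{j^X_x, j^Y_y} = π X Y x y` and
`{j^X_x, F} = D X x F`. -/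
def biderivation (π : Loop n g → Loop n g → Fin d → Fin d → Flower E G n g)
    (D : Loop n g → Fin d → Fun E G n g →ₗ[ℝ] Fun E G n g) (φ ψ : Flower E G n g) :
    Flower E G n g :=
  (∑ X, ∑ x, ∑ Y, ∑ y, dGen b X x φ * dGen b Y y ψ * π X Y x y)
    + ∑ X, ∑ x, (dGen b X x φ * dFun (D X x) ψ - dFun (D X x) φ * dGen b X x ψ)

section Biderivation

variable {π : Loop n g → Loop n g → Fin d → Fin d → Flower E G n g}
  {D : Loop n g → Fin d → Fun E G n g →ₗ[ℝ] Fun E G n g}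

/-- The bracket is a bivector: a skew matrix paired with the derivatives ∂/∂j, plus wedge products
of ∂/∂j with the extended derivations of C^∞(G^(n+2g)). -/
theorem isSkewBiderivation_biderivation (hπ : ∀ X Y x y, π X Y x y = -π Y X y x)
    (hD : ∀ X x F F', D X x (F * F') = F * D X x F' + F' * D X x F) :
    IsSkewBiderivation (biderivation b π D) := by
  have h1 := isSkewBiderivation_matrix (ι := Loop n g × Fin d) (π := fun p q => π p.1 q.1 p.2 q.2)
    (δ := fun p => dGen b p.1 p.2) (fun p q => hπ p.1 q.1 p.2 q.2) (fun p => dGen_mul b p.1 p.2)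
  have h2 := IsSkewBiderivation.sum fun X : Loop n g => IsSkewBiderivation.sum fun x : Fin d =>
    isSkewBiderivation_wedge (dGen_mul b X x) (dFun_mul (hD X x))
  have h3 := h1.add h2
  simp only [Fintype.sum_prod_type] at h3
  exact h3

theorem biderivation_gen_gen (hD : ∀ X x F F', D X x (F * F') = F * D X x F' + F' * D X x F)
    (X Y : Loop n g) (x y : Fin d) : biderivation b π D (gen b X x) (gen b Y y) = π X Y x y := by
  simp only [biderivation, dGen_gen, dFun_gen b (hD _ _), mul_zero, zero_mul, sub_zero,
    ite_and, ite_mul, one_mul]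
  rw [Finset.sum_eq_single X (fun X' _ h => by simp [h]) (by simp),
    Finset.sum_eq_single x (fun X' _ h => by simp [h]) (by simp),
    Finset.sum_eq_single Y (fun X' _ h => by simp [h]) (by simp),
    Finset.sum_eq_single y (fun X' _ h => by simp [h]) (by simp)]
  simp

theorem biderivation_gen_fn (X : Loop n g) (x : Fin d) (F : Fun E G n g) :
    biderivation b π D (gen b X x) (fn F) = fn (D X x F) := by
  simp only [biderivation, dGen_gen, dGen_fn, dFun_fn, mul_zero, zero_mul, sub_zero,
    Finset.sum_const_zero, zero_add, ite_and, ite_mul, one_mul]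
  rw [Finset.sum_eq_single X (fun X' _ h => by simp [h]) (by simp),
    Finset.sum_eq_single x (fun X' _ h => by simp [h]) (by simp)]
  simp

theorem biderivation_fn_fn (F F' : Fun E G n g) : biderivation b π D (fn F) (fn F') = 0 := by
  simp [biderivation, dGen_fn]

end Biderivation

end FlowerGenerators

/-! ### Linear maps obeying the Leibniz rule. -/

section LeibnizRule

variable {R : Type*} [CommRing R] [Algebra ℝ R]

/-- A linear endomorphism satisfying the Leibniz rule. -/
def IsLeibniz (D : R →ₗ[ℝ] R) : Prop := ∀ F F', D (F * F') = F * D F' + F' * D F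

theorem IsLeibniz.add {D D' : R →ₗ[ℝ] R} (h : IsLeibniz D) (h' : IsLeibniz D') :
    IsLeibniz (D + D') := fun F F' => by
  simp only [LinearMap.add_apply]
  rw [h, h']
  ring

theorem IsLeibniz.neg {D : R →ₗ[ℝ] R} (h : IsLeibniz D) : IsLeibniz (-D) := fun F F' => by
  simp only [LinearMap.neg_apply]
  rw [h]
  ring

theorem IsLeibniz.sub {D D' : R →ₗ[ℝ] R} (h : IsLeibniz D) (h' : IsLeibniz D') :
    IsLeibniz (D - D') := fun F F' => by
  simp only [LinearMap.sub_apply]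
  rw [h, h']
  ring

theorem IsLeibniz.zero : IsLeibniz (0 : R →ₗ[ℝ] R) := fun F F' => by simp

theorem IsLeibniz.sum {ι : Type*} {s : Finset ι} {D : ι → R →ₗ[ℝ] R} (h : ∀ i, IsLeibniz (D i)) :
    IsLeibniz (∑ i ∈ s, D i) := fun F F' => by
  simp only [LinearMap.sum_apply, Finset.mul_sum, ← Finset.sum_add_distrib]
  exact Finset.sum_congr rfl fun i _ => h i F F'

theorem IsLeibniz.mulLeft {D : R →ₗ[ℝ] R} (h : IsLeibniz D) (r : R) :
    IsLeibniz (LinearMap.mulLeft ℝ r ∘ₗ D) := fun F F' => by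
  simp only [LinearMap.comp_apply, LinearMap.mulLeft_apply]
  rw [h]
  ring

/-- A derivation that annihilates the coefficients and commutes with each D' passes through the
combination ∑ p D'. This handles the Ad*-weighted term at each handle. -/
theorem IsLeibniz.commute_sum {ι : Type*} [Fintype ι] {D : R →ₗ[ℝ] R} (h : IsLeibniz D)
    {p : ι → R} {D' : ι → R →ₗ[ℝ] R} (hp : ∀ i, D (p i) = 0) (F : R)
    (hD : ∀ i, D (D' i F) = D' i (D F)) :
    D (∑ i, p i * D' i F) = ∑ i, p i * D' i (D F) := by
  rw [map_sum]
  refine Finset.sum_congr rfl fun i _ => ?_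
  rw [h, hp, hD, mul_zero, add_zero]

end LeibnizRule

/-! ### Decoupled brackets and their diagonal generators. -/

section Decoupled

variable {E G : Type*} [NormedAddCommGroup E] [NormedSpace ℝ E] [FiniteDimensional ℝ E]
  [TopologicalSpace G] [ChartedSpace E G] [Group G] [LieGroup 𝓘(ℝ, E) ∞ G]
  {d n g : ℕ} (b : Module.Basis (Fin d) ℝ (LieAlg E G))

theorem isLeibniz_derivR (X : Loop n g) (ξ : LieAlg E G) : IsLeibniz (derivR X ξ) := derivR_mul X ξ
theorem isLeibniz_derivL (X : Loop n g) (ξ : LieAlg E G) : IsLeibniz (derivL X ξ) := derivL_mul X ξ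

section LieSum

variable {R : Type*} [CommRing R] [Algebra ℝ R]

/-- `∑ z, f_{xy}^z v_z`. -/
def lieSum (x y : Fin d) (v : Fin d → R) : R := ∑ z, structConst b x y z • v z

theorem lieSum_skew (x y : Fin d) (v : Fin d → R) : lieSum b x y v = -lieSum b y x v := by
  unfold lieSum
  rw [← Finset.sum_neg_distrib]
  refine Finset.sum_congr rfl fun z _ => ?_
  rw [structConst_skew, neg_smul]

theorem lieSum_sub (x y : Fin d) (v w : Fin d → R) :
    lieSum b x y (v - w) = lieSum b x y v - lieSum b x y w := by
  simp [lieSum, smul_sub, Finset.sum_sub_distrib]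

theorem lieSum_neg (x y : Fin d) (v : Fin d → R) : lieSum b x y (fun z => -v z) = -lieSum b x y v := by
  simp [lieSum]

theorem lieSum_lieSum (x y z : Fin d) (v : Fin d → R) :
    lieSum b y z (fun p => lieSum b x p v)
      = ∑ k, (∑ c, structConst b y z c * structConst b x c k) • v k := by
  simp only [lieSum, Finset.smul_sum, smul_smul, Finset.sum_smul]
  exact Finset.sum_comm

theorem lieSum_jacobi (x y z : Fin d) (v : Fin d → R) :
    lieSum b y z (fun p => lieSum b x p v) + lieSum b z x (fun p => lieSum b y p v)
      + lieSum b x y (fun p => lieSum b z p v) = 0 := by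
  simp only [lieSum_lieSum, ← Finset.sum_add_distrib, ← add_smul]
  refine Finset.sum_eq_zero fun k _ => ?_
  have h := structConst_jacobi b x y z k
  have e1 : ∑ c, structConst b z x c * structConst b y c k
      = -∑ c, structConst b x z c * structConst b y c k := by
    rw [← Finset.sum_neg_distrib]
    refine Finset.sum_congr rfl fun c _ => ?_
    rw [structConst_skew b z x, neg_mul]
  have e2 : ∑ c, structConst b x y c * structConst b z c k
      = -∑ c, structConst b x y c * structConst b c z k := by
    rw [← Finset.sum_neg_distrib]
    refine Finset.sum_congr rfl fun c _ => ?_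
    rw [structConst_skew b z c, mul_neg]
  rw [Finset.sum_add_distrib, Finset.sum_add_distrib, h, e1, e2]
  simp

theorem IsSkewBiderivation.lieSum_right {br : R → R → R} (h : IsSkewBiderivation br) (φ : R)
    (x y : Fin d) (v : Fin d → R) : br φ (lieSum b x y v) = lieSum b x y fun z => br φ (v z) := by
  unfold lieSum
  rw [h.sum_right]
  exact Finset.sum_congr rfl fun z _ => h.smul_right _ _ _

end LieSum

/-- The derivation `F ↦ {j^X_x, F}` in the decoupled Poisson structure. -/
def decGenFun (X : Loop n g) (x : Fin d) : Fun E G n g →ₗ[ℝ] Fun E G n g :=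
  match X with
  | Sum.inl i => -(derivR (M i) (b x) + derivL (M i) (b x))
  | Sum.inr (Sum.inl i) => -derivR (A i) (b x) - derivR (B i) (b x)
      - ∑ y, LinearMap.mulLeft ℝ (adFun b ((hol (B i))⁻¹ * hol (A i)) x y) ∘ₗ derivR (B i) (b y)
  | Sum.inr (Sum.inr i) => -derivR (B i) (b x)

theorem isLeibniz_decGenFun (X : Loop n g) (x : Fin d) : IsLeibniz (decGenFun b X x) := by
  rcases X with i | i | i
  · exact ((isLeibniz_derivR _ _).add (isLeibniz_derivL _ _)).neg
  · exact ((isLeibniz_derivR _ _).neg.sub (isLeibniz_derivR _ _)).sub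
      (IsLeibniz.sum fun y => (isLeibniz_derivR _ _).mulLeft _)
  · exact (isLeibniz_derivR _ _).neg

theorem isLeibniz_tailDeriv (X : Loop n g) (x : Fin d) : IsLeibniz (tailDeriv b X x) := by
  refine IsLeibniz.sum fun y => IsLeibniz.mulLeft (IsLeibniz.sum fun Y => ?_) _
  split_ifs
  · exact (isLeibniz_derivR _ _).add (isLeibniz_derivL _ _)
  · exact IsLeibniz.zero

theorem isLeibniz_flowerGenFun (X : Loop n g) (x : Fin d) : IsLeibniz (flowerGenFun b X x) := by
  rcases X with i | i | i
  · exact ((isLeibniz_derivR _ _).add (isLeibniz_derivL _ _)).neg.sub (isLeibniz_tailDeriv b _ _)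
  · exact ((((isLeibniz_derivR _ _).add (isLeibniz_derivL _ _)).neg.sub
      ((isLeibniz_derivR _ _).add (isLeibniz_derivL _ _))).sub
      (IsLeibniz.sum fun y => (isLeibniz_derivR _ _).mulLeft _)).sub (isLeibniz_tailDeriv b _ _)
  · exact ((isLeibniz_derivL _ _).neg.sub ((isLeibniz_derivR _ _).add (isLeibniz_derivL _ _))).sub
      (isLeibniz_tailDeriv b _ _)

theorem not_isHandlePair_self (X : Loop n g) : ¬IsHandlePair X X := by
  rintro ⟨i, rfl, h⟩
  simp at h

theorem IsHandlePair.not_symm {X Y : Loop n g} (h : IsHandlePair X Y) : ¬IsHandlePair Y X := by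
  obtain ⟨i, rfl, rfl⟩ := h
  rintro ⟨j, h, -⟩
  simp at h

theorem IsHandlePair.ne {X Y : Loop n g} (h : IsHandlePair X Y) : X ≠ Y := by
  rintro rfl
  exact not_isHandlePair_self X h

theorem IsHandlePair.level_eq {X Y : Loop n g} (h : IsHandlePair X Y) : level X = level Y := by
  obtain ⟨i, rfl, rfl⟩ := h
  rfl

/-- Two loops share a level only if they coincide or are the two loops of one handle. -/
theorem level_lt_of_unordered {X Y : Loop n g} (h : X ≠ Y) (h1 : ¬IsHandlePair X Y)
    (h2 : ¬IsHandlePair Y X) (h3 : ¬level X < level Y) : level Y < level X := by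
  refine lt_of_le_of_ne (not_lt.1 h3) fun he => ?_
  rcases X with i | i | i <;> rcases Y with j | j | j <;> simp only [level] at he
  · exact h (congrArg _ (Fin.ext he.symm))
  · omega
  · omega
  · omega
  · exact h (congrArg _ (congrArg _ (Fin.ext (by omega))))
  · exact h1 ⟨i, rfl, congrArg _ (congrArg _ (Fin.ext (by omega)))⟩
  · omega
  · exact h2 ⟨i, congrArg _ (congrArg _ (Fin.ext (by omega))), rfl⟩
  · exact h (congrArg _ (congrArg _ (Fin.ext (by omega))))

/-- For X = Y this is skewness of the structure constants. For X ≠ Y exactly one of (X, Y) and (Y,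
X) falls under the first case of the definition, so the relation holds by construction. -/
theorem flowerGenGen_skew (X Y : Loop n g) (x y : Fin d) :
    flowerGenGen b X Y x y = -flowerGenGen b Y X y x := by
  unfold flowerGenGen
  by_cases h : X = Y
  · subst h
    rw [if_pos (Or.inl rfl), if_pos (Or.inl rfl)]
    unfold flowerGenGenAux
    rw [if_neg (lt_irrefl _), if_neg (lt_irrefl _)]
    exact congrArg Neg.neg (lieSum_skew b x y (gen b X))
  · by_cases h1 : IsHandlePair X Y
    · have h2 := h1.not_symm
      have h3 := h1.level_eq
      rw [if_pos (Or.inr (Or.inl h1)), if_neg, neg_neg]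
      rintro (h | h | h)
      · exact h1.ne h.symm
      · exact h2 h
      · omega
    · by_cases h2 : IsHandlePair Y X
      · have h3 := h2.level_eq
        rw [if_neg, if_pos (Or.inr (Or.inl h2))]
        rintro (h | h | h)
        · exact h2.ne h.symm
        · exact h1 h
        · omega
      · by_cases h3 : level X < level Y
        · rw [if_pos (Or.inr (Or.inr h3)), if_neg, neg_neg]
          rintro (h | h | h)
          · exact absurd h.symm (by assumption)
          · exact h2 h
          · omega
        · have h4 := level_lt_of_unordered h h1 h2 h3
          rw [if_neg (by tauto), if_pos (Or.inr (Or.inr h4))]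

/-- The derivations of `C^∞(G^(n+2g))` given by the generators `freeGen`. -/
def freeFun (X : Loop n g) (x : Fin d) : Fun E G n g →ₗ[ℝ] Fun E G n g :=
  match X with
  | Sum.inl i => -(derivR (M i) (b x) + derivL (M i) (b x))
  | Sum.inr (Sum.inl i) =>
      -derivR (A i) (b x) + ∑ y, LinearMap.mulLeft ℝ (adFun b (hol (A i)) x y) ∘ₗ derivL (B i) (b y)
  | Sum.inr (Sum.inr i) => -derivR (B i) (b x)

theorem isLeibniz_freeFun (X : Loop n g) (x : Fin d) : IsLeibniz (freeFun b X x) := by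
  rcases X with i | i | i
  · exact ((isLeibniz_derivR _ _).add (isLeibniz_derivL _ _)).neg
  · exact (isLeibniz_derivR _ _).neg.add (IsLeibniz.sum fun y => (isLeibniz_derivL _ _).mulLeft _)
  · exact (isLeibniz_derivR _ _).neg

/-- Passes between the R_B form used in the stated brackets and the L_B form used in `freeFun`,
where commutation with right translations is evident. -/
theorem sum_adFun_derivL (w : Word E G n g) (X : Loop n g) (x : Fin d) (F : Fun E G n g) :
    ∑ y, adFun b w x y * derivL X (b y) F
      = -∑ y, adFun b ((hol X)⁻¹ * w) x y * derivR X (b y) F := by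
  simp only [derivL_eq_derivR, adFun_mul, mul_neg, Finset.sum_neg_distrib, Finset.mul_sum,
    Finset.sum_mul, mul_assoc]
  rw [Finset.sum_comm]

theorem isHandlePair_A_B (i : Fin g) : IsHandlePair (A i : Loop n g) (B i) := ⟨i, rfl, rfl⟩

theorem isHandlePair_A_B_iff {i j : Fin g} : IsHandlePair (A i : Loop n g) (B j) ↔ i = j := by
  constructor
  · rintro ⟨k, h1, h2⟩
    simp at h1 h2
    rw [h1, h2]
  · rintro rfl
    exact isHandlePair_A_B i

/-- `flowerBracket` is `biderivation` for the flower data, by unfolding. -/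
theorem isSkewBiderivation_flowerBracket : IsSkewBiderivation (flowerBracket (n := n) (g := g) b) :=
  isSkewBiderivation_biderivation b (flowerGenGen_skew b) (isLeibniz_flowerGenFun b)

section Abstract

variable {R : Type*} [CommRing R] [Algebra ℝ R]

open Classical in
/-- The brackets of the generators `J` of a decoupled Poisson structure. -/
def decGenGen (J : Loop n g → Fin d → R) (X Y : Loop n g) (x y : Fin d) : R :=
  if X = Y ∨ IsHandlePair X Y then -lieSum b x y (J Y)
  else if IsHandlePair Y X then -lieSum b x y (J X)
  else 0

theorem decGenGen_skew (J : Loop n g → Fin d → R) (X Y : Loop n g) (x y : Fin d) :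
    decGenGen b J X Y x y = -decGenGen b J Y X y x := by
  unfold decGenGen
  by_cases h : X = Y
  · subst h
    rw [if_pos (Or.inl rfl), if_pos (Or.inl rfl), lieSum_skew b x y]
  · by_cases h1 : IsHandlePair X Y
    · have h2 := h1.not_symm
      rw [if_pos (Or.inr h1), if_neg (by tauto), if_pos h1, lieSum_skew b x y]
    · by_cases h2 : IsHandlePair Y X
      · rw [if_neg (by tauto), if_pos h2, if_pos (Or.inr h2), lieSum_skew b x y]
      · rw [if_neg (by tauto), if_neg h2, if_neg (by tauto), if_neg h1, neg_zero]

/-- The relations between generators `J` and functions in a decoupled Poisson structure. -/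
structure IsDecoupled (br : R → R → R) (J : Loop n g → Fin d → R) (f : Fun E G n g →ₐ[ℝ] R) :
    Prop where
  biderivation : IsSkewBiderivation br
  gen_gen : ∀ X Y x y, br (J X x) (J Y y) = decGenGen b J X Y x y
  gen_fn : ∀ X x F, br (J X x) (f F) = f (decGenFun b X x F)
  fn_fn : ∀ F F', br (f F) (f F') = 0

/-- Generators in which the decoupled Poisson structure is diagonal: `j^{M_i}`, `j^{B_i}` and
`j^{A_i} - j^{B_i}`. -/
def freeGen (J : Loop n g → Fin d → R) (X : Loop n g) : Fin d → R :=
  match X with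
  | Sum.inl i => J (M i)
  | Sum.inr (Sum.inl i) => J (A i) - J (B i)
  | Sum.inr (Sum.inr i) => J (B i)

namespace IsDecoupled

variable {b} {br : R → R → R} {J : Loop n g → Fin d → R} {f : Fun E G n g →ₐ[ℝ] R}
  (h : IsDecoupled b br J f)
include h

theorem freeGen_fn (X : Loop n g) (x : Fin d) (F : Fun E G n g) :
    br (freeGen J X x) (f F) = f (freeFun b X x F) := by
  rcases X with i | i | i
  · exact h.gen_fn _ x F
  · change br (J (A i) x - J (B i) x) (f F) = _
    rw [h.biderivation.sub_left, h.gen_fn, h.gen_fn, ← map_sub]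
    congr 1
    simp only [freeFun, decGenFun, LinearMap.sub_apply, LinearMap.neg_apply, LinearMap.sum_apply,
      LinearMap.comp_apply, LinearMap.mulLeft_apply, LinearMap.add_apply, sum_adFun_derivL]
    ring
  · exact h.gen_fn _ x F

/-- At A_i, of the four brackets of j^A and j^B, one gives -f j^A and three give ∓f j^B with net
sign plus, which is again the Lie relation for j^A - j^B. -/
theorem freeGen_self (X : Loop n g) (x y : Fin d) :
    br (freeGen J X x) (freeGen J X y) = -lieSum b x y (freeGen J X) := by
  rcases X with i | i | i
  · exact (h.gen_gen _ _ x y).trans (if_pos (Or.inl rfl))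
  · change br (J (A i) x - J (B i) x) (J (A i) y - J (B i) y) = -lieSum b x y (J (A i) - J (B i))
    have hAB := isHandlePair_A_B (n := n) i
    have hBA : ¬((B i : Loop n g) = A i ∨ IsHandlePair (B i : Loop n g) (A i)) := by
      rintro (h | h)
      · simp at h
      · exact hAB.not_symm h
    rw [h.biderivation.sub_left, h.biderivation.sub_right, h.biderivation.sub_right, lieSum_sub]
    simp only [h.gen_gen, decGenGen]
    rw [if_pos (Or.inl rfl), if_pos (Or.inr hAB), if_pos (Or.inl rfl), if_neg hBA, if_pos hAB]
    ring
  · exact (h.gen_gen _ _ x y).trans (if_pos (Or.inl rfl))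

omit h in
theorem decGenGen_of_ne {X Y : Loop n g} (x y : Fin d) (h : X ≠ Y) (h1 : ¬IsHandlePair X Y)
    (h2 : ¬IsHandlePair Y X) : decGenGen b J X Y x y = 0 := by
  unfold decGenGen
  rw [if_neg (by tauto), if_neg h2]

/-- At one handle j^A and j^B have the same bracket with j^B, so their difference commutes with it.
-/
theorem freeGen_A_gen_B (i j : Fin g) (x y : Fin d) :
    br (J (A i) x - J (B i) x) (J (B j) y) = 0 := by
  rw [h.biderivation.sub_left]
  simp only [h.gen_gen, decGenGen]
  by_cases hij : i = j
  · subst hij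
    rw [if_pos (Or.inr (isHandlePair_A_B i)), if_pos (Or.inl rfl), sub_self]
  · have k1 : ¬((A i : Loop n g) = B j ∨ IsHandlePair (A i : Loop n g) (B j)) := by
      rw [isHandlePair_A_B_iff]; simp [hij]
    have k2 : ¬((B i : Loop n g) = B j ∨ IsHandlePair (B i : Loop n g) (B j)) := by
      simp [hij, IsHandlePair]
    rw [if_neg k1, if_neg k2, if_neg (by simp [IsHandlePair]), if_neg (by simp [IsHandlePair]), sub_zero]

theorem freeGen_of_ne {X Y : Loop n g} (hXY : X ≠ Y) (x y : Fin d) :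
    br (freeGen J X x) (freeGen J Y y) = 0 := by
  have hM : ∀ (i : Fin n) (j : Fin g) (x y : Fin d),
      br (J (M i) x) (J (A j) y - J (B j) y) = 0 := by
    intro i j x y
    rw [h.biderivation.sub_right, h.gen_gen, h.gen_gen, decGenGen_of_ne, decGenGen_of_ne, sub_zero]
    all_goals simp [IsHandlePair]
  rcases X with i | i | i <;> rcases Y with j | j | j
  · exact (h.gen_gen _ _ x y).trans
      (decGenGen_of_ne x y hXY (by simp [IsHandlePair]) (by simp [IsHandlePair]))
  · exact hM i j x y
  · exact (h.gen_gen _ _ x y).trans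
      (decGenGen_of_ne x y hXY (by simp [IsHandlePair]) (by simp [IsHandlePair]))
  · rw [h.biderivation.skew]
    exact neg_eq_zero.2 (hM j i y x)
  · have hij : i ≠ j := fun h => hXY (by rw [h])
    change br (J (A i) x - J (B i) x) (J (A j) y - J (B j) y) = 0
    rw [h.biderivation.sub_right, h.freeGen_A_gen_B, h.biderivation.sub_left, h.gen_gen, h.gen_gen,
      decGenGen_of_ne, decGenGen_of_ne, sub_zero, sub_zero]
    · simp
    · simp [IsHandlePair]
    · rw [isHandlePair_A_B_iff]; exact hij.symm
    · simp [hij]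
    · simp [IsHandlePair]
    · simp [IsHandlePair]
  · exact h.freeGen_A_gen_B i j x y
  · exact (h.gen_gen _ _ x y).trans
      (decGenGen_of_ne x y hXY (by simp [IsHandlePair]) (by simp [IsHandlePair]))
  · rw [h.biderivation.skew]
    exact neg_eq_zero.2 (h.freeGen_A_gen_B j i y x)
  · exact (h.gen_gen _ _ x y).trans
      (decGenGen_of_ne x y hXY (by simp [IsHandlePair]) (by simp [IsHandlePair]))

end IsDecoupled

end Abstract

end Decoupled

/-! ### The Jacobi identity for decoupled brackets. -/

section DecoupledPoisson

variable {E G : Type*} [NormedAddCommGroup E] [NormedSpace ℝ E] [FiniteDimensional ℝ E]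
  [TopologicalSpace G] [ChartedSpace E G] [Group G] [LieGroup 𝓘(ℝ, E) ∞ G]
  {d n g : ℕ} (b : Module.Basis (Fin d) ℝ (LieAlg E G))

theorem hol_update_of_ne {X Y : Loop n g} (h : X ≠ Y) (u : Loop n g → G) (v : G) :
    (hol Y : Word E G n g) (Function.update u X v) = (hol Y : Word E G n g) u := by
  change Function.update u X v Y = u Y
  exact Function.update_of_ne h.symm v u

theorem hol_inv_update_of_ne {X Y : Loop n g} (h : X ≠ Y) (u : Loop n g → G) (v : G) :
    ((hol Y)⁻¹ : Word E G n g) (Function.update u X v) = ((hol Y)⁻¹ : Word E G n g) u :=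
  congrArg Inv.inv (hol_update_of_ne (E := E) h u v)

theorem derivR_hol_of_ne {X Y : Loop n g} (h : X ≠ Y) (ξ : LieAlg E G) (x y : Fin d) :
    derivR X ξ (adFun b (hol Y) x y) = 0 := derivR_adFun_of_forall b ξ (hol_update_of_ne h) x y

theorem derivL_hol_of_ne {X Y : Loop n g} (h : X ≠ Y) (ξ : LieAlg E G) (x y : Fin d) :
    derivL X ξ (adFun b (hol Y) x y) = 0 := derivL_adFun_of_forall b ξ (hol_update_of_ne h) x y

theorem derivR_hol_inv_of_ne {X Y : Loop n g} (h : X ≠ Y) (ξ : LieAlg E G) (x y : Fin d) :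
    derivR X ξ (adFun b (hol Y)⁻¹ x y) = 0 := derivR_adFun_of_forall b ξ (hol_inv_update_of_ne h) x y

theorem derivL_hol_inv_of_ne {X Y : Loop n g} (h : X ≠ Y) (ξ : LieAlg E G) (x y : Fin d) :
    derivL X ξ (adFun b (hol Y)⁻¹ x y) = 0 := derivL_adFun_of_forall b ξ (hol_inv_update_of_ne h) x y

theorem freeFun_M (i : Fin n) (x : Fin d) (F : Fun E G n g) :
    freeFun b (M i) x F = -(derivR (M i) (b x) F + derivL (M i) (b x) F) := rfl

theorem freeFun_A (i : Fin g) (x : Fin d) (F : Fun E G n g) :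
    freeFun b (A i) x F = -derivR (A i) (b x) F
      + ∑ y, adFun b (hol (A i)) x y * derivL (B i) (b y) F := by
  simp [freeFun]

theorem freeFun_B (i : Fin g) (x : Fin d) (F : Fun E G n g) :
    freeFun b (B i) x F = -derivR (B i) (b x) F := rfl

/-- X = B_i is allowed: the loop B_i enters `freeFun` at A_i only through left translations, which
commute with right translations. -/
theorem derivR_freeFun_A {X : Loop n g} {i : Fin g} (h : X ≠ A i) (ξ : LieAlg E G)
    (y : Fin d) (F : Fun E G n g) :
    derivR X ξ (freeFun b (A i) y F) = freeFun b (A i) y (derivR X ξ F) := by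
  rw [freeFun_A, freeFun_A, map_add, map_neg, derivR_derivR_of_ne h,
    (isLeibniz_derivR X ξ).commute_sum (fun c => derivR_hol_of_ne b h ξ y c) F
      (fun c => derivR_derivL X _ ξ _ F)]

theorem derivL_freeFun_A {X : Loop n g} {i : Fin g} (h : X ≠ A i) (h' : X ≠ B i) (ξ : LieAlg E G)
    (y : Fin d) (F : Fun E G n g) :
    derivL X ξ (freeFun b (A i) y F) = freeFun b (A i) y (derivL X ξ F) := by
  rw [freeFun_A, freeFun_A, map_add, map_neg, ← derivR_derivL,
    (isLeibniz_derivL X ξ).commute_sum (fun c => derivL_hol_of_ne b h ξ y c) F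
      (fun c => derivL_derivL_of_ne h' _ _ F)]

/-- The generator at A_i moves u_{A_i} and u_{B_i}, any other only its own holonomy; this explains
the excluded pair. -/
theorem freeFun_adFun_hol_of_ne {X Y : Loop n g} (h : X ≠ Y)
    (h' : ∀ i, X = A i → Y ≠ B i) (a x y : Fin d) :
    freeFun b X a (adFun b (hol Y) x y) = 0 := by
  rcases X with i | i | i
  · rw [freeFun_M, derivR_hol_of_ne b h, derivL_hol_of_ne b h, add_zero, neg_zero]
  · rw [freeFun_A, derivR_hol_of_ne b h, neg_zero, zero_add]
    refine Finset.sum_eq_zero fun c _ => ?_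
    rw [derivL_hol_of_ne b (h' i rfl).symm, mul_zero]
  · rw [freeFun_B, derivR_hol_of_ne b h, neg_zero]

theorem freeFun_adFun_hol_inv_of_ne {X Y : Loop n g} (h : X ≠ Y)
    (h' : ∀ i, X = A i → Y ≠ B i) (a x y : Fin d) :
    freeFun b X a (adFun b (hol Y)⁻¹ x y) = 0 := by
  rcases X with i | i | i
  · rw [freeFun_M, derivR_hol_inv_of_ne b h, derivL_hol_inv_of_ne b h, add_zero, neg_zero]
  · rw [freeFun_A, derivR_hol_inv_of_ne b h, neg_zero, zero_add]
    refine Finset.sum_eq_zero fun c _ => ?_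
    rw [derivL_hol_inv_of_ne b (h' i rfl).symm, mul_zero]
  · rw [freeFun_B, derivR_hol_inv_of_ne b h, neg_zero]

theorem freeFun_commute {X Y : Loop n g} (h : X ≠ Y) (x y : Fin d) (F : Fun E G n g) :
    freeFun b X x (freeFun b Y y F) = freeFun b Y y (freeFun b X x F) := by
  have hMA : ∀ (i : Fin n) (j : Fin g) (x y : Fin d) (F : Fun E G n g),
      freeFun b (M i) x (freeFun b (A j) y F) = freeFun b (A j) y (freeFun b (M i) x F) := by
    intro i j x y F
    simp only [freeFun_M]
    rw [derivR_freeFun_A b (by simp), derivL_freeFun_A b (by simp) (by simp), map_neg, map_add]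
  have hMB : ∀ (i : Fin n) (j : Fin g) (x y : Fin d) (F : Fun E G n g),
      freeFun b (M i) x (freeFun b (B j) y F) = freeFun b (B j) y (freeFun b (M i) x F) := by
    intro i j x y F
    simp only [freeFun_M, freeFun_B, map_neg, map_add]
    rw [derivR_derivR_of_ne (by simp), derivR_derivL]
    ring
  have hAB : ∀ (i j : Fin g) (x y : Fin d) (F : Fun E G n g),
      freeFun b (A i) x (freeFun b (B j) y F) = freeFun b (B j) y (freeFun b (A i) x F) := by
    intro i j x y F
    simp only [freeFun_B, map_neg]
    rw [derivR_freeFun_A b (by simp)]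
  rcases X with i | i | i <;> rcases Y with j | j | j
  · simp only [freeFun_M, map_neg, map_add]
    rw [derivR_derivR_of_ne h, derivL_derivL_of_ne h, derivR_derivL, ← derivR_derivL]
    ring
  · exact hMA i j x y F
  · exact hMB i j x y F
  · exact (hMA j i y x F).symm
  · rw [freeFun_A b j y (freeFun b (A i) x F)]
    conv_lhs => rw [freeFun_A b j y F, map_add, map_neg]
    rw [derivR_freeFun_A b h.symm, (isLeibniz_freeFun b (A i) x).commute_sum
      (fun c => freeFun_adFun_hol_of_ne b h (by simp) x y c) F
      (fun c => (derivL_freeFun_A b (by simp) (fun h2 => h (by simp at h2; rw [h2])) _ x F).symm)]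
  · exact hAB i j x y F
  · exact (hMB j i y x F).symm
  · exact (hAB j i y x F).symm
  · simp only [freeFun_B, map_neg]
    rw [derivR_derivR_of_ne h]

/-- Invariance of the structure constants, contracted with v. It lets two Ad* factors be traded for
one inside a Lie sum. -/
theorem sum_lieSum_adFun (w : Word E G n g) (x y : Fin d) (v : Fin d → Fun E G n g) :
    ∑ p, ∑ q, adFun b w x p * adFun b w y q * lieSum b p q v
      = lieSum b x y fun z => ∑ k, adFun b w z k * v k := by
  have h1 : ∀ k, ∑ p, ∑ q, (structConst b p q k • (adFun b w x p * adFun b w y q)) * v k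
      = ∑ c, (structConst b x y c • adFun b w c k) * v k := by
    intro k
    rw [← Finset.sum_mul, ← adFun_structConst, Finset.sum_mul]
    exact Finset.sum_congr rfl fun p _ => (Finset.sum_mul _ _ _).symm
  simp only [lieSum, Finset.mul_sum, Finset.smul_sum]
  have h2 : ∀ p q k, adFun b w x p * adFun b w y q * structConst b p q k • v k
      = (structConst b p q k • (adFun b w x p * adFun b w y q)) * v k := fun p q k => by
    rw [mul_smul_comm, smul_mul_assoc]
  simp only [h2]
  rw [Finset.sum_congr rfl fun p _ => Finset.sum_comm, Finset.sum_comm]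
  simp only [h1]
  rw [Finset.sum_comm]
  simp only [smul_mul_assoc]

theorem freeFun_self (X : Loop n g) (x y : Fin d) (F : Fun E G n g) :
    freeFun b X x (freeFun b X y F) - freeFun b X y (freeFun b X x F)
      = -lieSum b x y fun z => freeFun b X z F := by
  rcases X with i | i | i
  · simp only [freeFun_M, map_neg, map_add, lieSum_neg, neg_neg]
    have h1 := derivR_lie_basis b (M i : Loop n g) x y F
    have h2 := derivL_lie_basis b (M i : Loop n g) x y F
    have h3 := derivR_derivL (M i : Loop n g) (M i) (b x) (b y) F
    have h4 := derivR_derivL (M i : Loop n g) (M i) (b y) (b x) F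
    simp only [lieSum, smul_add, Finset.sum_add_distrib]
    linear_combination h1 + h2 + h3 - h4
  -- With P = Ad*(u_A) and D_x = -R_x + P_x^c L_c, the cross terms R P contribute -2 f P L and the
  -- commutator of the L terms contributes + f P L. Together with [R, R] = f R this leaves -f D.
  · have hA : ∀ x y, derivR (A i : Loop n g) (b x) (∑ z, adFun b (hol (A i)) y z * derivL (B i) (b z) F)
        = lieSum b x y (fun c => ∑ z, adFun b (hol (A i)) c z * derivL (B i) (b z) F)
          + ∑ z, adFun b (hol (A i)) y z * derivL (B i) (b z) (derivR (A i) (b x) F) := by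
      intro x y
      simp only [map_sum, derivR_mul, derivR_adFun_hol, derivR_derivL, Finset.sum_add_distrib, lieSum,
        Finset.smul_sum]
      rw [add_comm]
      congr 1
      rw [Finset.sum_comm]
      refine Finset.sum_congr rfl fun z _ => ?_
      rw [Finset.mul_sum]
      refine Finset.sum_congr rfl fun c _ => ?_
      rw [mul_smul_comm, mul_comm]
    have hL : ∀ p y, derivL (B i : Loop n g) (b p) (∑ z, adFun b (hol (A i)) y z * derivL (B i) (b z) F)
        = ∑ z, adFun b (hol (A i)) y z * derivL (B i) (b p) (derivL (B i) (b z) F) := by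
      intro p y
      simp only [map_sum, derivL_mul]
      refine Finset.sum_congr rfl fun z _ => ?_
      rw [derivL_hol_of_ne b (by simp), mul_zero, add_zero]
    have hLL : ∑ p, adFun b (hol (A i)) x p * (∑ q, adFun b (hol (A i)) y q *
          derivL (B i : Loop n g) (b p) (derivL (B i) (b q) F))
        - ∑ q, adFun b (hol (A i)) y q * (∑ p, adFun b (hol (A i)) x p *
          derivL (B i : Loop n g) (b q) (derivL (B i) (b p) F))
        = lieSum b x y (fun c => ∑ z, adFun b (hol (A i)) c z * derivL (B i) (b z) F) := by
      rw [← sum_lieSum_adFun]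
      simp only [Finset.mul_sum]
      rw [Finset.sum_comm (s := Finset.univ (α := Fin d)) (t := Finset.univ (α := Fin d))
        (f := fun q p => adFun b (hol (A i)) y q * (adFun b (hol (A i)) x p *
          derivL (B i : Loop n g) (b q) (derivL (B i) (b p) F))), ← Finset.sum_sub_distrib]
      refine Finset.sum_congr rfl fun p _ => ?_
      rw [← Finset.sum_sub_distrib]
      refine Finset.sum_congr rfl fun q _ => ?_
      have h2 := derivL_lie_basis b (B i : Loop n g) p q F
      simp only [lieSum]
      rw [← h2]
      ring
    have h1 := derivR_lie_basis b (A i : Loop n g) x y F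
    have hs : lieSum b y x (fun c => ∑ z, adFun b (hol (A i)) c z * derivL (B i) (b z) F)
        = -lieSum b x y (fun c => ∑ z, adFun b (hol (A i)) c z * derivL (B i) (b z) F) :=
      lieSum_skew b y x _
    have e : (lieSum b x y fun z => freeFun b (A i : Loop n g) z F)
        = -(∑ z, structConst b x y z • derivR (A i) (b z) F)
          + lieSum b x y (fun c => ∑ z, adFun b (hol (A i)) c z * derivL (B i) (b z) F) := by
      simp only [freeFun_A, lieSum, smul_add, smul_neg, Finset.sum_add_distrib, Finset.sum_neg_distrib]
    rw [e]
    simp only [freeFun_A, map_neg, map_add, hA, hL]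
    linear_combination h1 + hLL + hs
  · simp only [freeFun_B, map_neg, lieSum_neg, neg_neg]
    exact derivR_lie_basis b (B i : Loop n g) x y F

section Abstract

variable {R : Type*} [CommRing R] [Algebra ℝ R]
  {br : R → R → R} {J : Loop n g → Fin d → R} {f : Fun E G n g →ₐ[ℝ] R}

theorem IsSkewBiderivation.jacobi_of_vanish {br : R → R → R} (h : IsSkewBiderivation br) {p q r : R}
    (h1 : br q r = 0) (h2 : br r p = 0) (h3 : br p q = 0) :
    br p (br q r) + br q (br r p) + br r (br p q) = 0 := by
  rw [h1, h2, h3, h.zero_right, h.zero_right, h.zero_right, add_zero, add_zero]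

theorem IsSkewBiderivation.jacobi_rotate {br : R → R → R} {p q r : R}
    (h1 : br q (br r p) + br r (br p q) + br p (br q r) = 0) :
    br p (br q r) + br q (br r p) + br r (br p q) = 0 := by
  rw [← h1]
  ring

variable {b}

theorem IsDecoupled.jacobi_gen (h : IsDecoupled b br J f) (X Y Z : Loop n g) (x y z : Fin d) :
    br (freeGen J X x) (br (freeGen J Y y) (freeGen J Z z))
      + br (freeGen J Y y) (br (freeGen J Z z) (freeGen J X x))
      + br (freeGen J Z z) (br (freeGen J X x) (freeGen J Y y)) = 0 := by
  have key : ∀ (X Y : Loop n g) (x y z : Fin d), X ≠ Y →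
      br (freeGen J X x) (br (freeGen J Y y) (freeGen J Y z))
      + br (freeGen J Y y) (br (freeGen J Y z) (freeGen J X x))
      + br (freeGen J Y z) (br (freeGen J X x) (freeGen J Y y)) = 0 := by
    intro X Y x y z hXY
    rw [h.freeGen_of_ne hXY, h.freeGen_of_ne hXY.symm, h.biderivation.zero_right,
      h.biderivation.zero_right, h.freeGen_self, h.biderivation.neg_right,
      h.biderivation.lieSum_right]
    simp [h.freeGen_of_ne hXY, lieSum]
  by_cases h1 : X = Y
  · subst h1
    by_cases h2 : X = Z
    · subst h2
      simp only [h.freeGen_self, h.biderivation.neg_right, h.biderivation.lieSum_right, lieSum_neg,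
        neg_neg]
      exact lieSum_jacobi b x y z _
    · exact IsSkewBiderivation.jacobi_rotate (IsSkewBiderivation.jacobi_rotate
        (key Z X z x y (Ne.symm h2)))
  · by_cases h2 : X = Z
    · subst h2
      exact IsSkewBiderivation.jacobi_rotate (key Y X y z x (Ne.symm h1))
    · by_cases h3 : Y = Z
      · subst h3
        exact key X Y x y z h1
      · exact h.biderivation.jacobi_of_vanish (h.freeGen_of_ne h3 _ _)
          (h.freeGen_of_ne (Ne.symm h2) _ _) (h.freeGen_of_ne h1 _ _)

/-- Equivalent to `freeGen` acting on functions compatibly with its brackets, so it follows from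
`freeFun_self` on one loop and `freeFun_commute` on two. -/
theorem IsDecoupled.jacobi_gen_gen_fn (h : IsDecoupled b br J f) (X Y : Loop n g) (x y : Fin d)
    (F : Fun E G n g) :
    br (freeGen J X x) (br (freeGen J Y y) (f F)) + br (freeGen J Y y) (br (f F) (freeGen J X x))
      + br (f F) (br (freeGen J X x) (freeGen J Y y)) = 0 := by
  rw [h.biderivation.skew (f F) (freeGen J X x), h.biderivation.skew (f F) (br _ _),
    h.biderivation.neg_right]
  simp only [h.freeGen_fn]
  by_cases hXY : X = Y
  · subst hXY
    rw [h.freeGen_self, h.biderivation.neg_left, neg_neg]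
    have h1 : br (lieSum b x y (freeGen J X)) (f F) = f (lieSum b x y fun z => freeFun b X z F) := by
      simp only [lieSum]
      rw [h.biderivation.sum_left, map_sum]
      refine Finset.sum_congr rfl fun z _ => ?_
      rw [h.biderivation.smul_left, h.freeGen_fn, map_smul]
    rw [h1, ← sub_eq_add_neg, ← map_sub, freeFun_self, ← map_add, neg_add_cancel, map_zero]
  · rw [h.freeGen_of_ne hXY, h.biderivation.zero_left, freeFun_commute b hXY]
    ring

theorem IsDecoupled.jacobi_gen_fn_fn (h : IsDecoupled b br J f) (X : Loop n g) (x : Fin d)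
    (F F' : Fun E G n g) :
    br (freeGen J X x) (br (f F) (f F')) + br (f F) (br (f F') (freeGen J X x))
      + br (f F') (br (freeGen J X x) (f F)) = 0 := by
  rw [h.biderivation.skew (f F') (freeGen J X x), h.biderivation.neg_right, h.freeGen_fn,
    h.freeGen_fn, h.fn_fn, h.fn_fn, h.fn_fn, h.biderivation.zero_right]
  ring

/-- The brackets of a decoupled Poisson structure satisfy the Jacobi identity. -/
theorem IsDecoupled.isPoissonBracket (h : IsDecoupled b br J f)
    (hJ : ∀ p : R → Prop, (∀ X x, p (J X x)) → (∀ F, p (f F)) → (∀ φ ψ, p φ → p ψ → p (φ + ψ)) →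
      (∀ φ ψ, p φ → p ψ → p (φ * ψ)) → ∀ φ, p φ) : IsPoissonBracket br := by
  refine h.biderivation.isPoissonBracket
    (S := {r | (∃ X x, r = freeGen J X x) ∨ ∃ F, r = f F}) ?_ ?_
  · intro p hS hadd hmul
    refine hJ p ?_ (fun F => hS _ (Or.inr ⟨F, rfl⟩)) hadd hmul
    rintro (i | i | i) x
    · exact hS _ (Or.inl ⟨M i, x, rfl⟩)
    -- j^A is recovered as (j^A - j^B) + j^B, so the diagonal generators generate the same algebra.
    · have := hadd _ _ (hS _ (Or.inl ⟨A i, x, rfl⟩)) (hS _ (Or.inl ⟨B i, x, rfl⟩))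
      simpa [freeGen] using this
    · exact hS _ (Or.inl ⟨B i, x, rfl⟩)
  · rintro _ (⟨X, x, rfl⟩ | ⟨F, rfl⟩) _ (⟨Y, y, rfl⟩ | ⟨F', rfl⟩) _ (⟨Z, z, rfl⟩ | ⟨F'', rfl⟩)
    · exact h.jacobi_gen X Y Z x y z
    · exact h.jacobi_gen_gen_fn X Y x y F''
    · exact IsSkewBiderivation.jacobi_rotate (IsSkewBiderivation.jacobi_rotate
        (h.jacobi_gen_gen_fn Z X z x F'))
    · exact h.jacobi_gen_fn_fn X x F' F''
    · exact IsSkewBiderivation.jacobi_rotate (h.jacobi_gen_gen_fn Y Z y z F)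
    · exact IsSkewBiderivation.jacobi_rotate (h.jacobi_gen_fn_fn Y y F'' F)
    · exact IsSkewBiderivation.jacobi_rotate (IsSkewBiderivation.jacobi_rotate
        (h.jacobi_gen_fn_fn Z z F F'))
    · exact h.biderivation.jacobi_of_vanish (h.fn_fn _ _) (h.fn_fn _ _) (h.fn_fn _ _)

end Abstract

end DecoupledPoisson

/-! ### Infinitesimal covariance of vectors and matrices. -/

section Covariance

variable {R : Type*} [CommRing R] [Algebra ℝ R] {d : ℕ}

/-- The covector `v` transforms under the derivation `δ` by the matrix `-N`. -/
def CovAt (δ : Derivation ℝ R R) (N : Matrix (Fin d) (Fin d) R) (v : Fin d → R) : Prop :=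
  (δ ∘ v) = -N.mulVec v

/-- The matrix `P` transforms under the derivation `δ` by the commutator with `-N`. -/
def ConjAt (δ : Derivation ℝ R R) (N P : Matrix (Fin d) (Fin d) R) : Prop :=
  P.map δ = P * N - N * P

theorem map_der_mul (δ : Derivation ℝ R R) (P Q : Matrix (Fin d) (Fin d) R) :
    (P * Q).map δ = P.map δ * Q + P * Q.map δ := by
  ext x y
  simp only [Matrix.map_apply, Matrix.mul_apply, Matrix.add_apply, map_sum, Derivation.leibniz,
    smul_eq_mul, ← Finset.sum_add_distrib]
  exact Finset.sum_congr rfl fun k _ => by ring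

theorem map_der_sub (δ : Derivation ℝ R R) (P Q : Matrix (Fin d) (Fin d) R) :
    (P - Q).map δ = P.map δ - Q.map δ := by
  ext x y
  simp

theorem map_der_one (δ : Derivation ℝ R R) : (1 : Matrix (Fin d) (Fin d) R).map δ = 0 := by
  ext x y
  simp [Matrix.one_apply, apply_ite δ]

theorem der_comp_mulVec (δ : Derivation ℝ R R) (P : Matrix (Fin d) (Fin d) R) (v : Fin d → R) :
    δ ∘ (P.mulVec v) = (P.map δ).mulVec v + P.mulVec (δ ∘ v) := by
  ext x
  simp only [Function.comp_apply, Matrix.mulVec, dotProduct, Matrix.map_apply, Pi.add_apply, map_sum,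
    Derivation.leibniz, smul_eq_mul, ← Finset.sum_add_distrib]
  exact Finset.sum_congr rfl fun k _ => by ring

theorem der_comp_add (δ : Derivation ℝ R R) (v w : Fin d → R) : δ ∘ (v + w) = δ ∘ v + δ ∘ w := by
  ext x
  simp

variable {δ δ' : Derivation ℝ R R} {N N' P Q : Matrix (Fin d) (Fin d) R} {v w : Fin d → R}

theorem CovAt.add (hv : CovAt δ N v) (hw : CovAt δ N w) : CovAt δ N (v + w) := by
  rw [CovAt, der_comp_add, hv, hw, Matrix.mulVec_add]
  abel

theorem CovAt.neg (hv : CovAt δ N v) : CovAt δ N (-v) := by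
  rw [CovAt, Matrix.mulVec_neg, ← hv]
  ext x
  simp

theorem CovAt.sub (hv : CovAt δ N v) (hw : CovAt δ N w) : CovAt δ N (v - w) := by
  rw [sub_eq_add_neg]
  exact hv.add hw.neg

theorem CovAt.zero : CovAt δ N 0 := by
  ext x
  simp

theorem CovAt.sum {ι : Type*} (s : Finset ι) {u : ι → Fin d → R} (h : ∀ i ∈ s, CovAt δ N (u i)) :
    CovAt δ N (∑ i ∈ s, u i) :=
  Finset.sum_induction u _ (fun _ _ => CovAt.add) CovAt.zero h

/-- The infinitesimal form of (g P g⁻¹)(g v) = g (P v). Through such closure rules, covariance of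
composite covectors follows from that of their constituents. -/
theorem ConjAt.mulVec (hP : ConjAt δ N P) (hv : CovAt δ N v) : CovAt δ N (P.mulVec v) := by
  rw [CovAt, der_comp_mulVec, hP, hv, Matrix.sub_mulVec, Matrix.mulVec_neg, Matrix.mulVec_mulVec,
    Matrix.mulVec_mulVec]
  abel

theorem ConjAt.mul (hP : ConjAt δ N P) (hQ : ConjAt δ N Q) : ConjAt δ N (P * Q) := by
  rw [ConjAt, map_der_mul, hP, hQ]
  noncomm_ring

theorem ConjAt.inv (hP : ConjAt δ N P) (hPQ : P * Q = 1) (hQP : Q * P = 1) : ConjAt δ N Q := by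
  have h : (Q * P).map δ = 0 := by rw [hQP, map_der_one]
  rw [map_der_mul, hP] at h
  have h2 := congrArg (· * Q) h
  simp only [add_mul, Matrix.mul_assoc, hPQ, Matrix.mul_one, Matrix.zero_mul] at h2
  rw [ConjAt, eq_neg_of_add_eq_zero_left h2, Matrix.sub_mul, Matrix.mul_sub, Matrix.mul_assoc N P Q,
    hPQ, Matrix.mul_assoc P N Q, ← Matrix.mul_assoc Q P, hQP]
  simp

/-- The matrices of two derivations add. This allows a generator to be split into pieces that each
act simply. -/
theorem CovAt.add_der (h : CovAt δ N v) (h' : CovAt δ' N' v) : CovAt (δ + δ') (N + N') v := by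
  rw [CovAt, Matrix.add_mulVec, neg_add, ← h, ← h']
  rfl

theorem ConjAt.add_der (h : ConjAt δ N P) (h' : ConjAt δ' N' P) : ConjAt (δ + δ') (N + N') P := by
  have : P.map (δ + δ') = P.map δ + P.map δ' := by
    ext
    simp
  rw [ConjAt, this, h, h']
  noncomm_ring

theorem covAt_zero_iff : CovAt δ 0 v ↔ ∀ x, δ (v x) = 0 := by
  simp [CovAt, funext_iff]

theorem conjAt_zero_iff : ConjAt δ 0 P ↔ ∀ x y, δ (P x y) = 0 := by
  simp [ConjAt, ← Matrix.ext_iff]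

end Covariance

/-! ### Coadjoint matrices and the matrices of ad. -/

section CoadjointMatrices

variable {E G : Type*} [NormedAddCommGroup E] [NormedSpace ℝ E] [FiniteDimensional ℝ E]
  [TopologicalSpace G] [ChartedSpace E G] [Group G] [LieGroup 𝓘(ℝ, E) ∞ G]
  {d n g : ℕ} (b : Module.Basis (Fin d) ℝ (LieAlg E G))
  {R : Type*} [CommRing R] [Algebra ℝ R] (f : Fun E G n g →ₐ[ℝ] R)

variable (R) in
/-- The matrix `(f_{ay}^z)_{y, z}` over `R`. -/
def adMat (a : Fin d) : Matrix (Fin d) (Fin d) R :=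
  Matrix.of fun y z => algebraMap ℝ R (structConst b a y z)

theorem adMat_mulVec (a : Fin d) (v : Fin d → R) (y : Fin d) :
    (adMat b R a).mulVec v y = lieSum b a y v := by
  simp [Matrix.mulVec, dotProduct, adMat, lieSum, Algebra.smul_def]

/-- The coadjoint matrix of a word, with entries mapped to `R`. -/
def adW (w : Word E G n g) : Matrix (Fin d) (Fin d) R := Matrix.of fun x y => f (adFun b w x y)

theorem adW_mul (w w' : Word E G n g) : adW b f (w * w') = adW b f w' * adW b f w := by
  ext x y
  simp [adW, adFun_mul, Matrix.mul_apply]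

theorem adW_one : adW b f (1 : Word E G n g) = 1 := by
  ext x y
  simp only [adW, Matrix.of_apply, adFun_one, Matrix.one_apply]
  split_ifs <;> simp

theorem adW_mul_inv (w : Word E G n g) : adW b f w * adW b f w⁻¹ = 1 := by
  rw [← adW_mul, inv_mul_cancel, adW_one]

theorem adW_inv_mul (w : Word E G n g) : adW b f w⁻¹ * adW b f w = 1 := by
  rw [← adW_mul, mul_inv_cancel, adW_one]

/-- The matrix form of the Ad-invariance of the structure constants, arranged to avoid inverses;
`sum_adMat` is its conjugation form. -/
theorem adW_mul_sum_adMat (w : Word E G n g) (a : Fin d) :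
    adW b f w * ∑ c, adW b f w a c • adMat b R c = adMat b R a * adW b f w := by
  ext y k
  have h := congrArg f (adFun_structConst b w a y k)
  simp only [map_sum, map_smul, map_mul] at h
  simp only [Matrix.mul_apply, Matrix.sum_apply, Matrix.smul_apply, adW, adMat, Matrix.of_apply,
    smul_eq_mul, Finset.mul_sum]
  rw [Finset.sum_comm]
  simp only [Algebra.smul_def] at h
  rw [← h]
  exact Finset.sum_congr rfl fun p _ => Finset.sum_congr rfl fun q _ => by ring

theorem sum_adMat (w : Word E G n g) (a : Fin d) :
    ∑ c, adW b f w a c • adMat b R c = adW b f w⁻¹ * adMat b R a * adW b f w := by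
  rw [Matrix.mul_assoc, ← adW_mul_sum_adMat, ← Matrix.mul_assoc, adW_inv_mul, Matrix.one_mul]

theorem adMat_skew (x y z : Fin d) : adMat b R x y z = -adMat b R y x z := by
  simp only [adMat, Matrix.of_apply]
  rw [structConst_skew, map_neg]

/-- The entries of `P ad_b` in terms of `∑ c, P_a^c ad_c`. -/
theorem mul_adMat_apply (P : Matrix (Fin d) (Fin d) R) (a y k : Fin d) :
    (P * adMat b R y) a k = -(∑ c, P a c • adMat b R c) y k := by
  simp only [Matrix.mul_apply, Matrix.sum_apply, Matrix.smul_apply, smul_eq_mul,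
    ← Finset.sum_neg_distrib]
  refine Finset.sum_congr rfl fun c _ => ?_
  rw [adMat_skew b y c, mul_neg]

/-- Skewness of the structure constants exchanges the label y of ad with the row index a. Together
with `mul_adMat_apply` it turns an action of all generators on one matrix entry into a matrix
indexed by the generators. -/
theorem adMat_mul_apply (P : Matrix (Fin d) (Fin d) R) (a y k : Fin d) :
    (adMat b R y * P) a k = -(adMat b R a * P) y k := by
  simp only [Matrix.mul_apply, ← Finset.sum_neg_distrib]
  refine Finset.sum_congr rfl fun c _ => ?_
  rw [adMat_skew b y a, neg_mul]

theorem map_derivR_adW (X : Loop n g) (a : Fin d) :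
    (Matrix.of fun x y => f (derivR X (b a) (adFun b (hol X) x y)))
      = adMat b R a * adW b f (hol X) := by
  ext x y
  simp [derivR_adFun_hol, Matrix.mul_apply, adMat, adW, Algebra.smul_def]

theorem map_derivL_adW (X : Loop n g) (a : Fin d) :
    (Matrix.of fun x y => f (derivL X (b a) (adFun b (hol X) x y)))
      = -(adW b f (hol X) * adMat b R a) := by
  ext x y
  simp only [derivL_adFun_hol, Matrix.mul_apply, adMat, adW, Algebra.smul_def, Matrix.of_apply,
    Matrix.neg_apply, map_neg, map_sum, map_mul, AlgHom.commutes]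
  exact congrArg _ (Finset.sum_congr rfl fun c _ => mul_comm _ _)

end CoadjointMatrices

/-! ### Local generators and handle momenta acting on functions and holonomies. -/

section HandleBlocks

variable {E G : Type*} [NormedAddCommGroup E] [NormedSpace ℝ E] [FiniteDimensional ℝ E]
  [TopologicalSpace G] [ChartedSpace E G] [Group G] [LieGroup 𝓘(ℝ, E) ∞ G]
  {d n g : ℕ} (b : Module.Basis (Fin d) ℝ (LieAlg E G))
  {R : Type*} [CommRing R] [Algebra ℝ R]

/-- The local part of the images of the generators `J` under the inverse decoupling
transformation. -/
def localGen (f : Fun E G n g →ₐ[ℝ] R) (J : Loop n g → Fin d → R) (X : Loop n g) : Fin d → R :=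
  match X with
  | Sum.inl i => J (M i)
  | Sum.inr (Sum.inl i) => J (A i) - (adW b f (hol (A i))⁻¹).mulVec (J (A i) - J (B i))
  | Sum.inr (Sum.inr i) => J (B i) - (adW b f (hol (A i))⁻¹).mulVec (J (A i) - J (B i))

/-- The derivation of `C^∞(G^(n+2g))` given by `localGen`. -/
def localFun (X : Loop n g) (x : Fin d) : Fun E G n g →ₗ[ℝ] Fun E G n g :=
  match X with
  | Sum.inl i => decGenFun b (M i) x
  | Sum.inr (Sum.inl i) => decGenFun b (A i) x - derivL (A i) (b x) - derivL (B i) (b x)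
  | Sum.inr (Sum.inr i) => decGenFun b (B i) x - derivL (A i) (b x) - derivL (B i) (b x)

/-- Separates the flower action into the part within the block and the part moving later blocks,
matching the two terms of `coupledGen`. -/
theorem flowerGenFun_eq (X : Loop n g) (x : Fin d) :
    flowerGenFun b X x = localFun b X x - tailDeriv b X x := by
  rcases X with i | i | i
  · rfl
  · simp only [flowerGenFun, localFun, decGenFun]
    abel
  · simp only [flowerGenFun, localFun, decGenFun]
    abel

/-- The derivation of `C^∞(G^(n+2g))` given by the total momentum of the handle `k`. -/
def handleFun (k : Fin g) (x : Fin d) : Fun E G n g →ₗ[ℝ] Fun E G n g :=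
  -(derivR (A k) (b x) + derivL (A k) (b x)) - (derivR (B k) (b x) + derivL (B k) (b x))

/-- The total momentum of the handle `k`. -/
def handleMom (f : Fun E G n g →ₐ[ℝ] R) (J : Loop n g → Fin d → R) (k : Fin g) : Fin d → R :=
  (J (A k) - (adW b f (hol (A k))⁻¹).mulVec (J (A k)))
    + ((adW b f (hol (A k))⁻¹).mulVec (J (B k))
      - (adW b f ((hol (B k))⁻¹ * hol (A k))).mulVec (J (B k)))

theorem handleMom_eq (f : Fun E G n g →ₐ[ℝ] R) (J : Loop n g → Fin d → R) (k : Fin g) :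
    handleMom b f J k = localGen b f J (A k)
      - (adW b f ((hol (B k))⁻¹ * hol (A k))).mulVec (J (B k)) := by
  simp only [handleMom, localGen, Matrix.mulVec_sub]
  abel

theorem sum_adFun_cancel (w : Word E G n g) (x : Fin d) (v : Fin d → Fun E G n g) :
    ∑ c, adFun b w⁻¹ x c * ∑ y, adFun b w c y * v y = v x := by
  simp only [Finset.mul_sum]
  rw [Finset.sum_comm]
  simp only [← mul_assoc, ← Finset.sum_mul, ← adFun_mul, mul_inv_cancel, adFun_one, ite_mul, one_mul,
    zero_mul, Finset.sum_ite_eq, Finset.mem_univ, if_true]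

/-- Ad*(u_A⁻¹) turns -R_A into L_A and cancels the factor Ad*(u_A) in front of L_B. Hence
Ad*(u_A⁻¹)(j^A - j^B) generates simultaneous left translation of u_A and u_B. -/
theorem adFun_inv_freeFun (i : Fin g) (x : Fin d) (F : Fun E G n g) :
    ∑ c, adFun b (hol (A i))⁻¹ x c * freeFun b (A i) c F
      = derivL (A i) (b x) F + derivL (B i) (b x) F := by
  simp only [freeFun_A, mul_add, Finset.sum_add_distrib]
  rw [sum_adFun_cancel b (hol (A i)) x fun y => derivL (B i) (b y) F, derivL_eq_derivR b (A i)]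
  simp

theorem map_adW (f : Fun E G n g →ₐ[ℝ] R) {δ : Derivation ℝ R R} {D : Fun E G n g →ₗ[ℝ] Fun E G n g}
    (h : ∀ F, δ (f F) = f (D F)) (w : Word E G n g) :
    (adW b f w).map δ = Matrix.of fun x y => f (D (adFun b w x y)) := by
  ext x y
  exact h _

namespace IsDecoupled

variable {b} {br : R → R → R} {J : Loop n g → Fin d → R} {f : Fun E G n g →ₐ[ℝ] R}
  (h : IsDecoupled b br J f)
include h

/-- Functions commute with each other, so bracketing with a function is linear over functions in the
other argument. -/
theorem br_mulVec_fn {v : Fin d → R} {D : Fin d → Fun E G n g →ₗ[ℝ] Fun E G n g}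
    (hv : ∀ c F, br (v c) (f F) = f (D c F)) (w : Word E G n g) (x : Fin d) (F : Fun E G n g) :
    br ((adW b f w).mulVec v x) (f F) = f (∑ c, adFun b w x c * D c F) := by
  change br (∑ c, adW b f w x c * v c) (f F) = _
  rw [h.biderivation.sum_left, map_sum]
  refine Finset.sum_congr rfl fun c _ => ?_
  rw [h.biderivation.leibniz_left, hv, map_mul]
  simp [adW, h.fn_fn]

theorem localGen_fn (X : Loop n g) (x : Fin d) (F : Fun E G n g) :
    br (localGen b f J X x) (f F) = f (localFun b X x F) := by
  have key : ∀ i : Fin g, br ((adW b f (hol (A i))⁻¹).mulVec (J (A i) - J (B i)) x) (f F)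
      = f (derivL (A i) (b x) F + derivL (B i) (b x) F) := by
    intro i
    rw [← adFun_inv_freeFun]
    exact h.br_mulVec_fn (h.freeGen_fn (A i)) _ _ _
  rcases X with i | i | i
  · exact h.gen_fn _ _ _
  · change br (J (A i) x - (adW b f (hol (A i))⁻¹).mulVec (J (A i) - J (B i)) x) (f F) = _
    rw [h.biderivation.sub_left, key, h.gen_fn, ← map_sub]
    congr 1
    simp only [localFun, LinearMap.sub_apply]
    ring
  · change br (J (B i) x - (adW b f (hol (A i))⁻¹).mulVec (J (A i) - J (B i)) x) (f F) = _
    rw [h.biderivation.sub_left, key, h.gen_fn, ← map_sub]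
    congr 1
    simp only [localFun, LinearMap.sub_apply]
    ring

/-- Subtracting Ad*(u_B⁻¹ u_A) j^B removes the twisted R_B term of the local generator and leaves
conjugation of u_A and u_B by the same element. -/
theorem handleMom_fn (i : Fin g) (x : Fin d) (F : Fun E G n g) :
    br (handleMom b f J i x) (f F) = f (handleFun b i x F) := by
  rw [handleMom_eq]
  change br (localGen b f J (A i) x - (adW b f _).mulVec (J (B i)) x) (f F) = _
  rw [h.biderivation.sub_left, h.localGen_fn, h.br_mulVec_fn (fun c F => h.gen_fn (B i) c F), ← map_sub]
  congr 1
  simp only [handleFun, localFun, decGenFun, LinearMap.sub_apply, LinearMap.neg_apply, LinearMap.add_apply,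
    LinearMap.sum_apply, LinearMap.comp_apply, LinearMap.mulLeft_apply, mul_neg,
    Finset.sum_neg_distrib]
  ring

/-! The action of the generators on the coadjoint matrices. -/

theorem puncture_conj (i : Fin n) (a : Fin d) :
    ConjAt (h.biderivation.der (J (M i) a)) (adMat b R a) (adW b f (hol (M i))) := by
  rw [ConjAt, map_adW b f (h.gen_fn (M i) a), ← neg_sub, ← map_derivR_adW, sub_eq_add_neg,
    ← map_derivL_adW]
  ext x y
  simp [decGenFun]

theorem freeGen_A_map_A (i : Fin g) (a : Fin d) :
    (adW b f (hol (A i))).map (h.biderivation.der (freeGen J (A i) a))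
      = -(adMat b R a * adW b f (hol (A i))) := by
  rw [map_adW b f (h.freeGen_fn (A i) a), ← map_derivR_adW]
  ext x y
  simp [freeFun_A, derivL_hol_of_ne]

theorem freeGen_A_map_B (i : Fin g) (a : Fin d) :
    (adW b f (hol (B i))).map (h.biderivation.der (freeGen J (A i) a))
      = -(adW b f (hol (B i)) * (adW b f (hol (A i))⁻¹ * adMat b R a * adW b f (hol (A i)))) := by
  rw [map_adW b f (h.freeGen_fn (A i) a), ← sum_adMat, Finset.mul_sum, ← Finset.sum_neg_distrib]
  simp only [Matrix.mul_smul, ← smul_neg, ← map_derivL_adW]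
  ext x y
  simp [freeFun_A, derivR_hol_of_ne, Matrix.sum_apply, adW]

theorem freeGen_B_map_A (i : Fin g) (a : Fin d) :
    (adW b f (hol (A i))).map (h.biderivation.der (freeGen J (B i) a)) = 0 := by
  rw [map_adW b f (h.freeGen_fn (B i) a)]
  ext x y
  simp [freeFun_B, derivR_hol_of_ne]

theorem freeGen_B_map_B (i : Fin g) (a : Fin d) :
    (adW b f (hol (B i))).map (h.biderivation.der (freeGen J (B i) a))
      = -(adMat b R a * adW b f (hol (B i))) := by
  rw [map_adW b f (h.freeGen_fn (B i) a), ← map_derivR_adW]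
  ext x y
  simp [freeFun_B]

theorem handleMom_conj_A (i : Fin g) (a : Fin d) :
    ConjAt (h.biderivation.der (handleMom b f J i a)) (adMat b R a) (adW b f (hol (A i))) := by
  rw [ConjAt, map_adW b f (h.handleMom_fn i a), ← neg_sub, ← map_derivR_adW, sub_eq_add_neg,
    ← map_derivL_adW]
  ext x y
  simp [handleFun, derivR_hol_of_ne, derivL_hol_of_ne]

theorem handleMom_conj_B (i : Fin g) (a : Fin d) :
    ConjAt (h.biderivation.der (handleMom b f J i a)) (adMat b R a) (adW b f (hol (B i))) := by
  rw [ConjAt, map_adW b f (h.handleMom_fn i a), ← neg_sub, ← map_derivR_adW, sub_eq_add_neg,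
    ← map_derivL_adW]
  ext x y
  simp [handleFun, derivR_hol_of_ne, derivL_hol_of_ne]

theorem localGen_A_conj_A (i : Fin g) (a : Fin d) :
    ConjAt (h.biderivation.der (localGen b f J (A i) a)) (adMat b R a) (adW b f (hol (A i))) := by
  rw [ConjAt, map_adW b f (h.localGen_fn (A i) a), ← neg_sub, ← map_derivR_adW, sub_eq_add_neg,
    ← map_derivL_adW]
  ext x y
  simp [localFun, decGenFun, derivR_hol_of_ne, derivL_hol_of_ne]
  ring

theorem localGen_B_conj_B (i : Fin g) (a : Fin d) :
    ConjAt (h.biderivation.der (localGen b f J (B i) a)) (adMat b R a) (adW b f (hol (B i))) := by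
  rw [ConjAt, map_adW b f (h.localGen_fn (B i) a), ← neg_sub, ← map_derivR_adW, sub_eq_add_neg,
    ← map_derivL_adW]
  ext x y
  simp [localFun, decGenFun, derivL_hol_of_ne]
  ring

theorem localGen_B_map_A (i : Fin g) (a : Fin d) :
    (adW b f (hol (A i))).map (h.biderivation.der (localGen b f J (B i) a))
      = adW b f (hol (A i)) * adMat b R a := by
  rw [map_adW b f (h.localGen_fn (B i) a), ← neg_neg (_ * _), ← map_derivL_adW]
  ext x y
  simp [localFun, decGenFun, derivR_hol_of_ne, derivL_hol_of_ne]

theorem localGen_A_map_B (i : Fin g) (a : Fin d) :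
    (adW b f (hol (B i))).map (h.biderivation.der (localGen b f J (A i) a))
      = adW b f (hol (B i)) * adMat b R a - adMat b R a * adW b f (hol (B i))
        - adW b f (hol (B i)) * (adW b f (hol (A i))⁻¹ * adMat b R a * adW b f (hol (A i))) := by
  -- The factors Ad*(u_B) introduced by `sum_adMat` for the word u_B⁻¹ u_A cancel on the right. The
  -- local generator at A_i thus differs from conjugation of u_B by this single term.
  have e : adW b f (hol (B i)) * (adW b f (hol (A i))⁻¹ * adMat b R a * adW b f (hol (A i)))
      = ∑ c, adW b f ((hol (B i))⁻¹ * hol (A i)) a c • (adMat b R c * adW b f (hol (B i))) := by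
    simp only [← Matrix.smul_mul, ← Finset.sum_mul]
    rw [sum_adMat, mul_inv_rev, inv_inv, adW_mul, adW_mul]
    simp only [Matrix.mul_assoc, adW_inv_mul, Matrix.mul_one]
  rw [map_adW b f (h.localGen_fn (A i) a), e, ← neg_neg (adW b f (hol (B i)) * _), ← map_derivL_adW]
  simp only [← map_derivR_adW]
  ext x y
  simp [localFun, decGenFun, derivR_hol_of_ne, derivL_hol_of_ne, Matrix.sum_apply, adW]
  ring

end IsDecoupled

end HandleBlocks

/-! ### Brackets within a block and between different blocks. -/

section BlockBrackets

variable {E G : Type*} [NormedAddCommGroup E] [NormedSpace ℝ E] [FiniteDimensional ℝ E]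
  [TopologicalSpace G] [ChartedSpace E G] [Group G] [LieGroup 𝓘(ℝ, E) ∞ G]
  {d n g : ℕ} {b : Module.Basis (Fin d) ℝ (LieAlg E G)}
  {R : Type*} [CommRing R] [Algebra ℝ R]

/-- Differentiate Q P = 1 and multiply by Q on the right. -/
theorem map_inv_of_conj {δ : Derivation ℝ R R} {P Q S : Matrix (Fin d) (Fin d) R}
    (hPQ : P * Q = 1) (hQP : Q * P = 1) (h : P.map δ = S) : Q.map δ = -(Q * S * Q) := by
  have h1 : (Q * P).map δ = 0 := by rw [hQP, map_der_one]
  rw [map_der_mul, h] at h1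
  have h2 := congrArg (· * Q) h1
  simp only [add_mul, Matrix.mul_assoc, hPQ, Matrix.mul_one, Matrix.zero_mul] at h2
  rw [eq_neg_of_add_eq_zero_left h2, Matrix.mul_assoc]

theorem IsSkewBiderivation.der_add {br : R → R → R} (h : IsSkewBiderivation br) (φ ψ : R) :
    h.der (φ + ψ) = h.der φ + h.der ψ := by
  ext χ
  exact h.add_left φ ψ χ

theorem IsSkewBiderivation.der_sub {br : R → R → R} (h : IsSkewBiderivation br) (φ ψ : R) :
    h.der (φ - ψ) = h.der φ - h.der ψ := by
  ext χ
  exact h.sub_left φ ψ χ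

theorem CovAt.sub_der {δ δ' : Derivation ℝ R R} {N N' : Matrix (Fin d) (Fin d) R}
    {v : Fin d → R} (h : CovAt δ N v) (h' : CovAt δ' N' v) : CovAt (δ - δ') (N - N') v := by
  have e : ⇑(δ - δ') ∘ v = δ ∘ v - δ' ∘ v := rfl
  rw [CovAt, e, h, h', Matrix.sub_mulVec]
  abel

namespace IsDecoupled

variable {br : R → R → R} {J : Loop n g → Fin d → R} {f : Fun E G n g →ₐ[ℝ] R}
  (h : IsDecoupled b br J f)
include h

theorem freeGen_cov (X : Loop n g) (a : Fin d) :
    CovAt (h.biderivation.der (freeGen J X a)) (adMat b R a) (freeGen J X) := by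
  ext y
  rw [Pi.neg_apply, adMat_mulVec]
  exact h.freeGen_self X a y

theorem freeGen_kills {X Y : Loop n g} (hXY : X ≠ Y) (a : Fin d) :
    CovAt (h.biderivation.der (freeGen J X a)) 0 (freeGen J Y) :=
  covAt_zero_iff.2 fun y => h.freeGen_of_ne hXY a y

theorem freeGen_A_map_A_inv (i : Fin g) (a : Fin d) :
    (adW b f (hol (A i))⁻¹).map (h.biderivation.der (freeGen J (A i) a))
      = adW b f (hol (A i))⁻¹ * adMat b R a := by
  rw [map_inv_of_conj (adW_mul_inv b f _) (adW_inv_mul b f _) (h.freeGen_A_map_A i a)]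
  simp only [Matrix.mul_neg, Matrix.neg_mul, neg_neg, Matrix.mul_assoc, adW_mul_inv, Matrix.mul_one]

theorem freeGen_A_map_B_inv (i : Fin g) (a : Fin d) :
    (adW b f (hol (B i))⁻¹).map (h.biderivation.der (freeGen J (A i) a))
      = adW b f (hol (A i))⁻¹ * adMat b R a * adW b f (hol (A i)) * adW b f (hol (B i))⁻¹ := by
  rw [map_inv_of_conj (adW_mul_inv b f _) (adW_inv_mul b f _) (h.freeGen_A_map_B i a)]
  simp only [Matrix.mul_neg, Matrix.neg_mul, neg_neg]
  rw [← Matrix.mul_assoc (adW b f (hol (B i))⁻¹), adW_inv_mul, Matrix.one_mul]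

theorem freeGen_B_map_A_inv (i : Fin g) (a : Fin d) :
    (adW b f (hol (A i))⁻¹).map (h.biderivation.der (freeGen J (B i) a)) = 0 := by
  rw [map_inv_of_conj (adW_mul_inv b f _) (adW_inv_mul b f _) (h.freeGen_B_map_A i a)]
  simp

theorem freeGen_B_map_B_inv (i : Fin g) (a : Fin d) :
    (adW b f (hol (B i))⁻¹).map (h.biderivation.der (freeGen J (B i) a))
      = adW b f (hol (B i))⁻¹ * adMat b R a := by
  rw [map_inv_of_conj (adW_mul_inv b f _) (adW_inv_mul b f _) (h.freeGen_B_map_B i a)]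
  simp only [Matrix.mul_neg, Matrix.neg_mul, neg_neg, Matrix.mul_assoc, adW_mul_inv, Matrix.mul_one]

/-- `Ad*(u_A⁻¹) (j^A - j^B)` Poisson-commutes with the diagonal generators. -/
theorem inv_mulVec_kills (i : Fin g) (X : Loop n g) (hX : X = A i ∨ X = B i) (a : Fin d) :
    CovAt (h.biderivation.der ((adW b f (hol (A i))⁻¹).mulVec (freeGen J (A i)) a)) 0 (freeGen J X) := by
  refine covAt_zero_iff.2 fun y => ?_
  rw [IsSkewBiderivation.der_apply, h.biderivation.skew, neg_eq_zero]
  have e := congrFun (der_comp_mulVec (h.biderivation.der (freeGen J X y))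
    (adW b f (hol (A i))⁻¹) (freeGen J (A i))) a
  refine e.trans ?_
  -- Bracketing with j^A - j^B, the derivative of Ad*(u_A⁻¹) cancels the coadjoint action on j^A -
  -- j^B; bracketing with j^B, both factors are fixed.
  rcases hX with rfl | rfl
  · rw [h.freeGen_A_map_A_inv, h.freeGen_cov, Matrix.mulVec_neg, Matrix.mulVec_mulVec, add_neg_cancel]
    rfl
  · rw [h.freeGen_B_map_A_inv, h.freeGen_kills (by simp)]
    simp

/-- `Ad*(u_B⁻¹ u_A) j^B` Poisson-commutes with the diagonal generators. -/
theorem comm_mulVec_kills (i : Fin g) (X : Loop n g) (hX : X = A i ∨ X = B i) (a : Fin d) :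
    CovAt (h.biderivation.der ((adW b f ((hol (B i))⁻¹ * hol (A i))).mulVec (J (B i)) a)) 0
      (freeGen J X) := by
  refine covAt_zero_iff.2 fun y => ?_
  rw [IsSkewBiderivation.der_apply, h.biderivation.skew, neg_eq_zero]
  have e := congrFun (der_comp_mulVec (h.biderivation.der (freeGen J X y))
    (adW b f ((hol (B i))⁻¹ * hol (A i))) (freeGen J (B i))) a
  refine e.trans ?_
  rw [adW_mul, map_der_mul]
  -- For j^A - j^B the variations of Ad*(u_A) and Ad*(u_B⁻¹) cancel; for j^B that of Ad*(u_B⁻¹)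
  -- cancels the coadjoint action on j^B.
  rcases hX with rfl | rfl
  · rw [h.freeGen_A_map_A, h.freeGen_A_map_B_inv, h.freeGen_kills (by simp)]
    simp only [← Matrix.mul_assoc, adW_mul_inv, Matrix.one_mul]
    simp
  · rw [h.freeGen_B_map_A, h.freeGen_B_map_B_inv, h.freeGen_cov, Matrix.mulVec_neg,
      Matrix.mulVec_mulVec, Matrix.zero_mul, zero_add, Matrix.mul_assoc, add_neg_cancel]
    rfl

theorem der_localGen_A (i : Fin g) (a : Fin d) :
    h.biderivation.der (localGen b f J (A i) a) = h.biderivation.der (freeGen J (A i) a)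
      + h.biderivation.der (freeGen J (B i) a)
      - h.biderivation.der ((adW b f (hol (A i))⁻¹).mulVec (freeGen J (A i)) a) := by
  have e : localGen b f J (A i) a = freeGen J (A i) a + freeGen J (B i) a
      - (adW b f (hol (A i))⁻¹).mulVec (freeGen J (A i)) a := by
    simp [localGen, freeGen]
  rw [e, IsSkewBiderivation.der_sub, IsSkewBiderivation.der_add]

/-- Of the three pieces in `der_localGen_A`, the first acts on j^A - j^B only, the second on j^B
only, and the third on neither, so both momenta transform together. -/
theorem localGen_A_cov (i : Fin g) (X : Loop n g) (hX : X = A i ∨ X = B i) (a : Fin d) :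
    CovAt (h.biderivation.der (localGen b f J (A i) a)) (adMat b R a) (freeGen J X) := by
  rw [h.der_localGen_A]
  have h3 := h.inv_mulVec_kills i X hX a
  rcases hX with rfl | rfl
  · simpa using ((h.freeGen_cov _ a).add_der (h.freeGen_kills (Y := A i) (by simp) a)).sub_der h3
  · simpa using ((h.freeGen_kills (X := A i) (Y := B i) (by simp) a).add_der
      (h.freeGen_cov (B i) a)).sub_der h3

theorem der_localGen_B (i : Fin g) (a : Fin d) :
    h.biderivation.der (localGen b f J (B i) a) = h.biderivation.der (freeGen J (B i) a)
      - h.biderivation.der ((adW b f (hol (A i))⁻¹).mulVec (freeGen J (A i)) a) := by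
  rw [← IsSkewBiderivation.der_sub]
  rfl

theorem localGen_B_cov (i : Fin g) (a : Fin d) :
    CovAt (h.biderivation.der (localGen b f J (B i) a)) (adMat b R a) (freeGen J (B i)) := by
  rw [h.der_localGen_B]
  simpa using (h.freeGen_cov (B i) a).sub_der (h.inv_mulVec_kills i (B i) (Or.inr rfl) a)

theorem localGen_B_kills (i : Fin g) (a : Fin d) :
    CovAt (h.biderivation.der (localGen b f J (B i) a)) 0 (freeGen J (A i)) := by
  rw [h.der_localGen_B]
  simpa using (h.freeGen_kills (X := B i) (Y := A i) (by simp) a).sub_der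
    (h.inv_mulVec_kills i (A i) (Or.inl rfl) a)

theorem handleMom_cov (i : Fin g) (X : Loop n g) (hX : X = A i ∨ X = B i) (a : Fin d) :
    CovAt (h.biderivation.der (handleMom b f J i a)) (adMat b R a) (freeGen J X) := by
  have e : handleMom b f J i a = localGen b f J (A i) a
      - (adW b f ((hol (B i))⁻¹ * hol (A i))).mulVec (J (B i)) a := congrFun (handleMom_eq b f J i) a
  rw [e, IsSkewBiderivation.der_sub]
  simpa using (h.localGen_A_cov i X hX a).sub_der (h.comm_mulVec_kills i X hX a)

end IsDecoupled

/-- The handles and punctures. -/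
abbrev Block (n g : ℕ) := Fin n ⊕ Fin g

/-- The puncture or handle of a loop. -/
def blockOf : Loop n g → Block n g
  | Sum.inl i => Sum.inl i
  | Sum.inr (Sum.inl i) => Sum.inr i
  | Sum.inr (Sum.inr i) => Sum.inr i

/-- The position of a puncture or handle in the order of the loops. -/
def blockLevel : Block n g → ℕ
  | Sum.inl i => i
  | Sum.inr i => n + i

theorem blockLevel_blockOf (X : Loop n g) : blockLevel (blockOf X) = level X := by
  rcases X with i | i | i <;> rfl

variable (b)

/-- The total momentum of a puncture or handle. -/
def blockMom (f : Fun E G n g →ₐ[ℝ] R) (J : Loop n g → Fin d → R) : Block n g → Fin d → R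
  | Sum.inl i => J (M i)
  | Sum.inr i => handleMom b f J i

/-- The algebra of the functions on one puncture or handle. -/
def blockAlg (f : Fun E G n g →ₐ[ℝ] R) (J : Loop n g → Fin d → R) (p : Block n g) :
    Subalgebra ℝ R :=
  Algebra.adjoin ℝ {r | ∃ X, blockOf X = p ∧ ((∃ x, r = freeGen J X x) ∨
    ∃ x y, r = f (adFun b (hol X) x y) ∨ r = f (adFun b (hol X)⁻¹ x y))}

/-- The derivation `δ` transforms the generators of one puncture or handle by `-N`. -/
def ActsOn (f : Fun E G n g →ₐ[ℝ] R) (J : Loop n g → Fin d → R) (δ : Derivation ℝ R R)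
    (N : Matrix (Fin d) (Fin d) R) (p : Block n g) : Prop :=
  ∀ X, blockOf X = p → CovAt δ N (freeGen J X) ∧ ConjAt δ N (adW b f (hol X))

variable {b} {f : Fun E G n g →ₐ[ℝ] R} {J : Loop n g → Fin d → R}

section BlockAlg

variable {p : Block n g}

theorem freeGen_mem_blockAlg (X : Loop n g) (x : Fin d) :
    freeGen J X x ∈ blockAlg b f J (blockOf X) :=
  Algebra.subset_adjoin ⟨X, rfl, Or.inl ⟨x, rfl⟩⟩

theorem adW_hol_mem_blockAlg (X : Loop n g) (x y : Fin d) :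
    adW b f (hol X) x y ∈ blockAlg b f J (blockOf X) :=
  Algebra.subset_adjoin ⟨X, rfl, Or.inr ⟨x, y, Or.inl rfl⟩⟩

theorem adW_hol_inv_mem_blockAlg (X : Loop n g) (x y : Fin d) :
    adW b f (hol X)⁻¹ x y ∈ blockAlg b f J (blockOf X) :=
  Algebra.subset_adjoin ⟨X, rfl, Or.inr ⟨x, y, Or.inr rfl⟩⟩

theorem mulVec_mem {S : Subalgebra ℝ R} {P : Matrix (Fin d) (Fin d) R} {v : Fin d → R}
    (hP : ∀ x y, P x y ∈ S) (hv : ∀ x, v x ∈ S) (x : Fin d) : P.mulVec v x ∈ S := by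
  rw [Matrix.mulVec_eq_sum, Finset.sum_apply]
  exact S.sum_mem fun y _ => S.mul_mem (hP x y) (hv y)

theorem localGen_mem_blockAlg (X : Loop n g) (x : Fin d) :
    localGen b f J X x ∈ blockAlg b f J (blockOf X) := by
  have key : ∀ i : Fin g, (adW b f (hol (A i))⁻¹).mulVec (J (A i) - J (B i)) x
      ∈ blockAlg b f J (Sum.inr i) := fun i =>
    mulVec_mem (adW_hol_inv_mem_blockAlg (A i)) (freeGen_mem_blockAlg (A i)) x
  rcases X with i | i | i
  · exact freeGen_mem_blockAlg (M i) x
  · have e : localGen b f J (A i) x = freeGen J (A i) x + freeGen J (B i) x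
        - (adW b f (hol (A i))⁻¹).mulVec (freeGen J (A i)) x := by
      simp [localGen, freeGen]
    rw [e]
    exact Subalgebra.sub_mem _ (Subalgebra.add_mem _ (freeGen_mem_blockAlg (A i) x)
      (freeGen_mem_blockAlg (B i) x)) (key i)
  · exact Subalgebra.sub_mem _ (freeGen_mem_blockAlg (B i) x) (key i)

theorem blockMom_mem_blockAlg (p : Block n g) (x : Fin d) :
    blockMom b f J p x ∈ blockAlg b f J p := by
  rcases p with i | i
  · exact freeGen_mem_blockAlg (M i) x
  · change handleMom b f J i x ∈ _
    rw [handleMom_eq]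
    refine Subalgebra.sub_mem _ (localGen_mem_blockAlg (A i) x)
      (mulVec_mem (fun x y => ?_) (freeGen_mem_blockAlg (B i)) x)
    rw [adW_mul, Matrix.mul_apply]
    exact Subalgebra.sum_mem _ fun c _ => Subalgebra.mul_mem _ (adW_hol_mem_blockAlg (A i) x c)
      (adW_hol_inv_mem_blockAlg (B i) c y)

end BlockAlg

section ActsOn

variable {δ δ' : Derivation ℝ R R} {N N' : Matrix (Fin d) (Fin d) R} {p : Block n g}

theorem ActsOn.add (h : ActsOn b f J δ N p) (h' : ActsOn b f J δ' N' p) :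
    ActsOn b f J (δ + δ') (N + N') p := fun X hX =>
  ⟨(h X hX).1.add_der (h' X hX).1, (h X hX).2.add_der (h' X hX).2⟩

theorem ActsOn.zero : ActsOn b f J (0 : Derivation ℝ R R) 0 p := fun _ _ =>
  ⟨covAt_zero_iff.2 fun _ => rfl, conjAt_zero_iff.2 fun _ _ => rfl⟩

theorem ActsOn.sum {ι : Type*} (s : Finset ι) {δ : ι → Derivation ℝ R R}
    {N : ι → Matrix (Fin d) (Fin d) R} (h : ∀ i, ActsOn b f J (δ i) (N i) p) :
    ActsOn b f J (∑ i ∈ s, δ i) (∑ i ∈ s, N i) p := by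
  classical
  induction s using Finset.induction_on with
  | empty => exact ActsOn.zero
  | insert i s hi ih =>
    rw [Finset.sum_insert hi, Finset.sum_insert hi]
    exact (h i).add ih

theorem ActsOn.conj_inv {X : Loop n g} (h : ActsOn b f J δ N (blockOf X)) :
    ConjAt δ N (adW b f (hol X)⁻¹) :=
  (h X rfl).2.inv (adW_mul_inv b f _) (adW_inv_mul b f _)

/-- The local generator is built equivariantly from the data of its block, so covariance is
inherited. -/
theorem ActsOn.localGen {X : Loop n g} (h : ActsOn b f J δ N (blockOf X)) :
    CovAt δ N (localGen b f J X) := by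
  have key : ∀ i : Fin g, ActsOn b f J δ N (Sum.inr i) →
      CovAt δ N ((adW b f (hol (A i))⁻¹).mulVec (J (A i) - J (B i))) := fun i h =>
    (ActsOn.conj_inv (X := A i) h).mulVec (h (A i) rfl).1
  rcases X with i | i | i
  · exact (h (M i) rfl).1
  · have e : FlowerAlgebra.localGen b f J (A i) = freeGen J (A i) + freeGen J (B i)
        - (adW b f (hol (A i))⁻¹).mulVec (freeGen J (A i)) := by
      simp [FlowerAlgebra.localGen, freeGen]
    rw [e]
    exact ((h (A i) rfl).1.add (h (B i) rfl).1).sub (key i h)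
  · exact (h (B i) rfl).1.sub (key i h)

theorem ActsOn.blockMom (h : ActsOn b f J δ N p) : CovAt δ N (blockMom b f J p) := by
  rcases p with i | i
  · exact (h (M i) rfl).1
  · change CovAt δ N (handleMom b f J i)
    rw [handleMom_eq, adW_mul]
    exact (ActsOn.localGen (X := A i) h).sub
      (((h (A i) rfl).2.mul (ActsOn.conj_inv (X := B i) h)).mulVec (h (B i) rfl).1)

end ActsOn

namespace IsDecoupled

variable {br : R → R → R} (h : IsDecoupled b br J f)
include h

/-- This is where the total momentum earns its name: it acts on the momenta and holonomies of its
own block by one and the same matrix. -/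
theorem blockMom_actsOn (p : Block n g) (a : Fin d) :
    ActsOn b f J (h.biderivation.der (blockMom b f J p a)) (adMat b R a) p := by
  rintro (i | i | i) rfl
  · exact ⟨h.freeGen_cov (M i) a, h.puncture_conj i a⟩
  · exact ⟨h.handleMom_cov i (A i) (Or.inl rfl) a, h.handleMom_conj_A i a⟩
  · exact ⟨h.handleMom_cov i (B i) (Or.inr rfl) a, h.handleMom_conj_B i a⟩

theorem br_eq_zero_of_mem_blockAlg {t : R} {p : Block n g}
    (h1 : ∀ X x, blockOf X = p → br (freeGen J X x) t = 0)
    (h2 : ∀ X x y, blockOf X = p → br (f (adFun b (hol X) x y)) t = 0)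
    (h3 : ∀ X x y, blockOf X = p → br (f (adFun b (hol X)⁻¹ x y)) t = 0)
    {r : R} (hr : r ∈ blockAlg b f J p) : br r t = 0 := by
  induction hr using Algebra.adjoin_induction with
  | mem r hr =>
    obtain ⟨X, hX, ⟨x, rfl⟩ | ⟨x, y, rfl | rfl⟩⟩ := hr
    · exact h1 X x hX
    · exact h2 X x y hX
    · exact h3 X x y hX
  | algebraMap c =>
    rw [h.biderivation.skew, neg_eq_zero]
    exact (h.biderivation.der t).map_algebraMap c
  | add r s _ _ hr hs => rw [h.biderivation.add_left, hr, hs, add_zero]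
  | mul r s _ _ hr hs => rw [h.biderivation.leibniz_left, hr, hs, zero_mul, mul_zero, add_zero]

/-- Commutation of different blocks, checked on the generators of the block algebra and extended
because {·, t} is a derivation. -/
theorem actsOn_zero_of_mem_blockAlg {p q : Block n g} (hpq : p ≠ q) {r : R}
    (hr : r ∈ blockAlg b f J p) : ActsOn b f J (h.biderivation.der r) 0 q := by
  rintro Y rfl
  have hne : ∀ X, blockOf X = p → X ≠ Y := fun X hX e => hpq (by rw [← hX, e])
  have hAB : ∀ X, blockOf X = p → ∀ i, X = A i → Y ≠ B i := fun X hX i h1 h2 =>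
    hpq (by rw [← hX, h1, h2]; rfl)
  have hBA : ∀ X, blockOf X = p → ∀ i, Y = A i → X ≠ B i := fun X hX i h1 h2 =>
    hpq (by rw [← hX, h1, h2]; rfl)
  refine ⟨covAt_zero_iff.2 fun y => h.br_eq_zero_of_mem_blockAlg ?_ ?_ ?_ hr,
    conjAt_zero_iff.2 fun y z => h.br_eq_zero_of_mem_blockAlg ?_ ?_ ?_ hr⟩
  · exact fun X x hX => h.freeGen_of_ne (hne X hX) x y
  · intro X x z hX
    rw [h.biderivation.skew, h.freeGen_fn, freeFun_adFun_hol_of_ne b (hne X hX).symm (hBA X hX),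
      map_zero, neg_zero]
  · intro X x z hX
    rw [h.biderivation.skew, h.freeGen_fn, freeFun_adFun_hol_inv_of_ne b (hne X hX).symm (hBA X hX),
      map_zero, neg_zero]
  · intro X x hX
    refine (h.freeGen_fn X x _).trans ?_
    rw [freeFun_adFun_hol_of_ne b (hne X hX) (hAB X hX), map_zero]
  · exact fun X x w _ => h.fn_fn _ _
  · exact fun X x w _ => h.fn_fn _ _

end IsDecoupled

end BlockBrackets

/-! ### The flower relations inside a decoupled bracket. -/

section UnprimedBrackets

variable {E G : Type*} [NormedAddCommGroup E] [NormedSpace ℝ E] [FiniteDimensional ℝ E]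
  [TopologicalSpace G] [ChartedSpace E G] [Group G] [LieGroup 𝓘(ℝ, E) ∞ G]
  {d n g : ℕ} (b : Module.Basis (Fin d) ℝ (LieAlg E G))
  {R : Type*} [CommRing R] [Algebra ℝ R]

/-- The sum of the total momenta of the punctures and handles after level `m`. -/
def tailMom (f : Fun E G n g →ₐ[ℝ] R) (J : Loop n g → Fin d → R) (m : ℕ) : Fin d → R :=
  ∑ p : Block n g, if m < blockLevel p then blockMom b f J p else 0

/-- The images of the generators `J` under the inverse decoupling transformation. -/
def coupledGen (f : Fun E G n g →ₐ[ℝ] R) (J : Loop n g → Fin d → R) (X : Loop n g) : Fin d → R :=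
  localGen b f J X
    + (tailMom b f J (level X) - (adW b f (hol X)).mulVec (tailMom b f J (level X)))

open Classical in
/-- The brackets of the generators `J` of a coupled Poisson structure. -/
def coupledGenGen (f : Fun E G n g →ₐ[ℝ] R) (J : Loop n g → Fin d → R) (X Y : Loop n g)
    (x y : Fin d) : R :=
  if X = Y ∨ IsHandlePair X Y then -lieSum b x y (J Y)
  else if IsHandlePair Y X then -lieSum b x y (J X)
  else if level X < level Y then
    -(lieSum b x y (J Y) - ∑ c, adW b f (hol X) x c * lieSum b c y (J Y))
  else lieSum b y x (J X) - ∑ c, adW b f (hol Y) y c * lieSum b c x (J X)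

/-- The derivation of `C^∞(G^(n+2g))` given by the total momentum of a puncture or handle. -/
def blockFun (p : Block n g) (x : Fin d) : Fun E G n g →ₗ[ℝ] Fun E G n g :=
  match p with
  | Sum.inl i => decGenFun b (M i) x
  | Sum.inr i => handleFun b i x

theorem sum_blockFun (m : ℕ) (x : Fin d) (F : Fun E G n g) :
    ∑ p : Block n g, (if m < blockLevel p then blockFun b p x F else 0)
      = -∑ Y : Loop n g, (if m < level Y then derivR Y (b x) + derivL Y (b x) else 0) F := by
  rw [Fintype.sum_sum_type, Fintype.sum_sum_type, Fintype.sum_sum_type, ← Finset.sum_add_distrib,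
    neg_add, ← Finset.sum_neg_distrib, ← Finset.sum_neg_distrib]
  congr 1
  · refine Finset.sum_congr rfl fun i _ => ?_
    by_cases hm : m < blockLevel (Sum.inl i : Block n g)
    · rw [if_pos hm, if_pos (show m < level (M i : Loop n g) from hm)]
      rfl
    · rw [if_neg hm, if_neg (show ¬m < level (M i : Loop n g) from hm)]
      exact neg_zero.symm
  · refine Finset.sum_congr rfl fun i _ => ?_
    by_cases hm : m < blockLevel (Sum.inr i : Block n g)
    · rw [if_pos hm, if_pos (show m < level (A i : Loop n g) from hm),
        if_pos (show m < level (B i : Loop n g) from hm)]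
      simp only [blockFun, handleFun, LinearMap.add_apply, LinearMap.sub_apply, LinearMap.neg_apply]
      ring
    · rw [if_neg hm, if_neg (show ¬m < level (A i : Loop n g) from hm),
        if_neg (show ¬m < level (B i : Loop n g) from hm)]
      simp

/-- Since each total momentum generates minus the sum of left and right translations, the tail in
the flower relations is minus (1 - Ad*(u_X)) applied to the later momenta. -/
theorem tailDeriv_apply (X : Loop n g) (x : Fin d) (F : Fun E G n g) :
    tailDeriv b X x F
      = -((∑ p : Block n g, if level X < blockLevel p then blockFun b p x F else 0)
        - ∑ c, adFun b (hol X) x c *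
          ∑ p : Block n g, if level X < blockLevel p then blockFun b p c F else 0) := by
  simp only [sum_blockFun, tailDeriv, LinearMap.sum_apply, LinearMap.comp_apply,
    LinearMap.mulLeft_apply, sub_mul, ite_mul, one_mul, zero_mul, Finset.sum_sub_distrib,
    Finset.sum_ite_eq, Finset.mem_univ, if_true, mul_neg, Finset.sum_neg_distrib]
  ring

variable {b}

theorem ActsOn.tailMom {f : Fun E G n g →ₐ[ℝ] R} {J : Loop n g → Fin d → R} {δ : Derivation ℝ R R}
    {N : Matrix (Fin d) (Fin d) R} {m : ℕ}
    (h : ∀ p : Block n g, m < blockLevel p → ActsOn b f J δ N p) : CovAt δ N (tailMom b f J m) := by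
  refine CovAt.sum _ fun p _ => ?_
  split_ifs with hp
  · exact (h p hp).blockMom
  · exact CovAt.zero

/-- The coupled generator at X involves only blocks at or after X, so a derivation acting uniformly
on those acts on it covariantly. -/
theorem ActsOn.coupledGen {f : Fun E G n g →ₐ[ℝ] R} {J : Loop n g → Fin d → R}
    {δ : Derivation ℝ R R} {N : Matrix (Fin d) (Fin d) R} {X : Loop n g}
    (h : ∀ p : Block n g, level X ≤ blockLevel p → ActsOn b f J δ N p) :
    CovAt δ N (coupledGen b f J X) := by
  have hX := h (blockOf X) (blockLevel_blockOf X).ge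
  have hT : CovAt δ N (FlowerAlgebra.tailMom b f J (level X)) := ActsOn.tailMom fun p hp => h p hp.le
  exact hX.localGen.add (hT.sub ((hX X rfl).2.mulVec hT))

namespace IsDecoupled

variable {br : R → R → R} {J : Loop n g → Fin d → R} {f : Fun E G n g →ₐ[ℝ] R}
  (h : IsDecoupled b br J f)
include h

theorem blockMom_fn (p : Block n g) (x : Fin d) (F : Fun E G n g) :
    br (blockMom b f J p x) (f F) = f (blockFun b p x F) := by
  rcases p with i | i
  · exact h.gen_fn _ _ _
  · exact h.handleMom_fn i x F

theorem tailMom_fn (m : ℕ) (x : Fin d) (F : Fun E G n g) :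
    br (tailMom b f J m x) (f F)
      = f (∑ p : Block n g, if m < blockLevel p then blockFun b p x F else 0) := by
  rw [tailMom, Finset.sum_apply, h.biderivation.sum_left, map_sum]
  refine Finset.sum_congr rfl fun p _ => ?_
  split_ifs
  · exact h.blockMom_fn p x F
  · rw [map_zero]
    exact h.biderivation.zero_left _

theorem coupledGen_fn (X : Loop n g) (x : Fin d) (F : Fun E G n g) :
    br (coupledGen b f J X x) (f F) = f (flowerGenFun b X x F) := by
  have h1 := h.br_mulVec_fn (v := tailMom b f J (level X))
    (D := fun c => ∑ p : Block n g, if level X < blockLevel p then blockFun b p c else 0)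
    (fun c F => by
      rw [h.tailMom_fn, LinearMap.sum_apply]
      congr 1
      refine Finset.sum_congr rfl fun p _ => ?_
      split_ifs <;> rfl) (hol X) x F
  change br (localGen b f J X x + (tailMom b f J (level X) x
    - (adW b f (hol X)).mulVec (tailMom b f J (level X)) x)) (f F) = _
  rw [h.biderivation.add_left, h.biderivation.sub_left, h.localGen_fn, h.tailMom_fn, h1, ← map_sub,
    ← map_add, flowerGenFun_eq, LinearMap.sub_apply, tailDeriv_apply, sub_neg_eq_add]
  have e : ∀ c, (∑ p : Block n g, if level X < blockLevel p then blockFun b p c else 0) F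
      = ∑ p : Block n g, if level X < blockLevel p then blockFun b p c F else 0 := by
    intro c
    rw [LinearMap.sum_apply]
    refine Finset.sum_congr rfl fun p _ => ?_
    split_ifs <;> rfl
  simp only [e]

theorem der_sum {ι : Type*} (s : Finset ι) (r : ι → R) :
    h.biderivation.der (∑ i ∈ s, r i) = ∑ i ∈ s, h.biderivation.der (r i) := by
  classical
  induction s using Finset.induction_on with
  | empty =>
    ext χ
    exact h.biderivation.zero_left χ
  | insert i s hi ih =>
    rw [Finset.sum_insert hi, Finset.sum_insert hi, IsSkewBiderivation.der_add, ih]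

/-- In the sum over blocks only the momentum of q acts on q, and it is present exactly when q lies
beyond level m. -/
theorem tailMom_actsOn (m : ℕ) (a : Fin d) (q : Block n g) :
    ActsOn b f J (h.biderivation.der (tailMom b f J m a))
      (if m < blockLevel q then adMat b R a else 0) q := by
  rw [tailMom, Finset.sum_apply, h.der_sum]
  have e : (if m < blockLevel q then adMat b R a else 0)
      = ∑ p : Block n g, if p = q then (if m < blockLevel q then adMat b R a else 0) else 0 := by
    rw [Finset.sum_ite_eq' _ q, if_pos (Finset.mem_univ _)]
  rw [e]
  refine ActsOn.sum _ fun p => ?_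
  have hz : h.biderivation.der ((0 : Fin d → R) a) = 0 := by
    ext χ
    exact h.biderivation.zero_left χ
  by_cases hpq : p = q
  · subst hpq
    rw [if_pos rfl]
    split_ifs
    · exact h.blockMom_actsOn p a
    · rw [hz]
      exact ActsOn.zero
  · rw [if_neg hpq]
    split_ifs
    · exact h.actsOn_zero_of_mem_blockAlg hpq (blockMom_mem_blockAlg p a)
    · rw [hz]
      exact ActsOn.zero

theorem tailMom_actsOn_of_lt {m : ℕ} (a : Fin d) {q : Block n g} (hq : m < blockLevel q) :
    ActsOn b f J (h.biderivation.der (tailMom b f J m a)) (adMat b R a) q := by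
  simpa [hq] using h.tailMom_actsOn m a q

theorem tailMom_actsOn_of_le {m : ℕ} (a : Fin d) {q : Block n g} (hq : blockLevel q ≤ m) :
    ActsOn b f J (h.biderivation.der (tailMom b f J m a)) 0 q := by
  simpa [not_lt.2 hq] using h.tailMom_actsOn m a q

/-- Everything in the block of X commutes with the generator at Y, while the tail of X contains
every block entering it. Only the tail acts, weighted by 1 - Ad*(u_X). -/
theorem coupledGen_of_lt {X Y : Loop n g} (hXY : level X < level Y) (x y : Fin d) :
    br (coupledGen b f J X x) (coupledGen b f J Y y)
      = -(lieSum b x y (coupledGen b f J Y)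
        - ∑ c, adW b f (hol X) x c * lieSum b c y (coupledGen b f J Y)) := by
  have hz : ∀ r ∈ blockAlg b f J (blockOf X), br r (coupledGen b f J Y y) = 0 := fun r hr =>
    covAt_zero_iff.1 (ActsOn.coupledGen fun p hp => h.actsOn_zero_of_mem_blockAlg (fun e => by
      rw [← e, blockLevel_blockOf] at hp
      omega) hr) y
  have hT : ∀ c, br (tailMom b f J (level X) c) (coupledGen b f J Y y)
      = -lieSum b c y (coupledGen b f J Y) := fun c => by
    rw [← adMat_mulVec]
    exact congrFun (ActsOn.coupledGen fun p hp => h.tailMom_actsOn_of_lt c (by omega) :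
      CovAt _ _ (coupledGen b f J Y)) y
  change br (localGen b f J X x + (tailMom b f J (level X) x
    - ∑ c, adW b f (hol X) x c * tailMom b f J (level X) c)) _ = _
  rw [h.biderivation.add_left, h.biderivation.sub_left, hz _ (localGen_mem_blockAlg X x), hT,
    h.biderivation.sum_left]
  have e : ∀ c, br (adW b f (hol X) x c * tailMom b f J (level X) c) (coupledGen b f J Y y)
      = -(adW b f (hol X) x c * lieSum b c y (coupledGen b f J Y)) := fun c => by
    rw [h.biderivation.leibniz_left, hz _ (adW_hol_mem_blockAlg X x c), hT]
    ring
  simp only [e, Finset.sum_neg_distrib]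
  ring

/-- The bracket of the images of two generators on the same puncture or handle. -/
theorem coupledGen_of_blockOf_eq {X Y : Loop n g} (hXY : blockOf X = blockOf Y) (a y : Fin d)
    (hloc : CovAt (h.biderivation.der (localGen b f J X a)) (adMat b R a) (localGen b f J Y))
    {S : Matrix (Fin d) (Fin d) R}
    (hS : ∀ e c, br (localGen b f J Y e) (adW b f (hol X) a c) = S e c)
    (hkey : S - (adW b f (hol Y)).map (h.biderivation.der (localGen b f J X a))
        - (1 - adW b f (hol Y)) * (adMat b R a - ∑ c, adW b f (hol X) a c • adMat b R c)
      = -(adMat b R a * (1 - adW b f (hol Y)))) :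
    br (coupledGen b f J X a) (coupledGen b f J Y y) = -lieSum b a y (coupledGen b f J Y) := by
  have hlev : level Y = level X := by rw [← blockLevel_blockOf, ← hXY, blockLevel_blockOf]
  set T := tailMom b f J (level X) with hT
  have hX : coupledGen b f J X a = localGen b f J X a + (T a - ∑ c, adW b f (hol X) a c * T c) := rfl
  have hY : coupledGen b f J Y = localGen b f J Y + (1 - adW b f (hol Y)).mulVec T := by
    rw [coupledGen, hlev, Matrix.sub_mulVec, Matrix.one_mulVec]
  have hne : ∀ p : Block n g, level X < blockLevel p → blockOf X ≠ p := fun p hp e => by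
    rw [← e, blockLevel_blockOf] at hp
    omega
  have hkT : ∀ r ∈ blockAlg b f J (blockOf X), ∀ e, br r (T e) = 0 := fun r hr =>
    covAt_zero_iff.1 (ActsOn.tailMom fun p hp => h.actsOn_zero_of_mem_blockAlg (hne p hp) hr)
  have hTT : ∀ c e, br (T c) (T e) = -((adMat b R c).mulVec T) e := fun c e =>
    congrFun (ActsOn.tailMom fun p hp => h.tailMom_actsOn_of_lt c hp : CovAt _ _ T) e
  have hTY : ∀ c, ActsOn b f J (h.biderivation.der (T c)) 0 (blockOf Y) := fun c =>
    h.tailMom_actsOn_of_le c (by rw [blockLevel_blockOf, hlev])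
  have hTl : ∀ c e, br (T c) (localGen b f J Y e) = 0 := fun c =>
    covAt_zero_iff.1 (hTY c).localGen
  have hTP : ∀ c e k, br (T c) (adW b f (hol Y) e k) = 0 := fun c =>
    conjAt_zero_iff.1 ((hTY c) Y rfl).2
  -- On the local part at Y the tail itself is inert, but Ad*(u_X) in front of it is not; the matrix
  -- S records that contribution.
  have h1 : h.biderivation.der (coupledGen b f J X a) ∘ localGen b f J Y
      = -(adMat b R a).mulVec (localGen b f J Y)
        + S.mulVec T := by
    ext e
    have hl := congrFun hloc e
    rw [Function.comp_apply, IsSkewBiderivation.der_apply] at hl ⊢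
    rw [hX, h.biderivation.add_left, h.biderivation.sub_left, hl, hTl, h.biderivation.sum_left,
      Pi.add_apply, zero_sub, ← Finset.sum_neg_distrib]
    congr 1
    refine Finset.sum_congr rfl fun c _ => ?_
    rw [h.biderivation.leibniz_left, hTl, h.biderivation.skew (adW b f (hol X) a c), hS]
    ring
  -- On the tail the roles are reversed: the block of X is inert and the tail acts on itself
  -- covariantly.
  have h2 : h.biderivation.der (coupledGen b f J X a) ∘ T
      = -(adMat b R a - ∑ c, adW b f (hol X) a c • adMat b R c).mulVec T := by
    ext e
    rw [Function.comp_apply, IsSkewBiderivation.der_apply, hX, h.biderivation.add_left,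
      h.biderivation.sub_left, hkT _ (localGen_mem_blockAlg X a), hTT, h.biderivation.sum_left,
      Matrix.sub_mulVec, Matrix.sum_mulVec, neg_sub, Pi.sub_apply, Finset.sum_apply, zero_add,
      sub_eq_add_neg, sub_eq_add_neg, add_comm, ← Finset.sum_neg_distrib]
    congr 1
    refine Finset.sum_congr rfl fun c _ => ?_
    rw [h.biderivation.leibniz_left, hTT, hkT _ (adW_hol_mem_blockAlg X a c), Matrix.smul_mulVec,
      Pi.smul_apply, smul_eq_mul]
    ring
  have h3 : (1 - adW b f (hol Y)).map (h.biderivation.der (coupledGen b f J X a))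
      = -(adW b f (hol Y)).map (h.biderivation.der (localGen b f J X a)) := by
    rw [map_der_sub, map_der_one, zero_sub]
    congr 1
    ext e k
    rw [Matrix.map_apply, Matrix.map_apply, IsSkewBiderivation.der_apply,
      IsSkewBiderivation.der_apply, hX, h.biderivation.add_left, h.biderivation.sub_left, hTP,
      h.biderivation.sum_left, Finset.sum_eq_zero, sub_zero, add_zero]
    intro c _
    rw [h.biderivation.leibniz_left, hTP, adW, adW, Matrix.of_apply, Matrix.of_apply, h.fn_fn]
    ring
  -- The local terms already have the required form, so the claim is an equality of the coefficients
  -- of T, which is `hkey`.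
  have h4 : h.biderivation.der (coupledGen b f J X a) ∘ coupledGen b f J Y
      = -(adMat b R a).mulVec (coupledGen b f J Y) := by
    rw [hY, der_comp_add, der_comp_mulVec, h1, h2, h3, Matrix.mulVec_add, Matrix.mulVec_mulVec,
      Matrix.mulVec_neg, Matrix.mulVec_mulVec, add_assoc, neg_add,
      ← Matrix.neg_mulVec (v := T) (A := adMat b R a * _), ← hkey]
    simp only [Matrix.sub_mulVec, Matrix.neg_mulVec]
    abel
  rw [← adMat_mulVec]
  exact congrFun h4 y

/-- The choice of S is the commutator of Ad*(u_X) with ad, reindexed by skewness so that the varying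
generator labels the rows. -/
theorem coupledGen_self {X : Loop n g} (a y : Fin d)
    (hloc : CovAt (h.biderivation.der (localGen b f J X a)) (adMat b R a) (localGen b f J X))
    (hconj : ∀ e, ConjAt (h.biderivation.der (localGen b f J X e)) (adMat b R e) (adW b f (hol X))) :
    br (coupledGen b f J X a) (coupledGen b f J X y) = -lieSum b a y (coupledGen b f J X) := by
  refine h.coupledGen_of_blockOf_eq rfl a y hloc
    (S := adMat b R a * adW b f (hol X) - ∑ c, adW b f (hol X) a c • adMat b R c)
    (fun e c => ?_) ?_
  · have h1 := congrFun (congrFun (hconj e) a) c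
    refine h1.trans ?_
    rw [Matrix.sub_apply, mul_adMat_apply, adMat_mul_apply, Matrix.sub_apply]
    ring
  · have e2 := adW_mul_sum_adMat b f (hol X) a
    rw [hconj a, sub_mul, mul_sub, mul_sub, e2]
    noncomm_ring

theorem localGen_A_cov_localGen_A (i : Fin g) (a : Fin d) :
    CovAt (h.biderivation.der (localGen b f J (A i) a)) (adMat b R a) (localGen b f J (A i)) := by
  have e : localGen b f J (A i) = freeGen J (A i) + freeGen J (B i)
      - (adW b f (hol (A i))⁻¹).mulVec (freeGen J (A i)) := by
    simp [localGen, freeGen]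
  nth_rw 2 [e]
  exact ((h.localGen_A_cov i (A i) (Or.inl rfl) a).add (h.localGen_A_cov i (B i) (Or.inr rfl) a)).sub
    (((h.localGen_A_conj_A i a).inv (adW_mul_inv b f _) (adW_inv_mul b f _)).mulVec
      (h.localGen_A_cov i (A i) (Or.inl rfl) a))

theorem localGen_A_cov_localGen_B (i : Fin g) (a : Fin d) :
    CovAt (h.biderivation.der (localGen b f J (A i) a)) (adMat b R a) (localGen b f J (B i)) :=
  (h.localGen_A_cov i (B i) (Or.inr rfl) a).sub
    (((h.localGen_A_conj_A i a).inv (adW_mul_inv b f _) (adW_inv_mul b f _)).mulVec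
      (h.localGen_A_cov i (A i) (Or.inl rfl) a))

/-- The local generator at B_i fixes j^A - j^B but multiplies Ad*(u_A) by ad on the right. Hence
Ad*(u_A⁻¹) picks up -ad on the left, which is exactly covariance of the product. -/
theorem localGen_B_cov_localGen_B (i : Fin g) (a : Fin d) :
    CovAt (h.biderivation.der (localGen b f J (B i) a)) (adMat b R a) (localGen b f J (B i)) := by
  refine (h.localGen_B_cov i a).sub ?_
  rw [CovAt, der_comp_mulVec, map_inv_of_conj (adW_mul_inv b f _) (adW_inv_mul b f _)
    (h.localGen_B_map_A i a), ← Matrix.mul_assoc (adW b f (hol (A i))⁻¹), adW_inv_mul, Matrix.one_mul]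
  have e := h.localGen_B_kills i a
  rw [CovAt, Matrix.zero_mulVec, neg_zero] at e
  change _ + (adW b f (hol (A i))⁻¹).mulVec (_ ∘ freeGen J (A i)) = _
  rw [e, Matrix.mulVec_zero, add_zero, Matrix.neg_mulVec, Matrix.mulVec_mulVec]

theorem coupledGen_A_B (i : Fin g) (a y : Fin d) :
    br (coupledGen b f J (A i) a) (coupledGen b f J (B i) y)
      = -lieSum b a y (coupledGen b f J (B i)) := by
  refine h.coupledGen_of_blockOf_eq (X := A i) (Y := B i) rfl a y (h.localGen_A_cov_localGen_B i a)
    (S := -∑ c, adW b f (hol (A i)) a c • adMat b R c) (fun e c => ?_) ?_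
  · refine (congrFun (congrFun (h.localGen_B_map_A i e) a) c).trans ?_
    rw [mul_adMat_apply, Matrix.neg_apply]
  · rw [h.localGen_A_map_B, ← sum_adMat]
    noncomm_ring

theorem coupledGen_gen_self (X : Loop n g) (a y : Fin d) :
    br (coupledGen b f J X a) (coupledGen b f J X y) = -lieSum b a y (coupledGen b f J X) := by
  rcases X with i | i | i
  · exact h.coupledGen_self a y (h.freeGen_cov (M i) a) (h.puncture_conj i)
  · exact h.coupledGen_self a y (h.localGen_A_cov_localGen_A i a) (h.localGen_A_conj_A i)
  · exact h.coupledGen_self a y (h.localGen_B_cov_localGen_B i a) (h.localGen_B_conj_B i)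

/-- The brackets of the images of the generators under the inverse decoupling transformation. -/
theorem coupledGen_gen (X Y : Loop n g) (x y : Fin d) :
    br (coupledGen b f J X x) (coupledGen b f J Y y)
      = coupledGenGen b f (coupledGen b f J) X Y x y := by
  unfold coupledGenGen
  by_cases h0 : X = Y
  · subst h0
    rw [if_pos (Or.inl rfl)]
    exact h.coupledGen_gen_self X x y
  by_cases h1 : IsHandlePair X Y
  · rw [if_pos (Or.inr h1)]
    obtain ⟨i, rfl, rfl⟩ := h1
    exact h.coupledGen_A_B i x y
  rw [if_neg (by tauto)]
  by_cases h2 : IsHandlePair Y X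
  · rw [if_pos h2]
    obtain ⟨i, rfl, rfl⟩ := h2
    rw [h.biderivation.skew, h.coupledGen_A_B, lieSum_skew b x y]
  rw [if_neg h2]
  by_cases h3 : level X < level Y
  · rw [if_pos h3]
    exact h.coupledGen_of_lt h3 x y
  · rw [if_neg h3, h.biderivation.skew, h.coupledGen_of_lt (level_lt_of_unordered h0 h1 h2 h3),
      neg_neg]

end IsDecoupled

end UnprimedBrackets

/-! ### Sums over tails and ordered index lists. -/

section FiniteSums

theorem sum_ite_le_succ {V : Type*} [AddCommGroup V] {m : ℕ} (v : Fin m → V) (i : Fin m) :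
    (∑ k : Fin m, if (i : ℕ) ≤ k then v k else 0)
      = v i + ∑ k : Fin m, if (i : ℕ) + 1 ≤ k then v k else 0 := by
  have e : v i = ∑ k : Fin m, if k = i then v k else 0 := by simp
  rw [e]
  rw [← Finset.sum_add_distrib]
  refine Finset.sum_congr rfl fun k _ => ?_
  by_cases h : k = i
  · subst h
    simp
  · have h' : (k : ℕ) ≠ i := fun e => h (Fin.ext e)
    by_cases h1 : (i : ℕ) ≤ k
    · rw [if_pos h1, if_neg h, if_pos (by omega), zero_add]
    · rw [if_neg h1, if_neg h, if_neg (by omega), zero_add]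

theorem sum_ite_le_sub {V : Type*} [AddCommGroup V] {m i : ℕ} (x : ℕ → V) (hi : i ≤ m) :
    (∑ k : Fin m, if i ≤ (k : ℕ) then x k - x (k + 1) else 0) = x i - x m := by
  rw [Fin.sum_univ_eq_sum_range fun k => if i ≤ k then x k - x (k + 1) else 0]
  induction m, hi using Nat.le_induction with
  | base =>
    rw [sub_self]
    exact Finset.sum_eq_zero fun k hk => if_neg (not_le.2 (Finset.mem_range.1 hk))
  | succ m hm ih =>
    rw [Finset.sum_range_succ, ih, if_pos hm]
    abel

/-- In an increasing list the least index satisfying p heads the filtered list. This makes it the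
rightmost factor of the descending product. -/
theorem filter_eq_cons {m : ℕ} {p : Fin m → Prop} [DecidablePred p] {i : Fin m} (hi : p i)
    (h : ∀ l, p l → i ≤ l) {L : List (Fin m)} (hL : L.Pairwise (· < ·)) (hiL : i ∈ L) :
    L.filter (fun k => decide (p k)) = i :: L.filter fun k => decide (p k ∧ i < k) := by
  induction L with
  | nil => simp at hiL
  | cons a L ih =>
    rw [List.pairwise_cons] at hL
    by_cases ha : a = i
    · subst ha
      rw [List.filter_cons_of_pos (by simpa using hi), List.filter_cons_of_neg (by simp)]
      congr 1
      refine List.filter_congr fun k hk => ?_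
      simp [hL.1 k hk]
    · have hi' : i ∈ L := by
        rcases List.mem_cons.1 hiL with h1 | h1
        · exact absurd h1.symm ha
        · exact h1
      have hpa : ¬p a := fun hp => absurd (h a hp) (not_le.2 (hL.1 i hi'))
      rw [List.filter_cons_of_neg (by simpa using hpa), List.filter_cons_of_neg (by simp [hpa])]
      exact ih hL.2 hi'

end FiniteSums

/-! ### The recursion satisfied by twisted tails. -/

section Telescoping

variable {E G : Type*} [NormedAddCommGroup E] [NormedSpace ℝ E] [FiniteDimensional ℝ E]
  [TopologicalSpace G] [ChartedSpace E G] [Group G] [LieGroup 𝓘(ℝ, E) ∞ G]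
  {d n g : ℕ} (b : Module.Basis (Fin d) ℝ (LieAlg E G))
  {R : Type*} [CommRing R] [Algebra ℝ R] (f : Fun E G n g →ₐ[ℝ] R)

theorem descProd_congr {m : ℕ} {p q : Fin m → Prop} [DecidablePred p] [DecidablePred q]
    (h : ∀ l, p l ↔ q l) (w : Fin m → Word E G n g) : descProd p w = descProd q w := by
  unfold descProd
  simp only [h]

theorem descProd_empty {m : ℕ} {p : Fin m → Prop} [DecidablePred p] (h : ∀ l, ¬p l)
    (w : Fin m → Word E G n g) : descProd p w = 1 := by
  simp [descProd, h]

theorem descProd_eq_mul {m : ℕ} {p : Fin m → Prop} [DecidablePred p] {i : Fin m} (hi : p i)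
    (h : ∀ l, p l → i ≤ l) (w : Fin m → Word E G n g) :
    descProd p w = descProd (fun l => p l ∧ i < l) w * w i := by
  unfold descProd
  rw [filter_eq_cons hi h (List.pairwise_lt_finRange m) (List.mem_finRange i)]
  simp

variable {m : ℕ} (w : Fin m → Word E G n g) (v : Fin m → Fin d → R)

/-- `∑_{k ≥ j} Ad*(w_{k-1} ⋯ w_j) v_k`. -/
def tailAct (j : ℕ) : Fin d → R :=
  ∑ k : Fin m, if j ≤ (k : ℕ) then
    (adW b f (descProd (fun l => j ≤ (l : ℕ) ∧ l < k) w)).mulVec (v k) else 0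

theorem tailAct_last : tailAct b f w v m = 0 :=
  Finset.sum_eq_zero fun k _ => if_neg (not_le.2 k.2)

/-- Each later term carries u_i as the rightmost factor of its word, and the order reversal in
`adW_mul` moves it to the far left, where it factors out. -/
theorem tailAct_succ (i : Fin m) :
    tailAct b f w v i = v i + (adW b f (w i)).mulVec (tailAct b f w v (i + 1)) := by
  have e : v i = ∑ k : Fin m, if k = i then v k else 0 := by simp
  rw [e, tailAct, tailAct, Matrix.mulVec_sum, ← Finset.sum_add_distrib]
  refine Finset.sum_congr rfl fun k _ => ?_
  by_cases h : k = i
  · subst h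
    rw [if_pos le_rfl, if_pos rfl, if_neg (by omega), Matrix.mulVec_zero, add_zero,
      descProd_empty (fun l hl => absurd hl.1 (not_le.2 hl.2)), adW_one, Matrix.one_mulVec]
  · have h' : (k : ℕ) ≠ i := fun e => h (Fin.ext e)
    by_cases h1 : (i : ℕ) ≤ k
    · have h2 : i < k := Fin.lt_def.2 (by omega)
      rw [if_pos h1, if_neg h, if_pos (by omega), zero_add, Matrix.mulVec_mulVec, ← adW_mul,
        descProd_eq_mul (i := i) ⟨le_rfl, h2⟩ (fun l hl => hl.1)]
      congr 3
      refine descProd_congr (fun l => ?_) w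
      rw [Fin.lt_def, Fin.lt_def]
      omega
    · rw [if_neg h1, if_neg h, if_neg (by omega), Matrix.mulVec_zero, zero_add]

theorem adW_descProd_succ (i : Fin m) :
    adW b f (descProd (fun l => (i : ℕ) ≤ (l : ℕ)) w)
      = adW b f (w i) * adW b f (descProd (fun l => (i : ℕ) + 1 ≤ (l : ℕ)) w) := by
  rw [← adW_mul, descProd_eq_mul (p := fun l : Fin m => (i : ℕ) ≤ (l : ℕ)) (i := i) le_rfl
    (fun l hl => hl)]
  congr 2
  refine descProd_congr (fun l => ?_) w
  rw [Fin.lt_def]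
  omega

theorem adW_descProd_last : adW b f (descProd (fun l => m ≤ (l : ℕ)) w) = 1 := by
  rw [descProd_empty (fun l => not_le.2 l.2), adW_one]

/-- A sequence with `x_i = v_i + Ad*(w_i) x_{i+1}` is determined by its last term. -/
theorem tailAct_add_eq (x : ℕ → Fin d → R)
    (hx : ∀ i : Fin m, x i = v i + (adW b f (w i)).mulVec (x (i + 1))) {j : ℕ} (hj : j ≤ m) :
    tailAct b f w v j + (adW b f (descProd (fun l => j ≤ (l : ℕ)) w)).mulVec (x m) = x j := by
  induction hj using Nat.decreasingInduction with
  | self => rw [tailAct_last, adW_descProd_last, Matrix.one_mulVec, zero_add]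
  | of_succ k hk ih =>
    have h1 := tailAct_succ b f w v ⟨k, hk⟩
    have h2 := adW_descProd_succ b f w ⟨k, hk⟩
    have h3 := hx ⟨k, hk⟩
    simp only at h1 h2 h3
    rw [h1, h2, h3, ← ih, Matrix.mulVec_add, Matrix.mulVec_mulVec, add_assoc]

end Telescoping

/-! ### The two generator transformations are mutually inverse. -/

section Inverse

variable {E G : Type*} [NormedAddCommGroup E] [NormedSpace ℝ E] [FiniteDimensional ℝ E]
  [TopologicalSpace G] [ChartedSpace E G] [Group G] [LieGroup 𝓘(ℝ, E) ∞ G]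
  {d n g : ℕ} (b : Module.Basis (Fin d) ℝ (LieAlg E G))
  {R : Type*} [CommRing R] [Algebra ℝ R] (f : Fun E G n g →ₐ[ℝ] R) (J : Loop n g → Fin d → R)

/-- The covector `j^{H_i}` built from generators `J`. -/
def handleGen (i : Fin g) : Fin d → R :=
  (J (A i) - (adW b f ((hol (A i))⁻¹ * (hol (B i))⁻¹ * hol (A i))).mulVec (J (A i)))
    + ((adW b f ((hol (A i))⁻¹ * (hol (B i))⁻¹ * hol (A i))).mulVec (J (B i))
      - (adW b f ((hol (B i))⁻¹ * hol (A i))).mulVec (J (B i)))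

/-- `∑_{k ≥ j} Ad*(u_{K_{k-1}} ⋯ u_{K_j}) j^{H_k}`. -/
def handleTail (j : ℕ) : Fin d → R := tailAct b f uK (handleGen b f J) j

/-- `∑_{k ≥ j} Ad*(u_{M_{k-1}} ⋯ u_{M_j}) j^{M_k}
  + ∑_k Ad*(u_{K_{k-1}} ⋯ u_{K_1} u_{M_n} ⋯ u_{M_j}) j^{H_k}`. -/
def punctureTail (j : ℕ) : Fin d → R :=
  tailAct b f (fun l : Fin n => hol (M l)) (fun k => J (M k)) j
    + (adW b f (descProd (fun l : Fin n => j ≤ (l : ℕ)) fun l => hol (M l))).mulVec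
        (handleTail b f J 0)

/-- The images of the generators `J` under the decoupling transformation. -/
def decoupledGen (X : Loop n g) : Fin d → R :=
  match X with
  | Sum.inl i => J (M i) - (punctureTail b f J (i + 1)
      - (adW b f (hol (M i))).mulVec (punctureTail b f J (i + 1)))
  | Sum.inr (Sum.inl i) => J (A i) + (adW b f (hol (A i))⁻¹).mulVec (J (A i) - J (B i))
      + ((adW b f (hol (A i))).mulVec (handleTail b f J (i + 1))
        - (adW b f (hol (B i) * (hol (A i))⁻¹)).mulVec (handleTail b f J (i + 1)))
  | Sum.inr (Sum.inr i) => J (B i) + (adW b f (hol (A i))⁻¹).mulVec (J (A i) - J (B i))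
      + ((adW b f (hol (B i))).mulVec (handleTail b f J (i + 1))
        - (adW b f (hol (B i) * (hol (A i))⁻¹)).mulVec (handleTail b f J (i + 1)))

/-- The sum of the total momenta of the handles `k ≥ j`. -/
def handleMomTail (j : ℕ) : Fin d → R := ∑ k : Fin g, if j ≤ (k : ℕ) then handleMom b f J k else 0

/-- The sum of the total momenta of the punctures `k ≥ j` and of all handles. -/
def punctureMomTail (j : ℕ) : Fin d → R :=
  (∑ k : Fin n, if j ≤ (k : ℕ) then J (M k) else 0) + handleMomTail b f J 0

theorem tailMom_handle (i : Fin g) : tailMom b f J (n + i) = handleMomTail b f J (i + 1) := by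
  unfold tailMom handleMomTail
  rw [Fintype.sum_sum_type, Finset.sum_eq_zero, zero_add]
  · refine Finset.sum_congr rfl fun k _ => if_congr ?_ rfl rfl
    change n + (i : ℕ) < n + k ↔ _
    omega
  · refine fun k _ => if_neg ?_
    change ¬n + (i : ℕ) < k
    omega

theorem tailMom_puncture (i : Fin n) : tailMom b f J i = punctureMomTail b f J (i + 1) := by
  unfold tailMom punctureMomTail handleMomTail
  rw [Fintype.sum_sum_type]
  congr 1
  refine Finset.sum_congr rfl fun k _ => if_congr ?_ rfl rfl
  change (i : ℕ) < n + k ↔ _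
  omega

theorem handleTail_succ (i : Fin g) : handleTail b f J i
    = handleGen b f J i + (adW b f (uK i)).mulVec (handleTail b f J (i + 1)) :=
  tailAct_succ b f uK _ i

theorem handleTail_last : handleTail b f J g = 0 := tailAct_last b f uK _

theorem punctureTail_last : punctureTail b f J n = handleTail b f J 0 := by
  rw [punctureTail, tailAct_last, adW_descProd_last, Matrix.one_mulVec, zero_add]

theorem punctureTail_succ (i : Fin n) : punctureTail b f J i
    = J (M i) + (adW b f (hol (M i))).mulVec (punctureTail b f J (i + 1)) := by
  rw [punctureTail, tailAct_succ, adW_descProd_succ, punctureTail, Matrix.mulVec_add,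
    Matrix.mulVec_mulVec, add_assoc]

theorem handleMomTail_last : handleMomTail b f J g = 0 :=
  Finset.sum_eq_zero fun k _ => if_neg (not_le.2 k.2)

theorem adW_uK (i : Fin g) : adW b f (uK i) = adW b f (hol (A i)) * adW b f (hol (B i))⁻¹
    * adW b f (hol (A i))⁻¹ * adW b f (hol (B i)) := by
  rw [uK, adW_mul, adW_mul, adW_mul]
  simp only [Matrix.mul_assoc]

theorem inv_mulVec_cancel (u : Word E G n g) (v : Fin d → R) :
    (adW b f u⁻¹).mulVec ((adW b f u).mulVec v) = v := by
  rw [Matrix.mulVec_mulVec, adW_inv_mul, Matrix.one_mulVec]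

/-- The words in j^H are arranged so that the tail contributions combine to 1 - Ad*(u_K). The sums
of total momenta then satisfy the recursion defining `handleTail`. -/
theorem handleGen_coupledGen (i : Fin g) : handleGen b f (coupledGen b f J) i
    = handleMom b f J i + handleMomTail b f J (i + 1)
      - (adW b f (uK i)).mulVec (handleMomTail b f J (i + 1)) := by
  have hA : coupledGen b f J (A i) = localGen b f J (A i) + (handleMomTail b f J (i + 1)
      - (adW b f (hol (A i))).mulVec (handleMomTail b f J (i + 1))) := by
    rw [coupledGen, level, tailMom_handle]
  have hB : coupledGen b f J (B i) = localGen b f J (B i) + (handleMomTail b f J (i + 1)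
      - (adW b f (hol (B i))).mulVec (handleMomTail b f J (i + 1))) := by
    rw [coupledGen, level, tailMom_handle]
  rw [handleGen, hA, hB, adW_uK]
  simp only [handleMom, localGen, adW_mul, ← Matrix.mulVec_mulVec, Matrix.mulVec_add,
    Matrix.mulVec_sub, inv_mulVec_cancel]
  abel

theorem handleTail_coupledGen {j : ℕ} (hj : j ≤ g) :
    handleTail b f (coupledGen b f J) j = handleMomTail b f J j := by
  have h := tailAct_add_eq b f uK (handleGen b f (coupledGen b f J)) (handleMomTail b f J)
    (fun i => by
      rw [handleGen_coupledGen, handleMomTail, sum_ite_le_succ, ← handleMomTail]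
      abel) hj
  rwa [handleMomTail_last, Matrix.mulVec_zero, add_zero] at h

theorem punctureTail_coupledGen {j : ℕ} (hj : j ≤ n) :
    punctureTail b f (coupledGen b f J) j = punctureMomTail b f J j := by
  have h := tailAct_add_eq b f (fun l : Fin n => hol (M l)) (fun k => coupledGen b f J (M k))
    -- For a puncture j_i + (1 - P) x_{i+1} + P x_{i+1} = j_i + x_{i+1}, so the sums of momenta
    -- solve the recursion, with the handle sum as terminal value.
    (punctureMomTail b f J) (fun i => by
      rw [coupledGen, level, tailMom_puncture, punctureMomTail, sum_ite_le_succ, localGen,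
        add_assoc (J (M i)), ← punctureMomTail]
      abel) hj
  rw [punctureTail, handleTail_coupledGen b f J (Nat.zero_le g), ← h]
  congr 2
  rw [punctureMomTail, Finset.sum_eq_zero fun k _ => if_neg (not_le.2 k.2), zero_add]

/-- The decoupling transformation is a left inverse on generators. -/
theorem decoupledGen_coupledGen : decoupledGen b f (coupledGen b f J) = J := by
  funext X
  rcases X with i | i | i
  · change coupledGen b f J (M i) - _ = _
    rw [punctureTail_coupledGen b f J i.2, coupledGen, level, tailMom_puncture, localGen]
    abel
  · change coupledGen b f J (A i) + (adW b f (hol (A i))⁻¹).mulVec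
      (coupledGen b f J (A i) - coupledGen b f J (B i)) + _ = _
    rw [handleTail_coupledGen b f J i.2, coupledGen, coupledGen, level, level, tailMom_handle]
    simp only [localGen, adW_mul, ← Matrix.mulVec_mulVec, Matrix.mulVec_add,
      Matrix.mulVec_sub, inv_mulVec_cancel]
    abel
  · change coupledGen b f J (B i) + (adW b f (hol (A i))⁻¹).mulVec
      (coupledGen b f J (A i) - coupledGen b f J (B i)) + _ = _
    rw [handleTail_coupledGen b f J i.2, coupledGen, coupledGen, level, level, tailMom_handle]
    simp only [localGen, adW_mul, ← Matrix.mulVec_mulVec, Matrix.mulVec_add,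
      Matrix.mulVec_sub, inv_mulVec_cancel]
    abel

/-- Expressed through the original generators, each total momentum is a difference of consecutive
twisted tails, so plain sums of momenta telescope back to those tails. -/
theorem handleMom_decoupledGen (i : Fin g) : handleMom b f (decoupledGen b f J) i
    = handleTail b f J i - handleTail b f J (i + 1) := by
  rw [handleTail_succ, adW_uK, handleMom]
  simp only [handleGen, decoupledGen, adW_mul, ← Matrix.mulVec_mulVec, Matrix.mulVec_add,
    Matrix.mulVec_sub, inv_mulVec_cancel]
  abel

theorem handleMomTail_decoupledGen {j : ℕ} (hj : j ≤ g) :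
    handleMomTail b f (decoupledGen b f J) j = handleTail b f J j := by
  unfold handleMomTail
  simp only [handleMom_decoupledGen]
  rw [sum_ite_le_sub _ hj, handleTail_last, sub_zero]

theorem punctureMomTail_decoupledGen {j : ℕ} (hj : j ≤ n) :
    punctureMomTail b f (decoupledGen b f J) j = punctureTail b f J j := by
  have e : ∀ k : Fin n, decoupledGen b f J (M k) = punctureTail b f J k - punctureTail b f J (k + 1) := by
    intro k
    rw [punctureTail_succ, decoupledGen]
    abel
  unfold punctureMomTail
  simp only [e]
  rw [sum_ite_le_sub _ hj, handleMomTail_decoupledGen b f J (Nat.zero_le g), punctureTail_last]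
  abel

/-- The decoupling transformation is a right inverse on generators. -/
theorem coupledGen_decoupledGen : coupledGen b f (decoupledGen b f J) = J := by
  funext X
  rcases X with i | i | i
  · rw [coupledGen, level, tailMom_puncture, punctureMomTail_decoupledGen b f J i.2]
    simp only [localGen, decoupledGen]
    abel
  · rw [coupledGen, level, tailMom_handle, handleMomTail_decoupledGen b f J i.2]
    simp only [localGen, decoupledGen, adW_mul, ← Matrix.mulVec_mulVec, Matrix.mulVec_add,
      Matrix.mulVec_sub, inv_mulVec_cancel]
    abel
  · rw [coupledGen, level, tailMom_handle, handleMomTail_decoupledGen b f J i.2]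
    simp only [localGen, decoupledGen, adW_mul, ← Matrix.mulVec_mulVec, Matrix.mulVec_add,
      Matrix.mulVec_sub, inv_mulVec_cancel]
    abel

end Inverse

/-! ### Compatibility of the constructions with algebra homomorphisms. -/

section Naturality

variable {E G : Type*} [NormedAddCommGroup E] [NormedSpace ℝ E] [FiniteDimensional ℝ E]
  [TopologicalSpace G] [ChartedSpace E G] [Group G] [LieGroup 𝓘(ℝ, E) ∞ G]
  {d n g : ℕ} (b : Module.Basis (Fin d) ℝ (LieAlg E G))
  {R S : Type*} [CommRing R] [Algebra ℝ R] [CommRing S] [Algebra ℝ S]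
  (φ : R →ₐ[ℝ] S) {f : Fun E G n g →ₐ[ℝ] R} {f' : Fun E G n g →ₐ[ℝ] S}
  (hf : ∀ F, φ (f F) = f' F) {J : Loop n g → Fin d → R} {J' : Loop n g → Fin d → S}
  (hJ : ∀ X, φ ∘ J X = J' X)
include hf

theorem comp_adW_mulVec (w : Word E G n g) {v : Fin d → R} {v' : Fin d → S} (hv : φ ∘ v = v') :
    φ ∘ (adW b f w).mulVec v = (adW b f' w).mulVec v' := by
  subst hv
  ext x
  simp [Matrix.mulVec, dotProduct, adW, hf]

omit hf in
theorem hom_comp_add (v w : Fin d → R) : φ ∘ (v + w) = φ ∘ v + φ ∘ w := by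
  ext x
  simp

omit hf in
theorem hom_comp_sub (v w : Fin d → R) : φ ∘ (v - w) = φ ∘ v - φ ∘ w := by
  ext x
  simp

omit hf in
theorem hom_comp_sum {ι : Type*} [Fintype ι] (p : ι → Prop) [DecidablePred p] (v : ι → Fin d → R)
    {v' : ι → Fin d → S} (hv : ∀ i, φ ∘ v i = v' i) :
    φ ∘ (∑ i, if p i then v i else 0) = ∑ i, if p i then v' i else 0 := by
  ext x
  simp only [Function.comp_apply, Finset.sum_apply, map_sum]
  refine Finset.sum_congr rfl fun i _ => ?_
  split_ifs
  · rw [← hv]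
    rfl
  · exact map_zero φ

omit hf in
theorem map_lieSum (x y : Fin d) {v : Fin d → R} {v' : Fin d → S} (hv : φ ∘ v = v') :
    φ (lieSum b x y v) = lieSum b x y v' := by
  subst hv
  simp [lieSum]

include hJ

theorem comp_localGen (X : Loop n g) : φ ∘ localGen b f J X = localGen b f' J' X := by
  rcases X with i | i | i
  · exact hJ _
  · simp only [localGen, hom_comp_sub, hJ,
      comp_adW_mulVec b φ hf _ (hom_comp_sub φ (J (A i)) (J (B i)))]
  · simp only [localGen, hom_comp_sub, hJ,
      comp_adW_mulVec b φ hf _ (hom_comp_sub φ (J (A i)) (J (B i)))]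

theorem comp_blockMom (p : Block n g) : φ ∘ blockMom b f J p = blockMom b f' J' p := by
  rcases p with i | i
  · exact hJ _
  · change φ ∘ handleMom b f J i = handleMom b f' J' i
    rw [handleMom_eq, handleMom_eq, hom_comp_sub, comp_localGen b φ hf hJ,
      comp_adW_mulVec b φ hf _ (hJ _)]

/-- A homomorphism fixing functions is moved past the whole construction, so applying K to the
inverse formulas amounts to substituting the transformed generators. -/
theorem comp_coupledGen (X : Loop n g) : φ ∘ coupledGen b f J X = coupledGen b f' J' X := by
  have hT : φ ∘ tailMom b f J (level X) = tailMom b f' J' (level X) :=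
    hom_comp_sum φ _ _ fun p => comp_blockMom b φ hf hJ p
  rw [coupledGen, coupledGen, hom_comp_add, hom_comp_sub, comp_localGen b φ hf hJ, hT,
    comp_adW_mulVec b φ hf _ hT]

theorem comp_tailAct {m : ℕ} (w : Fin m → Word E G n g) {v : Fin m → Fin d → R}
    {v' : Fin m → Fin d → S} (hv : ∀ k, φ ∘ v k = v' k) (j : ℕ) :
    φ ∘ tailAct b f w v j = tailAct b f' w v' j :=
  hom_comp_sum φ _ _ fun k => comp_adW_mulVec b φ hf _ (hv k)

theorem comp_handleGen (i : Fin g) : φ ∘ handleGen b f J i = handleGen b f' J' i := by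
  simp only [handleGen, hom_comp_add, hom_comp_sub, hJ, comp_adW_mulVec b φ hf _ (hJ _)]

theorem comp_handleTail (j : ℕ) : φ ∘ handleTail b f J j = handleTail b f' J' j :=
  comp_tailAct b φ hf hJ _ (comp_handleGen b φ hf hJ) j

theorem comp_punctureTail (j : ℕ) : φ ∘ punctureTail b f J j = punctureTail b f' J' j := by
  rw [punctureTail, punctureTail, hom_comp_add, comp_tailAct b φ hf hJ _ (fun k => hJ (M k)) j,
    comp_adW_mulVec b φ hf _ (comp_handleTail b φ hf hJ 0)]

theorem comp_decoupledGen (X : Loop n g) : φ ∘ decoupledGen b f J X = decoupledGen b f' J' X := by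
  rcases X with i | i | i
  · simp only [decoupledGen, hom_comp_sub, hJ, comp_punctureTail b φ hf hJ,
      comp_adW_mulVec b φ hf _ (comp_punctureTail b φ hf hJ _)]
  · simp only [decoupledGen, hom_comp_sub, hom_comp_add, hJ,
      comp_adW_mulVec b φ hf _ (comp_handleTail b φ hf hJ _),
      comp_adW_mulVec b φ hf _ (hom_comp_sub φ (J (A i)) (J (B i)))]
  · simp only [decoupledGen, hom_comp_sub, hom_comp_add, hJ,
      comp_adW_mulVec b φ hf _ (comp_handleTail b φ hf hJ _),
      comp_adW_mulVec b φ hf _ (hom_comp_sub φ (J (A i)) (J (B i)))]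

theorem map_coupledGenGen (X Y : Loop n g) (x y : Fin d) :
    φ (coupledGenGen b f J X Y x y) = coupledGenGen b f' J' X Y x y := by
  have hs : ∀ (X Y : Loop n g) (x y : Fin d), φ (∑ c, adW b f (hol X) x c * lieSum b c y (J Y))
      = ∑ c, adW b f' (hol X) x c * lieSum b c y (J' Y) := by
    intro X Y x y
    rw [map_sum]
    refine Finset.sum_congr rfl fun c _ => ?_
    rw [map_mul, map_lieSum b φ _ _ (hJ Y)]
    exact congrArg (· * _) (hf _)
  unfold coupledGenGen
  split_ifs
  · rw [map_neg, map_lieSum b φ _ _ (hJ Y)]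
  · rw [map_neg, map_lieSum b φ _ _ (hJ X)]
  · rw [map_neg, map_sub, hs, map_lieSum b φ _ _ (hJ Y)]
  · rw [map_sub, hs, map_lieSum b φ _ _ (hJ X)]

theorem map_decGenGen (X Y : Loop n g) (x y : Fin d) :
    φ (decGenGen b J X Y x y) = decGenGen b J' X Y x y := by
  unfold decGenGen
  split_ifs
  · rw [map_neg, map_lieSum b φ _ _ (hJ Y)]
  · rw [map_neg, map_lieSum b φ _ _ (hJ X)]
  · exact map_zero φ

end Naturality

/-! ### The flower algebra and the transformation K. -/

section Instantiation

variable {E G : Type*} [NormedAddCommGroup E] [NormedSpace ℝ E] [FiniteDimensional ℝ E]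
  [TopologicalSpace G] [ChartedSpace E G] [Group G] [LieGroup 𝓘(ℝ, E) ∞ G]
  {d n g : ℕ} (b : Module.Basis (Fin d) ℝ (LieAlg E G))

theorem sum_structConst_smul_mul {R : Type*} [CommRing R] [Algebra ℝ R] (f : Fun E G n g →ₐ[ℝ] R)
    (v : Fin d → R) (P : Fin d → Fun E G n g) (x y : Fin d) :
    ∑ z, ∑ w, structConst b w y z • (v z * f ((if x = w then 1 else 0) - P w))
      = lieSum b x y v - ∑ c, f (P c) * lieSum b c y v := by
  rw [Finset.sum_comm]
  have e : ∀ w, ∑ z, structConst b w y z • (v z * f ((if x = w then 1 else 0) - P w))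
      = (if x = w then lieSum b w y v else 0) - f (P w) * lieSum b w y v := by
    intro w
    have : (if x = w then lieSum b w y v else 0) - f (P w) * lieSum b w y v
        = f ((if x = w then 1 else 0) - P w) * lieSum b w y v := by
      rw [map_sub, sub_mul]
      split_ifs <;> simp
    rw [this, lieSum, Finset.mul_sum]
    refine Finset.sum_congr rfl fun z _ => ?_
    rw [mul_smul_comm, mul_comm]
  simp only [e, Finset.sum_sub_distrib, Finset.sum_ite_eq, Finset.mem_univ, if_true]

theorem flowerGenGenAux_of_lt {X Y : Loop n g} (h : level X < level Y) (x y : Fin d) :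
    flowerGenGenAux b X Y x y = -(lieSum b x y (gen b Y)
      - ∑ c, adW b fnHom (hol X) x c * lieSum b c y (gen b Y)) := by
  unfold flowerGenGenAux
  rw [if_pos h]
  exact congrArg Neg.neg (sum_structConst_smul_mul b fnHom (gen b Y) (adFun b (hol X) x) x y)

theorem flowerGenGenAux_of_not_lt {X Y : Loop n g} (h : ¬level X < level Y) (x y : Fin d) :
    flowerGenGenAux b X Y x y = -lieSum b x y (gen b Y) := by
  unfold flowerGenGenAux
  rw [if_neg h]
  rfl

theorem flowerGenGen_eq (X Y : Loop n g) (x y : Fin d) :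
    flowerGenGen b X Y x y = coupledGenGen b fnHom (gen b) X Y x y := by
  unfold flowerGenGen coupledGenGen
  by_cases h0 : X = Y
  · subst h0
    rw [if_pos (Or.inl rfl), if_pos (Or.inl rfl)]
    exact flowerGenGenAux_of_not_lt b (lt_irrefl _) x y
  by_cases h1 : IsHandlePair X Y
  · rw [if_pos (Or.inr (Or.inl h1)), if_pos (Or.inr h1)]
    exact flowerGenGenAux_of_not_lt b (by rw [h1.level_eq]; exact lt_irrefl _) x y
  by_cases h3 : level X < level Y
  · have h2 : ¬IsHandlePair Y X := fun h => by
      have := h.level_eq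
      omega
    rw [if_pos (Or.inr (Or.inr h3)), if_neg (by tauto), if_neg h2, if_pos h3]
    exact flowerGenGenAux_of_lt b h3 x y
  rw [if_neg (by tauto), if_neg (c := X = Y ∨ IsHandlePair X Y) (by tauto)]
  by_cases h2 : IsHandlePair Y X
  · rw [if_pos h2, lieSum_skew b x y]
    exact congrArg Neg.neg (flowerGenGenAux_of_not_lt b (by rw [h2.level_eq]; exact lt_irrefl _) y x)
  · rw [if_neg h2, if_neg h3, ← neg_neg (lieSum b y x (gen b X) - _)]
    exact congrArg Neg.neg (flowerGenGenAux_of_lt b (level_lt_of_unordered h0 h1 h2 h3) y x)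

/-- The bracket of the flower algebra with the brackets of the transformed generators. -/
def decBracket : Flower E G n g → Flower E G n g → Flower E G n g :=
  biderivation b (decGenGen b (gen b)) (decGenFun b)

theorem isDecoupled_decBracket : IsDecoupled b (decBracket b) (gen b) (fnHom (E := E) (G := G) (n := n) (g := g)) where
  biderivation := isSkewBiderivation_biderivation b (decGenGen_skew b (gen b)) (isLeibniz_decGenFun b)
  gen_gen := biderivation_gen_gen b (isLeibniz_decGenFun b)
  gen_fn := biderivation_gen_fn b
  fn_fn := biderivation_fn_fn b

theorem isPoissonBracket_decBracket : IsPoissonBracket (decBracket (n := n) (g := g) b) :=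
  (isDecoupled_decBracket b).isPoissonBracket fun _ hgen hfn hadd hmul =>
    flower_induction b hgen hfn hadd hmul

theorem substHom_fn (v : Loop n g → Fin d → Flower E G n g) (F : Fun E G n g) :
    substHom b v (fn F) = fn F := by
  simp [substHom, fn]

theorem substHom_gen (v : Loop n g → Fin d → Flower E G n g) (X : Loop n g) (x : Fin d) :
    substHom b v (gen b X x) = v X x := by
  simp only [substHom, gen, Algebra.TensorProduct.lift_tmul, SymmetricAlgebra.lift_ι_apply,
    Module.Basis.constr_basis, map_one, mul_one]

theorem act_eq (w : Word E G n g) (v : Fin d → Flower E G n g) :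
    act b w v = (adW b fnHom w).mulVec v := rfl

theorem handleGen_gen (i : Fin g) : genH b i = handleGen b fnHom (gen (n := n) b) i := rfl

theorem handleTail_gen (i : Fin g) : tailH b i = handleTail b fnHom (gen (n := n) b) (i + 1) := by
  unfold tailH handleTail tailAct
  refine Finset.sum_congr rfl fun k _ => ?_
  have hiff : i < k ↔ (i : ℕ) + 1 ≤ k := by rw [Fin.lt_def]; omega
  by_cases h : i < k
  · rw [if_pos h, if_pos (hiff.1 h), act_eq, handleGen_gen]
    rfl
  · rw [if_neg h, if_neg fun h' => h (hiff.2 h')]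

theorem punctureTail_gen (i : Fin n) : tailM b i = punctureTail b fnHom (gen (g := g) b) (i + 1) := by
  unfold tailM punctureTail
  congr 1
  unfold handleTail tailAct
  rw [Matrix.mulVec_sum]
  refine Finset.sum_congr rfl fun k _ => ?_
  rw [if_pos (Nat.zero_le _), act_eq, adW_mul, Matrix.mulVec_mulVec, handleGen_gen]
  congr 3
  exact descProd_congr (fun l => by simp) _

theorem primed_eq : primed (n := n) (g := g) b = decoupledGen b fnHom (gen b) := by
  funext X
  rcases X with i | i | i
  · simp only [primed, decoupledGen, punctureTail_gen, act_eq]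
  · simp only [primed, decoupledGen, handleTail_gen, act_eq]
  · simp only [primed, decoupledGen, handleTail_gen, act_eq]

theorem invTailH_eq (i : Fin g) : invTailH b i = tailMom b fnHom (gen (n := n) b) (level (A i : Loop n g)) := by
  rw [level, tailMom_handle]
  unfold invTailH handleMomTail
  refine Finset.sum_congr rfl fun k _ => if_congr ?_ rfl rfl
  rw [Fin.lt_def]
  omega

theorem invTailM_eq (i : Fin n) : invTailM b i = tailMom b fnHom (gen (g := g) b) (level (M i : Loop n g)) := by
  rw [level, tailMom_puncture]
  unfold invTailM punctureMomTail handleMomTail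
  congr 1

theorem unprimed_eq : unprimed (n := n) (g := g) b = coupledGen b fnHom (gen b) := by
  funext X
  rcases X with i | i | i
  · simp only [unprimed, coupledGen, invTailM_eq, act_eq, localGen]
  · simp only [unprimed, coupledGen, invTailH_eq, act_eq, localGen]
  · simp only [unprimed, coupledGen, invTailH_eq, act_eq, localGen]
    rfl

theorem decoupling_gen (X : Loop n g) (x : Fin d) : decoupling b (gen b X x) = primed b X x :=
  substHom_gen b _ X x

theorem decoupling_fn (F : Fun E G n g) : decoupling b (fn F) = fn F := substHom_fn b _ F

theorem decouplingInv_gen (X : Loop n g) (x : Fin d) : decouplingInv b (gen b X x) = unprimed b X x :=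
  substHom_gen b _ X x

theorem decouplingInv_fn (F : Fun E G n g) : decouplingInv b (fn F) = fn F := substHom_fn b _ F

/-- By naturality this is the decoupling formula evaluated on the coupled generators, which returns
the original ones. -/
theorem decouplingInv_primed (X : Loop n g) (x : Fin d) :
    decouplingInv b (primed b X x) = gen b X x := by
  have h := comp_decoupledGen b (decouplingInv (n := n) (g := g) b)
    (f := fnHom) (f' := fnHom) (decouplingInv_fn b)
    (J := gen b) (J' := coupledGen b fnHom (gen b))
    (fun X => by
      rw [← unprimed_eq]
      exact funext fun x => decouplingInv_gen b X x) X
  rw [decoupledGen_coupledGen, ← primed_eq] at h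
  exact congrFun h x

theorem decoupling_unprimed (X : Loop n g) (x : Fin d) :
    decoupling b (unprimed b X x) = gen b X x := by
  have h := comp_coupledGen b (decoupling (n := n) (g := g) b)
    (f := fnHom) (f' := fnHom) (decoupling_fn b)
    (J := gen b) (J' := decoupledGen b fnHom (gen b))
    (fun X => by
      rw [← primed_eq]
      exact funext fun x => decoupling_gen b X x) X
  rw [coupledGen_decoupledGen, ← unprimed_eq] at h
  exact congrFun h x

theorem leftInverse_decouplingInv :
    Function.LeftInverse (decouplingInv (n := n) (g := g) b) (decoupling b) := by
  intro φ
  refine flower_induction b (p := fun φ => decouplingInv b (decoupling b φ) = φ) ?_ ?_ ?_ ?_ φ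
  · intro X x
    rw [decoupling_gen, decouplingInv_primed]
  · intro F
    rw [decoupling_fn, decouplingInv_fn]
  · intro φ ψ h h'
    rw [map_add, map_add, h, h']
  · intro φ ψ h h'
    rw [map_mul, map_mul, h, h']

theorem rightInverse_decouplingInv :
    Function.RightInverse (decouplingInv (n := n) (g := g) b) (decoupling b) := by
  intro φ
  refine flower_induction b (p := fun φ => decoupling b (decouplingInv b φ) = φ) ?_ ?_ ?_ ?_ φ
  · intro X x
    rw [decouplingInv_gen, decoupling_unprimed]
  · intro F
    rw [decouplingInv_fn, decoupling_fn]
  · intro φ ψ h h'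
    rw [map_add, map_add, h, h']
  · intro φ ψ h h'
    rw [map_mul, map_mul, h, h']

/-- The left side is given by the flower relations written in the coupled generators; by naturality
the homomorphism turns the original relations into the same expression. -/
theorem decBracket_unprimed (X Y : Loop n g) (x y : Fin d) :
    decBracket b (unprimed b X x) (unprimed b Y y) = decouplingInv b (flowerGenGen b X Y x y) := by
  have h := map_coupledGenGen b (decouplingInv (n := n) (g := g) b)
    (f := fnHom) (f' := fnHom) (decouplingInv_fn b)
    (J := gen b) (J' := coupledGen b fnHom (gen b))
    (fun X => by
      rw [← unprimed_eq]
      exact funext fun x => decouplingInv_gen b X x) X Y x y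
  rw [flowerGenGen_eq, unprimed_eq]
  exact ((isDecoupled_decBracket b).coupledGen_gen X Y x y).trans h.symm

/-- The inverse decoupling transformation intertwines the bracket of the flower algebra with the
decoupled bracket. -/
theorem decBracket_decouplingInv (φ ψ : Flower E G n g) :
    decBracket b (decouplingInv b φ) (decouplingInv b ψ) = decouplingInv b (flowerBracket b φ ψ) := by
  have hgf : ∀ (X : Loop n g) (x : Fin d) (F : Fun E G n g),
      decBracket b (unprimed b X x) (fn F) = decouplingInv b (fn (flowerGenFun b X x F)) := by
    intro X x F
    rw [decouplingInv_fn, unprimed_eq]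
    exact (isDecoupled_decBracket b).coupledGen_fn X x F
  refine (isSkewBiderivation_flowerBracket b).map_bracket (isDecoupled_decBracket b).biderivation
    (decouplingInv b) (S := {r | (∃ X x, r = gen b X x) ∨ ∃ F, r = fn F}) ?_ ?_ φ ψ
  · intro p hS hadd hmul
    exact flower_induction b (fun X x => hS _ (Or.inl ⟨X, x, rfl⟩)) (fun F => hS _ (Or.inr ⟨F, rfl⟩))
      hadd hmul
  · rintro _ (⟨X, x, rfl⟩ | ⟨F, rfl⟩) _ (⟨Y, y, rfl⟩ | ⟨F', rfl⟩)
    · have h2 : flowerBracket b (gen b X x) (gen b Y y) = flowerGenGen b X Y x y :=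
        biderivation_gen_gen b (isLeibniz_flowerGenFun b) X Y x y
      rw [decouplingInv_gen, decouplingInv_gen, h2, decBracket_unprimed]
    · have h2 : flowerBracket b (gen b X x) (fn F') = fn (flowerGenFun b X x F') :=
        biderivation_gen_fn b X x F'
      rw [decouplingInv_gen, decouplingInv_fn, h2, hgf]
    · have h2 : flowerBracket b (gen b Y y) (fn F) = fn (flowerGenFun b Y y F) :=
        biderivation_gen_fn b Y y F
      rw [decouplingInv_gen, decouplingInv_fn, (isDecoupled_decBracket b).biderivation.skew,
        (isSkewBiderivation_flowerBracket b).skew, h2, hgf, map_neg]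
    · have h2 : flowerBracket b (fn F) (fn F') = 0 := biderivation_fn_fn b F F'
      rw [decouplingInv_fn, decouplingInv_fn, h2, map_zero]
      exact (isDecoupled_decBracket b).fn_fn F F'

theorem isPoissonBracket_flowerBracket : IsPoissonBracket (flowerBracket (n := n) (g := g) b) :=
  -- Being one-sided invertible makes `decouplingInv` injective, so Jacobi can be tested after
  -- applying it.
  (isPoissonBracket_decBracket b).of_injective (isSkewBiderivation_flowerBracket b)
    (decouplingInv b) (rightInverse_decouplingInv b).injective (decBracket_decouplingInv b)

theorem flowerBracket_decoupling (φ ψ : Flower E G n g) :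
    flowerBracket b (decoupling b φ) (decoupling b ψ) = decoupling b (decBracket b φ ψ) := by
  rw [← rightInverse_decouplingInv b (flowerBracket b _ _), ← decBracket_decouplingInv,
    leftInverse_decouplingInv, leftInverse_decouplingInv]

theorem flowerBracket_primed (X Y : Loop n g) (x y : Fin d) :
    flowerBracket b (primed b X x) (primed b Y y) = decGenGen b (primed b) X Y x y := by
  rw [← decoupling_gen, ← decoupling_gen, flowerBracket_decoupling]
  refine (congrArg (decoupling b) ((isDecoupled_decBracket b).gen_gen X Y x y)).trans ?_
  exact map_decGenGen b (decoupling b) (f := fnHom) (f' := fnHom) (decoupling_fn b)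
    (fun X => funext fun x => decoupling_gen b X x) X Y x y

theorem flowerBracket_primed_fn (X : Loop n g) (x : Fin d) (F : Fun E G n g) :
    flowerBracket b (primed b X x) (fn F) = fn (decGenFun b X x F) := by
  rw [← decoupling_gen, ← decoupling_fn b F, flowerBracket_decoupling]
  exact (congrArg (decoupling b) ((isDecoupled_decBracket b).gen_fn X x F)).trans (decoupling_fn b _)

end Instantiation

/-! ### The brackets of H* and D_+(H) from the values of invariant fields. -/

section Frames

variable {E G : Type*} [NormedAddCommGroup E] [NormedSpace ℝ E] [FiniteDimensional ℝ E]
  [TopologicalSpace G] [ChartedSpace E G] [Group G] [LieGroup 𝓘(ℝ, E) ∞ G]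
  {d n g : ℕ} (b : Module.Basis (Fin d) ℝ (LieAlg E G))
  {R : Type*} [CommRing R] [Algebra ℝ R]

/-- The bracket `δ ∧ ε` of two linear maps. -/
def wedgeBr (δ ε : R →ₗ[ℝ] R) (φ ψ : R) : R := δ φ * ε ψ - ε φ * δ ψ

/-- Derivations of an algebra corresponding to the invariant vector fields on `H^(n+2g)`. -/
structure VectorFields (n g d : ℕ) (R : Type*) [CommRing R] [Algebra ℝ R] where
  pr : Loop n g → Fin d → R →ₗ[ℝ] R
  pl : Loop n g → Fin d → R →ₗ[ℝ] R
  jr : Loop n g → Fin d → R →ₗ[ℝ] R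
  jl : Loop n g → Fin d → R →ₗ[ℝ] R

namespace VectorFields

variable (V : VectorFields n g d R)

/-- The bracket of `H*` on the factor `X`. -/
def dualBr (X : Loop n g) (φ ψ : R) : R :=
  ∑ x, ((1 / 2 : ℝ) • (wedgeBr (V.pl X x) (V.jl X x) φ ψ + wedgeBr (V.pr X x) (V.jr X x) φ ψ)
    + wedgeBr (V.pr X x) (V.jl X x) φ ψ)

/-- The bracket of `D_+(H)` on the factors `X`, `Y`. -/
def heisBr (X Y : Loop n g) (φ ψ : R) : R :=
  ∑ x, ((1 / 2 : ℝ) • (wedgeBr (V.pr X x) (V.jr X x) φ ψ + wedgeBr (V.pl X x) (V.jl X x) φ ψ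
      + wedgeBr (V.pr Y x) (V.jr Y x) φ ψ + wedgeBr (V.pl Y x) (V.jl Y x) φ ψ)
    + wedgeBr (V.pr X x) (V.jr Y x) φ ψ + wedgeBr (V.pl X x) (V.jl Y x) φ ψ)

/-- The bracket on one puncture or handle. -/
def blockBr : Block n g → R → R → R
  | Sum.inl i => V.dualBr (M i)
  | Sum.inr i => V.heisBr (A i) (B i)

/-- The direct sum of the brackets on the punctures and handles. -/
def sumBr (φ ψ : R) : R := ∑ p, V.blockBr p φ ψ

/-- The values of the vector fields on generators `J` and functions. -/
structure IsFrame (J : Loop n g → Fin d → R) (f : Fun E G n g →ₐ[ℝ] R) : Prop where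
  pr_leibniz : ∀ X x, IsLeibniz (V.pr X x)
  pl_leibniz : ∀ X x, IsLeibniz (V.pl X x)
  jr_leibniz : ∀ X x, IsLeibniz (V.jr X x)
  jl_leibniz : ∀ X x, IsLeibniz (V.jl X x)
  pr_gen : ∀ X Y x y, V.pr X x (J Y y) = if X = Y then (if x = y then -1 else 0) else 0
  pl_gen : ∀ X Y x y, V.pl X x (J Y y) = if X = Y then f (adFun b (hol X) y x) else 0
  jr_gen : ∀ X Y x y, V.jr X x (J Y y) = if X = Y then lieSum b x y (J X) else 0
  jl_gen : ∀ X Y x y, V.jl X x (J Y y) = 0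
  pr_fn : ∀ X x F, V.pr X x (f F) = 0
  pl_fn : ∀ X x F, V.pl X x (f F) = 0
  jr_fn : ∀ X x F, V.jr X x (f F) = f (derivR X (b x) F)
  jl_fn : ∀ X x F, V.jl X x (f F) = f (derivL X (b x) F)

namespace IsFrame

variable {b} {V} {J : Loop n g → Fin d → R} {f : Fun E G n g →ₐ[ℝ] R} (h : V.IsFrame b J f)
include h

theorem sum_wedge_pr_jr_fn (X Y : Loop n g) (y : Fin d) (F : Fun E G n g) :
    ∑ x, wedgeBr (V.pr X x) (V.jr Y x) (J X y) (f F) = -f (derivR Y (b y) F) := by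
  simp [wedgeBr, h.pr_gen, h.pr_fn, h.jr_fn]

theorem sum_wedge_pr_jl_fn (X Y : Loop n g) (y : Fin d) (F : Fun E G n g) :
    ∑ x, wedgeBr (V.pr X x) (V.jl Y x) (J X y) (f F) = -f (derivL Y (b y) F) := by
  simp [wedgeBr, h.pr_gen, h.pr_fn, h.jl_fn]

theorem sum_wedge_pl_jl_fn (X Y : Loop n g) (y : Fin d) (F : Fun E G n g) :
    ∑ x, wedgeBr (V.pl X x) (V.jl Y x) (J X y) (f F)
      = f (∑ x, adFun b (hol X) y x * derivL Y (b x) F) := by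
  simp [wedgeBr, h.pl_gen, h.pl_fn, h.jl_fn]

/-- Ad*(u) L = -R on a single factor, so the left and right wedge terms agree here; this is why the
two halves add up to one full term. -/
theorem sum_wedge_pl_jl_fn_self (X : Loop n g) (y : Fin d) (F : Fun E G n g) :
    ∑ x, wedgeBr (V.pl X x) (V.jl X x) (J X y) (f F) = -f (derivR X (b y) F) := by
  rw [h.sum_wedge_pl_jl_fn, sum_adFun_derivL, inv_mul_cancel, map_neg]
  congr 2
  simp [adFun_one]

theorem wedge_fn_of_ne {X X' Y : Loop n g} (hX : X ≠ Y) (hX' : X' ≠ Y) (x y : Fin d) (r : R) :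
    wedgeBr (V.pr X x) (V.jr X' x) (J Y y) r = 0 ∧ wedgeBr (V.pl X x) (V.jl X' x) (J Y y) r = 0
      ∧ wedgeBr (V.pr X x) (V.jl X' x) (J Y y) r = 0 := by
  simp [wedgeBr, h.pr_gen, h.pl_gen, h.jr_gen, h.jl_gen, hX, hX']

theorem wedge_pl_jl_gen (X X' Y Z : Loop n g) (x y z : Fin d) :
    wedgeBr (V.pl X x) (V.jl X' x) (J Y y) (J Z z) = 0 := by
  simp [wedgeBr, h.jl_gen]

theorem wedge_pr_jl_gen (X X' Y Z : Loop n g) (x y z : Fin d) :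
    wedgeBr (V.pr X x) (V.jl X' x) (J Y y) (J Z z) = 0 := by
  simp [wedgeBr, h.jl_gen]

/-- The fields J_L annihilate all momenta, so among the wedge terms only this kind contributes to
brackets of two generators. -/
theorem sum_wedge_pr_jr_gen (X X' Y Z : Loop n g) (y z : Fin d) :
    ∑ x, wedgeBr (V.pr X x) (V.jr X' x) (J Y y) (J Z z)
      = -((if X = Y then if X' = Z then lieSum b y z (J X') else 0 else 0)
        + if X = Z then if X' = Y then lieSum b y z (J X') else 0 else 0) := by
  have e1 : ∑ x, V.pr X x (J Y y) * V.jr X' x (J Z z)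
      = -(if X = Y then if X' = Z then lieSum b y z (J X') else 0 else 0) := by
    simp only [h.pr_gen, h.jr_gen]
    split_ifs <;> simp
  have e2 : ∑ x, V.jr X' x (J Y y) * V.pr X x (J Z z)
      = if X = Z then if X' = Y then lieSum b y z (J X') else 0 else 0 := by
    simp only [h.pr_gen, h.jr_gen, lieSum_skew b y z]
    split_ifs <;> simp
  simp only [wedgeBr, Finset.sum_sub_distrib, e1, e2]
  ring

theorem dualBr_fn (X : Loop n g) (y : Fin d) (F : Fun E G n g) :
    V.dualBr X (J X y) (f F) = f (-(derivR X (b y) F + derivL X (b y) F)) := by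
  simp only [dualBr, Finset.sum_add_distrib, ← Finset.smul_sum, h.sum_wedge_pr_jr_fn,
    h.sum_wedge_pr_jl_fn, h.sum_wedge_pl_jl_fn_self, map_neg, map_add]
  module

theorem dualBr_gen (X : Loop n g) (y z : Fin d) :
    V.dualBr X (J X y) (J X z) = -lieSum b y z (J X) := by
  simp only [dualBr, Finset.sum_add_distrib, ← Finset.smul_sum, h.sum_wedge_pr_jr_gen,
    h.wedge_pr_jl_gen, h.wedge_pl_jl_gen, Finset.sum_const_zero, if_true]
  module

theorem heisBr_fst_fn {X Y : Loop n g} (hXY : X ≠ Y) (y : Fin d) (F : Fun E G n g) :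
    V.heisBr X Y (J X y) (f F) = f (-derivR X (b y) F - derivR Y (b y) F
      + ∑ x, adFun b (hol X) y x * derivL Y (b x) F) := by
  simp only [heisBr, Finset.sum_add_distrib, ← Finset.smul_sum, h.sum_wedge_pr_jr_fn,
    h.sum_wedge_pl_jl_fn X Y, h.sum_wedge_pl_jl_fn_self, map_neg, map_add, map_sub,
    (h.wedge_fn_of_ne hXY.symm hXY.symm _ y (f F)).1,
    (h.wedge_fn_of_ne hXY.symm hXY.symm _ y (f F)).2.1, Finset.sum_const_zero]
  module

theorem heisBr_snd_fn {X Y : Loop n g} (hXY : X ≠ Y) (y : Fin d) (F : Fun E G n g) :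
    V.heisBr X Y (J Y y) (f F) = f (-derivR Y (b y) F) := by
  have e1 : ∀ x, wedgeBr (V.pr X x) (V.jr Y x) (J Y y) (f F) = 0 := fun x => by
    simp [wedgeBr, h.pr_gen, h.pr_fn, hXY]
  have e2 : ∀ x, wedgeBr (V.pl X x) (V.jl Y x) (J Y y) (f F) = 0 := fun x => by
    simp [wedgeBr, h.pl_gen, h.pl_fn, hXY]
  simp only [heisBr, Finset.sum_add_distrib, ← Finset.smul_sum, h.sum_wedge_pr_jr_fn, e1, e2,
    h.sum_wedge_pl_jl_fn_self, map_neg,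
    (h.wedge_fn_of_ne hXY hXY _ y (f F)).1,
    (h.wedge_fn_of_ne hXY hXY _ y (f F)).2.1, Finset.sum_const_zero]
  module

/-- Each half-weighted diagonal wedge yields two equal terms, hence weight one; the mixed wedge of P
on X with J on Y gives the bracket between the two factors. -/
theorem heisBr_gen {X Y : Loop n g} (Z Z' : Loop n g) (y z : Fin d) :
    V.heisBr X Y (J Z y) (J Z' z)
      = -((if X = Z then if X = Z' then lieSum b y z (J X) else 0 else 0)
        + (if Y = Z then if Y = Z' then lieSum b y z (J Y) else 0 else 0)
        + (if X = Z then if Y = Z' then lieSum b y z (J Y) else 0 else 0)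
        + if X = Z' then if Y = Z then lieSum b y z (J Y) else 0 else 0) := by
  have e : ∀ X : Loop n g, (if X = Z' then if X = Z then lieSum b y z (J X) else 0 else 0)
      = if X = Z then if X = Z' then lieSum b y z (J X) else 0 else 0 := fun X => by
    split_ifs <;> rfl
  simp only [heisBr, Finset.sum_add_distrib, ← Finset.smul_sum, h.sum_wedge_pr_jr_gen,
    h.wedge_pl_jl_gen, Finset.sum_const_zero, e]
  module

theorem blockBr_of_ne {p : Block n g} {Y : Loop n g} (hp : blockOf Y ≠ p) (y : Fin d) (r : R) :
    V.blockBr p (J Y y) r = 0 := by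
  have hne : ∀ X, blockOf X = p → X ≠ Y := fun X hX e => hp (e ▸ hX)
  rcases p with i | i
  · have h1 := hne (M i) rfl
    change V.dualBr (M i) (J Y y) r = 0
    unfold dualBr
    refine Finset.sum_eq_zero fun x _ => ?_
    obtain ⟨e1, e2, e3⟩ := h.wedge_fn_of_ne h1 h1 x y r
    rw [e1, e2, e3, add_zero, add_zero, smul_zero]
  · have hA := hne (A i) rfl
    have hB := hne (B i) rfl
    change V.heisBr (A i) (B i) (J Y y) r = 0
    unfold heisBr
    refine Finset.sum_eq_zero fun x _ => ?_
    obtain ⟨e1, e2, -⟩ := h.wedge_fn_of_ne hA hA x y r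
    obtain ⟨e3, e4, -⟩ := h.wedge_fn_of_ne hB hB x y r
    obtain ⟨e5, e6, -⟩ := h.wedge_fn_of_ne hA hB x y r
    simp only [e1, e2, e3, e4, e5, e6, add_zero, smul_zero]

theorem sumBr_gen_left (Y : Loop n g) (y : Fin d) (r : R) :
    V.sumBr (J Y y) r = V.blockBr (blockOf Y) (J Y y) r :=
  Finset.sum_eq_single _ (fun _ _ hp => h.blockBr_of_ne hp.symm y r)
    (fun hp => absurd (Finset.mem_univ _) hp)

theorem isSkewBiderivation_blockBr (p : Block n g) : IsSkewBiderivation (V.blockBr p) := by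
  have w : ∀ {δ ε : R →ₗ[ℝ] R}, IsLeibniz δ → IsLeibniz ε → IsSkewBiderivation (wedgeBr δ ε) :=
    fun hδ hε => isSkewBiderivation_wedge hδ hε
  rcases p with i | i
  · exact IsSkewBiderivation.sum fun x =>
      (((w (h.pl_leibniz (M i) x) (h.jl_leibniz (M i) x)).add
        (w (h.pr_leibniz (M i) x) (h.jr_leibniz (M i) x))).const_smul _).add
        (w (h.pr_leibniz (M i) x) (h.jl_leibniz (M i) x))
  · exact IsSkewBiderivation.sum fun x =>
      (((((w (h.pr_leibniz (A i) x) (h.jr_leibniz (A i) x)).add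
        (w (h.pl_leibniz (A i) x) (h.jl_leibniz (A i) x))).add
        (w (h.pr_leibniz (B i) x) (h.jr_leibniz (B i) x))).add
        (w (h.pl_leibniz (B i) x) (h.jl_leibniz (B i) x))).const_smul _).add
        (w (h.pr_leibniz (A i) x) (h.jr_leibniz (B i) x)) |>.add
        (w (h.pl_leibniz (A i) x) (h.jl_leibniz (B i) x))

theorem isSkewBiderivation_sumBr : IsSkewBiderivation V.sumBr :=
  IsSkewBiderivation.sum h.isSkewBiderivation_blockBr

/-- The direct sum of the Poisson structures on the punctures and handles is decoupled. -/
theorem isDecoupled_sumBr : IsDecoupled b V.sumBr J f where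
  biderivation := h.isSkewBiderivation_sumBr
  fn_fn F F' := by
    refine Finset.sum_eq_zero fun p _ => ?_
    rcases p with i | i
    · simp [blockBr, dualBr, wedgeBr, h.pr_fn, h.pl_fn]
    · simp [blockBr, heisBr, wedgeBr, h.pr_fn, h.pl_fn]
  gen_fn X x F := by
    rw [h.sumBr_gen_left]
    rcases X with i | i | i
    · exact h.dualBr_fn _ _ _
    · refine (h.heisBr_fst_fn (X := A i) (Y := B i) (by simp) x F).trans (congrArg f ?_)
      rw [sum_adFun_derivL]
      simp [decGenFun]
      ring
    · exact h.heisBr_snd_fn (X := A i) (Y := B i) (by simp) x F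
  gen_gen X Y x y := by
    rw [h.sumBr_gen_left]
    by_cases hXY : blockOf X = blockOf Y
    · rcases X with i | i | i
      · obtain rfl : Y = M i := by
          rcases Y with j | j | j <;> simp [blockOf] at hXY
          rw [hXY]
        exact (h.dualBr_gen _ _ _).trans (if_pos (Or.inl rfl)).symm
      · refine (h.heisBr_gen (X := A i) (Y := B i) _ _ x y).trans ?_
        rcases Y with j | j | j <;> simp [blockOf] at hXY <;> subst hXY <;>
          simp [decGenGen, isHandlePair_A_B]
      · refine (h.heisBr_gen (X := A i) (Y := B i) _ _ x y).trans ?_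
        rcases Y with j | j | j <;> simp [blockOf] at hXY <;> subst hXY <;>
          simp [decGenGen, isHandlePair_A_B, (isHandlePair_A_B (n := n) i).not_symm]
    · rw [(h.isSkewBiderivation_blockBr _).skew, h.blockBr_of_ne (Ne.symm hXY), neg_zero, decGenGen,
        if_neg, if_neg]
      · rintro ⟨i, rfl, rfl⟩
        exact hXY rfl
      · rintro (rfl | ⟨i, rfl, rfl⟩)
        · exact hXY rfl
        · exact hXY rfl

end IsFrame

end VectorFields

end Frames

/-! ### Invariant vector fields on realized functions. -/

section Realization

variable {E G : Type*} [NormedAddCommGroup E] [NormedSpace ℝ E] [FiniteDimensional ℝ E]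
  [TopologicalSpace G] [ChartedSpace E G] [Group G] [LieGroup 𝓘(ℝ, E) ∞ G]
  {d n g : ℕ} (b : Module.Basis (Fin d) ℝ (LieAlg E G))

theorem realize_gen (X : Loop n g) (x : Fin d) (h : Loop n g → HGroup E G) :
    realize (gen b X x) h = momentum (h X) (b x) := by
  have e : loopBasis b n g ⟨X, x⟩ = Pi.single X (b x) := by simp [loopBasis]
  simp only [realize, gen, Algebra.TensorProduct.lift_tmul, SymmetricAlgebra.lift_ι_apply, map_one,
    mul_one, e]
  change ∑ Y, momentum (h Y) ((Pi.single X (b x) : Loop n g → LieAlg E G) Y) = _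
  rw [Finset.sum_eq_single X (fun Y _ hY => by rw [Pi.single_eq_of_ne hY, map_zero]) (by simp),
    Pi.single_eq_same]

theorem realize_fn (F : Fun E G n g) (h : Loop n g → HGroup E G) :
    realize (fn F) h = F fun X => (h X).1 := by
  simp only [realize, fn, Algebra.TensorProduct.lift_tmul, map_one, one_mul]
  rfl

theorem realize_add (φ ψ : Flower E G n g) (h : Loop n g → HGroup E G) :
    realize (φ + ψ) h = realize φ h + realize ψ h := congrFun (map_add realize φ ψ) h

theorem realize_mul (φ ψ : Flower E G n g) (h : Loop n g → HGroup E G) :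
    realize (φ * ψ) h = realize φ h * realize ψ h := congrFun (map_mul realize φ ψ) h

/-- Derivatives along curves with values in `H^(n+2g)` are determined on generators. -/
theorem hasDerivAt_realize {c : ℝ → Loop n g → HGroup E G} {D : Flower E G n g →ₗ[ℝ] Flower E G n g}
    (hD : IsLeibniz D)
    (hgen : ∀ X x, HasDerivAt (fun t => realize (gen b X x) (c t)) (realize (D (gen b X x)) (c 0)) 0)
    (hfn : ∀ F, HasDerivAt (fun t => realize (fn F) (c t)) (realize (D (fn F)) (c 0)) 0)
    (φ : Flower E G n g) :
    HasDerivAt (fun t => realize φ (c t)) (realize (D φ) (c 0)) 0 := by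
  refine flower_induction b (p := fun φ => HasDerivAt (fun t => realize φ (c t))
    (realize (D φ) (c 0)) 0) hgen hfn ?_ ?_ φ
  · intro φ ψ h h'
    simp only [realize_add, map_add]
    exact h.add h'
  · intro φ ψ h h'
    rw [hD]
    simp only [realize_mul, realize_add]
    refine (h.mul h').congr_deriv ?_
    ring

/-- Derivatives along maps `G → H^(n+2g)` are determined on generators. -/
theorem dOne_realize {c : G → Loop n g → HGroup E G} {D : Flower E G n g →ₗ[ℝ] Flower E G n g}
    {ξ : LieAlg E G} (hD : IsLeibniz D)
    (hgen' : ∀ X x, MDifferentiableAt 𝓘(ℝ, E) 𝓘(ℝ) (fun v => realize (gen b X x) (c v)) (1 : G))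
    (hfn' : ∀ F, MDifferentiableAt 𝓘(ℝ, E) 𝓘(ℝ) (fun v => realize (fn F) (c v)) (1 : G))
    (hgen : ∀ X x, dOne (fun v => realize (gen b X x) (c v)) ξ = realize (D (gen b X x)) (c 1))
    (hfn : ∀ F, dOne (fun v => realize (fn F) (c v)) ξ = realize (D (fn F)) (c 1))
    (φ : Flower E G n g) :
    dOne (fun v => realize φ (c v)) ξ = realize (D φ) (c 1) := by
  have key := flower_induction b (p := fun φ =>
    MDifferentiableAt 𝓘(ℝ, E) 𝓘(ℝ) (fun v => realize φ (c v)) (1 : G)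
      ∧ dOne (fun v => realize φ (c v)) ξ = realize (D φ) (c 1))
    (fun X x => ⟨hgen' X x, hgen X x⟩) (fun F => ⟨hfn' F, hfn F⟩) ?_ ?_ φ
  · exact key.2
  · rintro φ ψ ⟨h1, h2⟩ ⟨h3, h4⟩
    simp only [realize_add, map_add]
    exact ⟨h1.add h3, by rw [dOne_add h1 h3, h2, h4]⟩
  · rintro φ ψ ⟨h1, h2⟩ ⟨h3, h4⟩
    rw [hD]
    simp only [realize_mul, realize_add]
    exact ⟨h1.mul h3, by rw [dOne_mul h1 h3, h2, h4]⟩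

section OfPartials

variable {R : Type*} [CommRing R] [Algebra ℝ R]

/-- The derivations given by partial derivatives `pd` with respect to generators `J` and by
extensions `dr`, `dl` of the derivations of `C^∞(G^(n+2g))`. -/
def VectorFields.ofPartials (J : Loop n g → Fin d → R) (f : Fun E G n g →ₐ[ℝ] R)
    (pd dr dl : Loop n g → Fin d → R →ₗ[ℝ] R) : VectorFields n g d R where
  pr X x := -pd X x
  pl X x := ∑ a, LinearMap.mulLeft ℝ (f (adFun b (hol X) a x)) ∘ₗ pd X a
  jr X x := dr X x + ∑ a, LinearMap.mulLeft ℝ (lieSum b x a (J X)) ∘ₗ pd X a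
  jl X x := dl X x

theorem VectorFields.isFrame_ofPartials {J : Loop n g → Fin d → R} {f : Fun E G n g →ₐ[ℝ] R}
    {pd dr dl : Loop n g → Fin d → R →ₗ[ℝ] R} (hpd : ∀ X x, IsLeibniz (pd X x))
    (hdr : ∀ X x, IsLeibniz (dr X x)) (hdl : ∀ X x, IsLeibniz (dl X x))
    (pd_gen : ∀ X Y x y, pd X x (J Y y) = if X = Y ∧ x = y then 1 else 0)
    (pd_fn : ∀ X x F, pd X x (f F) = 0) (dr_gen : ∀ X Y x y, dr X x (J Y y) = 0)
    (dl_gen : ∀ X Y x y, dl X x (J Y y) = 0)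
    (dr_fn : ∀ X x F, dr X x (f F) = f (derivR X (b x) F))
    (dl_fn : ∀ X x F, dl X x (f F) = f (derivL X (b x) F)) :
    (VectorFields.ofPartials b J f pd dr dl).IsFrame b J f where
  pr_leibniz X x := (hpd X x).neg
  pl_leibniz X x := IsLeibniz.sum fun a => (hpd X a).mulLeft _
  jr_leibniz X x := (hdr X x).add (IsLeibniz.sum fun a => (hpd X a).mulLeft _)
  jl_leibniz := hdl
  pr_gen X Y x y := by
    simp only [ofPartials, LinearMap.neg_apply, pd_gen]
    by_cases h1 : X = Y <;> by_cases h2 : x = y <;> simp [h1, h2]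
  pl_gen X Y x y := by
    simp only [ofPartials, LinearMap.sum_apply, LinearMap.comp_apply, LinearMap.mulLeft_apply, pd_gen]
    by_cases h1 : X = Y <;> simp [h1]
  jr_gen X Y x y := by
    simp only [ofPartials, LinearMap.add_apply, LinearMap.sum_apply, LinearMap.comp_apply,
      LinearMap.mulLeft_apply, pd_gen, dr_gen]
    by_cases h1 : X = Y <;> simp [h1]
  jl_gen := dl_gen
  pr_fn X x F := by simp [ofPartials, pd_fn]
  pl_fn X x F := by simp [ofPartials, pd_fn]
  jr_fn X x F := by simp [ofPartials, pd_fn, dr_fn]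
  jl_fn := dl_fn

end OfPartials

/-- The derivations of the flower algebra given by the invariant vector fields on `H^(n+2g)`. -/
def flowerFields : VectorFields n g d (Flower E G n g) :=
  VectorFields.ofPartials b (gen b) fnHom (dGen b) (fun X x => dFun (derivR X (b x)))
    (fun X x => dFun (derivL X (b x)))

theorem isFrame_flowerFields : (flowerFields (n := n) (g := g) b).IsFrame b (gen b) fnHom :=
  VectorFields.isFrame_ofPartials b (dGen_mul b) (fun X x => dFun_mul (isLeibniz_derivR X (b x)))
    (fun X x => dFun_mul (isLeibniz_derivL X (b x))) (dGen_gen b) (dGen_fn b)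
    (fun X Y x y => dFun_gen b (isLeibniz_derivR X (b x)) Y y)
    (fun X Y x y => dFun_gen b (isLeibniz_derivL X (b x)) Y y)
    (fun _ _ F => dFun_fn _ F) (fun _ _ F => dFun_fn _ F)

theorem momentum_apply (p : HGroup E G) (η : LieAlg E G) : momentum p η = -p.2 (Ad p.1 η) := rfl

/-- The multiplication of H twists tP by Ad*(u⁻¹), and the momentum map untwists it, so the momentum
shifts by exactly -tP. -/
theorem momentum_mul_dual (p : HGroup E G) (t : ℝ) (x y : Fin d) :
    momentum (hmul p (1, t • b.coord x)) (b y) = momentum p (b y) - t * if x = y then 1 else 0 := by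
  have e : momentum (hmul p (1, t • b.coord x)) (b y)
      = -(p.2 (Ad (p.1 * 1) (b y)) + t * b.repr (Ad p.1⁻¹ (Ad (p.1 * 1) (b y))) x) := rfl
  rw [e, mul_one, Ad_inv_apply, momentum_apply, b.repr_self, Finsupp.single_apply]
  simp only [eq_comm]
  ring

theorem momentum_dual_mul (p : HGroup E G) (t : ℝ) (x y : Fin d) :
    momentum (hmul (1, -(t • b.coord x)) p) (b y) = momentum p (b y) + t * adStar b p.1 y x := by
  have e : momentum (hmul (1, -(t • b.coord x)) p) (b y)
      = -(-(t * b.repr (Ad (1 * p.1) (b y)) x) + p.2 (Ad (1 : G)⁻¹ (Ad (1 * p.1) (b y)))) := rfl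
  rw [e, one_mul, inv_one, Ad_one, momentum_apply, adStar]
  ring

theorem momentum_mul_group (p : HGroup E G) (v : G) (η : LieAlg E G) :
    momentum (hmul p (v, 0)) η = momentum p (Ad v η) := by
  have e : momentum (hmul p (v, 0)) η = -(p.2 (Ad (p.1 * v) η) + 0) := rfl
  rw [e, add_zero, Ad_mul, momentum_apply]

/-- Left translation changes the covector and the holonomy by opposite twists, so the momentum is
invariant; hence J_L kills the generators. -/
theorem momentum_group_mul (p : HGroup E G) (v : G) (η : LieAlg E G) :
    momentum (hmul (v⁻¹, 0) p) η = momentum p η := by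
  have e : momentum (hmul (v⁻¹, 0) p) η = -(0 + p.2 (Ad v⁻¹⁻¹ (Ad (v⁻¹ * p.1) η))) := rfl
  rw [e, zero_add, ← Ad_mul, inv_inv, mul_inv_cancel_left, momentum_apply]

theorem fst_update (h : Loop n g → HGroup E G) (X : Loop n g) (p : HGroup E G) :
    (fun Y => (Function.update h X p Y).1) = Function.update (fun Y => (h Y).1) X p.1 := by
  funext Y
  by_cases hY : Y = X
  · subst hY
    simp
  · simp [hY]

theorem realize_gen_update (h : Loop n g → HGroup E G) (X Y : Loop n g) (p : HGroup E G)
    (y : Fin d) : realize (gen b Y y) (Function.update h X p)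
      = if X = Y then momentum p (b y) else realize (gen b Y y) h := by
  rw [realize_gen, realize_gen]
  by_cases hY : X = Y
  · subst hY
    simp
  · rw [if_neg hY, Function.update_of_ne (Ne.symm hY)]

theorem realize_fn_update (h : Loop n g → HGroup E G) (X : Loop n g) (p : HGroup E G)
    (F : Fun E G n g) : realize (fn F) (Function.update h X p)
      = F (Function.update (fun Y => (h Y).1) X p.1) := by
  rw [realize_fn, fst_update]

theorem hmul_one_zero_right (p : HGroup E G) : hmul p (1, 0) = p := by
  ext1
  · exact mul_one _
  · exact add_zero _

theorem hmul_one_zero_left (p : HGroup E G) : hmul (1, 0) p = p := by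
  ext1
  · exact one_mul _
  · ext η
    change 0 + p.2 (Ad (1 : G)⁻¹ η) = _
    rw [inv_one, Ad_one, zero_add]

theorem realize_zero (h : Loop n g → HGroup E G) :
    realize (0 : Flower E G n g) h = 0 := congrFun (map_zero realize) h

theorem realize_ite (c : Prop) [Decidable c] (φ ψ : Flower E G n g) (h : Loop n g → HGroup E G) :
    realize (if c then φ else ψ) h = if c then realize φ h else realize ψ h := by
  split_ifs <;> rfl

theorem realize_sum {ι : Type*} (s : Finset ι) (φ : ι → Flower E G n g)
    (h : Loop n g → HGroup E G) : realize (∑ i ∈ s, φ i) h = ∑ i ∈ s, realize (φ i) h := by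
  rw [map_sum, Finset.sum_apply]

theorem realize_smul (r : ℝ) (φ : Flower E G n g) (h : Loop n g → HGroup E G) :
    realize (r • φ) h = r * realize φ h := congrFun (map_smul realize r φ) h

theorem realize_sub (φ ψ : Flower E G n g) (h : Loop n g → HGroup E G) :
    realize (φ - ψ) h = realize φ h - realize ψ h := congrFun (map_sub realize φ ψ) h

theorem realize_neg (φ : Flower E G n g) (h : Loop n g → HGroup E G) :
    realize (-φ) h = -realize φ h := congrFun (map_neg realize φ) h

theorem realize_one (h : Loop n g → HGroup E G) :
    realize (1 : Flower E G n g) h = 1 := by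
  rw [map_one, Pi.one_apply]

theorem realize_lieSum (X : Loop n g) (x y : Fin d) (h : Loop n g → HGroup E G) :
    realize (lieSum b x y (gen b X)) h = momentum (h X) ⁅b x, b y⁆ := by
  rw [lieSum, realize_sum, lie_eq_sum, map_sum]
  refine Finset.sum_congr rfl fun z _ => ?_
  rw [realize_smul, realize_gen, map_smul, smul_eq_mul]

theorem PR_realize (X : Loop n g) (x : Fin d) (φ : Flower E G n g) (h : Loop n g → HGroup E G) :
    PR b x (fun p => realize φ (Function.update h X p)) (h X)
      = realize ((flowerFields b).pr X x φ) h := by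
  have hF := isFrame_flowerFields (n := n) (g := g) b
  have h0 : Function.update h X (hmul (h X) (1, (0 : ℝ) • b.coord x)) = h := by
    rw [zero_smul, hmul_one_zero_right, Function.update_eq_self]
  have key := hasDerivAt_realize b (c := fun t : ℝ =>
    -- Both sides are derivations along this curve, so only generators and functions remain to be
    -- differentiated.
    Function.update h X (hmul (h X) (1, t • b.coord x))) (hF.pr_leibniz X x) ?_ ?_ φ
  · rw [h0] at key
    exact key.deriv
  · intro Y y
    rw [h0, hF.pr_gen]
    simp only [realize_gen_update, momentum_mul_dual, realize_ite, realize_neg, realize_one,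
      realize_zero]
    by_cases hY : X = Y
    · simp only [if_pos hY]
      refine (((hasDerivAt_id (0 : ℝ)).mul_const (if x = y then (1 : ℝ) else 0)).const_sub
        (momentum (h X) (b y))).congr_deriv ?_
      split_ifs <;> simp
    · simp only [if_neg hY]
      exact hasDerivAt_const _ _
  · intro F
    rw [h0]
    refine (hasDerivAt_const (0 : ℝ) (realize (fn F) h)).congr_of_eventuallyEq
      (Filter.Eventually.of_forall fun t => ?_) |>.congr_deriv ?_
    · rw [realize_fn_update, realize_fn]
      change F (Function.update _ X ((h X).1 * 1)) = _
      rw [mul_one, Function.update_eq_self]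
    · have e : (flowerFields b).pr X x (fn F) = 0 := hF.pr_fn X x F
      rw [e, realize_zero]

theorem PL_realize (X : Loop n g) (x : Fin d) (φ : Flower E G n g) (h : Loop n g → HGroup E G) :
    PL b x (fun p => realize φ (Function.update h X p)) (h X)
      = realize ((flowerFields b).pl X x φ) h := by
  have hF := isFrame_flowerFields (n := n) (g := g) b
  have h0 : Function.update h X (hmul (1, -((0 : ℝ) • b.coord x)) (h X)) = h := by
    rw [zero_smul, neg_zero, hmul_one_zero_left, Function.update_eq_self]
  have key := hasDerivAt_realize b (c := fun t : ℝ =>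
    Function.update h X (hmul (1, -(t • b.coord x)) (h X))) (hF.pl_leibniz X x) ?_ ?_ φ
  · rw [h0] at key
    exact key.deriv
  · intro Y y
    rw [h0, hF.pl_gen]
    simp only [realize_gen_update, momentum_dual_mul, realize_ite, fnHom_apply, realize_fn,
      realize_zero]
    by_cases hY : X = Y
    · simp only [if_pos hY]
      refine (((hasDerivAt_id (0 : ℝ)).mul_const (adStar b (h X).1 y x)).const_add
        (momentum (h X) (b y))).congr_deriv ?_
      exact one_mul _
    · simp only [if_neg hY]
      exact hasDerivAt_const _ _
  · intro F
    rw [h0]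
    refine (hasDerivAt_const (0 : ℝ) (realize (fn F) h)).congr_of_eventuallyEq
      (Filter.Eventually.of_forall fun t => ?_) |>.congr_deriv ?_
    · rw [realize_fn_update, realize_fn]
      change F (Function.update _ X (1 * (h X).1)) = _
      rw [one_mul, Function.update_eq_self]
    · have e : (flowerFields b).pl X x (fn F) = 0 := hF.pl_fn X x F
      rw [e, realize_zero]

theorem JR_realize (X : Loop n g) (x : Fin d) (φ : Flower E G n g) (h : Loop n g → HGroup E G) :
    JR b x (fun p => realize φ (Function.update h X p)) (h X)
      = realize ((flowerFields b).jr X x φ) h := by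
  have hF := isFrame_flowerFields (n := n) (g := g) b
  have h0 : Function.update h X (hmul (h X) (1, 0)) = h := by
    rw [hmul_one_zero_right, Function.update_eq_self]
  have efn : ∀ F : Fun E G n g, (fun v : G => realize (fn F) (Function.update h X (hmul (h X) (v, 0))))
      = fun v => F (Function.update (fun Y => (h Y).1) X ((h X).1 * v)) :=
    fun F => funext fun v => realize_fn_update h X _ F
  have key := dOne_realize b (c := fun v : G => Function.update h X (hmul (h X) (v, 0)))
    (ξ := b x) (hF.jr_leibniz X x) ?_ ?_ ?_ ?_ φ
  · rw [h0] at key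
    exact key
  · intro Y y
    simp only [realize_gen_update, momentum_mul_group]
    by_cases hY : X = Y
    · simp only [if_pos hY]
      exact (contMDiff_dual_Ad _ _).mdifferentiableAt (by simp)
    · simp only [if_neg hY]
      exact mdifferentiableAt_const
  · intro F
    rw [efn]
    exact mdifferentiableAt_of_param (contMDiff_updateR F X) (fun Y => (h Y).1) 1
  · intro Y y
    rw [h0, hF.jr_gen]
    simp only [realize_gen_update, momentum_mul_group, realize_ite, realize_zero]
    by_cases hY : X = Y
    · simp only [if_pos hY, realize_lieSum]
      exact dOne_Ad _ _ _
    · simp only [if_neg hY]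
      exact dOne_const _ _
  · intro F
    have e : (flowerFields b).jr X x (fn F) = fn (derivR X (b x) F) := hF.jr_fn X x F
    rw [h0, efn, e, realize_fn]
    rfl

theorem JL_realize (X : Loop n g) (x : Fin d) (φ : Flower E G n g) (h : Loop n g → HGroup E G) :
    JL b x (fun p => realize φ (Function.update h X p)) (h X)
      = realize ((flowerFields b).jl X x φ) h := by
  have hF := isFrame_flowerFields (n := n) (g := g) b
  have h0 : Function.update h X (hmul ((1 : G)⁻¹, 0) (h X)) = h := by
    rw [inv_one, hmul_one_zero_left, Function.update_eq_self]
  have efn : ∀ F : Fun E G n g,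
      (fun v : G => realize (fn F) (Function.update h X (hmul (v⁻¹, 0) (h X))))
      = fun v => F (Function.update (fun Y => (h Y).1) X (v⁻¹ * (h X).1)) :=
    fun F => funext fun v => realize_fn_update h X _ F
  have egen : ∀ (Y : Loop n g) (y : Fin d),
      (fun v : G => realize (gen b Y y) (Function.update h X (hmul (v⁻¹, 0) (h X))))
      = fun _ => realize (gen b Y y) h := fun Y y => funext fun v => by
    rw [realize_gen_update, momentum_group_mul]
    split_ifs with hY
    · rw [realize_gen, hY]
    · rfl
  have key := dOne_realize b (c := fun v : G => Function.update h X (hmul (v⁻¹, 0) (h X)))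
    (ξ := b x) (hF.jl_leibniz X x) ?_ ?_ ?_ ?_ φ
  · rw [h0] at key
    exact key
  · intro Y y
    rw [egen]
    exact mdifferentiableAt_const
  · intro F
    rw [efn]
    exact mdifferentiableAt_of_param (contMDiff_updateL F X) (fun Y => (h Y).1) 1
  · intro Y y
    rw [egen, h0, hF.jl_gen, realize_zero]
    exact dOne_const _ _
  · intro F
    have e : (flowerFields b).jl X x (fn F) = fn (derivL X (b x) F) := hF.jl_fn X x F
    rw [h0, efn, e, realize_fn]
    rfl

end Realization

/-! ### Identification with the direct sum and injectivity of the realization. -/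

section Transport

variable {E G : Type*} [NormedAddCommGroup E] [NormedSpace ℝ E] [FiniteDimensional ℝ E]
  [TopologicalSpace G] [ChartedSpace E G] [Group G] [LieGroup 𝓘(ℝ, E) ∞ G]
  {d n g : ℕ} (b : Module.Basis (Fin d) ℝ (LieAlg E G))

theorem realize_wedgeBr (δ ε : Flower E G n g →ₗ[ℝ] Flower E G n g) (φ ψ : Flower E G n g)
    (h : Loop n g → HGroup E G) : realize (wedgeBr δ ε φ ψ) h
      = realize (δ φ) h * realize (ε ψ) h - realize (ε φ) h * realize (δ ψ) h := by
  rw [wedgeBr, realize_sub, realize_mul, realize_mul]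

theorem realize_dualBr (X : Loop n g) (φ ψ : Flower E G n g) (h : Loop n g → HGroup E G) :
    realize ((flowerFields b).dualBr X φ ψ) h
      = dualBracket b (fun p => realize φ (Function.update h X p))
          (fun p => realize ψ (Function.update h X p)) (h X) := by
  rw [VectorFields.dualBr, realize_sum]
  refine Finset.sum_congr rfl fun x _ => ?_
  simp only [realize_add, realize_smul, realize_wedgeBr, wedge, PR_realize, PL_realize, JR_realize,
    JL_realize]

theorem onFst_realize (V : (HGroup E G → ℝ) → HGroup E G → ℝ) {X Y : Loop n g} (hXY : X ≠ Y)
    (φ : Flower E G n g) (h : Loop n g → HGroup E G) :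
    onFst V (fun p => realize φ (Function.update (Function.update h X p.1) Y p.2)) (h X, h Y)
      = V (fun p => realize φ (Function.update h X p)) (h X) := by
  have e : ∀ p, Function.update (Function.update h X p) Y (h Y) = Function.update h X p := fun p => by
    rw [Function.update_comm hXY, Function.update_eq_self]
  simp only [onFst, e]

theorem onSnd_realize (V : (HGroup E G → ℝ) → HGroup E G → ℝ) (X Y : Loop n g)
    (φ : Flower E G n g) (h : Loop n g → HGroup E G) :
    onSnd V (fun p => realize φ (Function.update (Function.update h X p.1) Y p.2)) (h X, h Y)
      = V (fun p => realize φ (Function.update h Y p)) (h Y) := by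
  simp only [onSnd, Function.update_eq_self]

theorem realize_heisBr {X Y : Loop n g} (hXY : X ≠ Y) (φ ψ : Flower E G n g)
    (h : Loop n g → HGroup E G) :
    realize ((flowerFields b).heisBr X Y φ ψ) h
      = heisBracket b (fun p => realize φ (Function.update (Function.update h X p.1) Y p.2))
          (fun p => realize ψ (Function.update (Function.update h X p.1) Y p.2)) (h X, h Y) := by
  rw [VectorFields.heisBr, realize_sum]
  refine Finset.sum_congr rfl fun x _ => ?_
  simp only [realize_add, realize_smul, realize_wedgeBr, wedge, onFst_realize _ hXY, onSnd_realize,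
    PR_realize, PL_realize, JR_realize, JL_realize]

theorem realize_sumBr (φ ψ : Flower E G n g) :
    realize ((flowerFields b).sumBr φ ψ) = directSumBracket b (realize φ) (realize ψ) := by
  funext h
  rw [VectorFields.sumBr, realize_sum, Fintype.sum_sum_type]
  exact congrArg₂ (· + ·) (Finset.sum_congr rfl fun i _ => realize_dualBr b (M i) φ ψ h)
    (Finset.sum_congr rfl fun i _ => realize_heisBr b (X := A i) (Y := B i) (by simp) φ ψ h)

/-- Two skew biderivations with the same values on generators coincide; `map_bracket` is used with
the identity homomorphism. -/
theorem sumBr_flowerFields (φ ψ : Flower E G n g) :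
    (flowerFields b).sumBr φ ψ = decBracket b φ ψ := by
  have h := (isFrame_flowerFields (n := n) (g := g) b).isDecoupled_sumBr
  have h' := isDecoupled_decBracket (n := n) (g := g) b
  refine h.biderivation.map_bracket h'.biderivation (AlgHom.id ℝ _)
    (S := {r | (∃ X x, r = gen b X x) ∨ ∃ F, r = fn F}) ?_ ?_ φ ψ |>.symm
  · intro p hS hadd hmul
    exact flower_induction b (fun X x => hS _ (Or.inl ⟨X, x, rfl⟩)) (fun F => hS _ (Or.inr ⟨F, rfl⟩))
      hadd hmul
  · rintro _ (⟨X, x, rfl⟩ | ⟨F, rfl⟩) _ (⟨Y, y, rfl⟩ | ⟨F', rfl⟩)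
    · exact (h'.gen_gen X Y x y).trans (h.gen_gen X Y x y).symm
    · exact (h'.gen_fn X x F').trans (h.gen_fn X x F').symm
    · exact (h'.biderivation.skew _ _).trans ((congrArg Neg.neg ((h'.gen_fn Y y F).trans
        (h.gen_fn Y y F).symm)).trans (h.biderivation.skew _ _).symm)
    · exact (h'.fn_fn F F').trans (h.fn_fn F F').symm

theorem realize_transported (φ ψ : Flower E G n g) :
    realize (decouplingInv b (flowerBracket b (decoupling b φ) (decoupling b ψ)))
      = directSumBracket b (realize φ) (realize ψ) := by
  rw [flowerBracket_decoupling, leftInverse_decouplingInv, ← sumBr_flowerFields, realize_sumBr]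

/-- At a fixed point of H^(n+2g) the symmetric algebra acts by evaluating polynomials at the
momenta. -/
theorem lift_realizeLin (q : MvPolynomial (Σ _ : Loop n g, Fin d) ℝ) (h : Loop n g → HGroup E G) :
    SymmetricAlgebra.lift realizeLin
        ((SymmetricAlgebra.equivMvPolynomial (loopBasis b n g)).symm q) h
      = MvPolynomial.eval (fun p => momentum (h p.1) (b p.2)) q := by
  have e : ((Pi.evalAlgHom ℝ (fun _ : Loop n g → HGroup E G => ℝ) h).comp
      (SymmetricAlgebra.lift realizeLin)).comp
        (SymmetricAlgebra.equivMvPolynomial (loopBasis b n g)).symm.toAlgHom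
      = MvPolynomial.aeval fun p => momentum (h p.1) (b p.2) := by
    refine MvPolynomial.algHom_ext fun p => ?_
    have e1 := realize_gen b p.1 p.2 h
    simp only [realize, gen, Algebra.TensorProduct.lift_tmul, map_one, mul_one] at e1
    rw [MvPolynomial.aeval_X, ← e1]
    exact congrArg (fun s => SymmetricAlgebra.lift realizeLin s h)
      (SymmetricAlgebra.equivMvPolynomial_symm_X (loopBasis b n g) p)
  rw [← MvPolynomial.coe_aeval_eq_eval]
  exact DFunLike.congr_fun e q

/-- Holonomies and momenta are independent coordinates: the witness takes the covector -Ad*(u⁻¹) a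
over u. -/
theorem exists_momentum (u : Loop n g → G) (a : (Σ _ : Loop n g, Fin d) → ℝ) :
    ∃ h : Loop n g → HGroup E G, (fun X => (h X).1) = u
      ∧ (fun p : Σ _ : Loop n g, Fin d => momentum (h p.1) (b p.2)) = a := by
  refine ⟨fun X => (u X, -(b.constr ℝ (fun x => a ⟨X, x⟩) ∘ₗ Ad (u X)⁻¹)), rfl, funext fun p => ?_⟩
  rw [momentum_apply]
  change -(-(b.constr ℝ (fun x => a ⟨p.1, x⟩) (Ad (u p.1)⁻¹ (Ad (u p.1) (b p.2))))) = _
  rw [Ad_inv_apply, neg_neg, Module.Basis.constr_basis]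

include b in
theorem realize_injective : Function.Injective (realize (E := E) (G := G) (n := n) (g := g)) := by
  refine (injective_iff_map_eq_zero realize).2 fun φ hφ => ?_
  set e := SymmetricAlgebra.equivMvPolynomial (loopBasis b n g) with he
  obtain ⟨c, rfl⟩ := TensorProduct.eq_repr_basis_left
    ((MvPolynomial.basisMonomials (Σ _ : Loop n g, Fin d) ℝ).map e.symm.toLinearEquiv) φ
  suffices hc : c = 0 by rw [hc, Finsupp.sum_zero_index]
  -- After expanding in monomials with coefficients in C^∞(G^(n+2g)), fix the holonomies. The
  -- resulting real polynomial vanishes at all momenta, so each coefficient vanishes at u.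
  have key : ∀ u : Loop n g → G,
      ∑ m ∈ c.support, MvPolynomial.monomial m (c m u) = 0 := fun u => by
    refine MvPolynomial.funext fun a => ?_
    obtain ⟨h, h1, h2⟩ := exists_momentum b u a
    have e0 : realize _ h = 0 := congrFun hφ h
    rw [map_zero, ← e0, Finsupp.sum, realize_sum, map_sum]
    refine Finset.sum_congr rfl fun m _ => ?_
    have e1 : realize (((MvPolynomial.basisMonomials (Σ _ : Loop n g, Fin d) ℝ).map
        e.symm.toLinearEquiv) m ⊗ₜ[ℝ] c m) h
        = SymmetricAlgebra.lift realizeLin (e.symm (MvPolynomial.monomial m 1)) h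
          * c m (fun X => (h X).1) := by
      simp only [realize, Algebra.TensorProduct.lift_tmul, Module.Basis.map_apply,
        MvPolynomial.coe_basisMonomials]
      rfl
    rw [e1, he, lift_realizeLin, h1, h2, MvPolynomial.eval_monomial, MvPolynomial.eval_monomial]
    ring
  ext m u
  by_cases hm : m ∈ c.support
  · have := congrArg (MvPolynomial.coeff m) (key u)
    rw [MvPolynomial.coeff_sum, MvPolynomial.coeff_zero, Finset.sum_eq_single m
      (fun m' _ hm' => by rw [MvPolynomial.coeff_monomial, if_neg hm'])
      (fun hm' => absurd hm hm'), MvPolynomial.coeff_monomial, if_pos rfl] at this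
    exact this
  · rw [Finsupp.notMem_support_iff.1 hm]
    rfl

theorem flowerBracket_primed_A_fn (i : Fin g) (x : Fin d) (F : Fun E G n g) :
    flowerBracket b (primed b (A i) x) (fn F) =
      -fn (derivR (A i) (b x) F) - fn (derivR (B i) (b x) F
        + ∑ y, adFun b ((hol (B i))⁻¹ * hol (A i)) x y * derivR (B i) (b y) F) := by
  have e : decGenFun b (A i) x F = -derivR (A i) (b x) F - (derivR (B i) (b x) F
      + ∑ y, adFun b ((hol (B i))⁻¹ * hol (A i)) x y * derivR (B i) (b y) F) := by
    simp only [decGenFun, LinearMap.sub_apply, LinearMap.neg_apply, LinearMap.sum_apply,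
      LinearMap.comp_apply, LinearMap.mulLeft_apply]
    rw [sub_sub]
  rw [flowerBracket_primed_fn, e, fn_sub, fn_neg]

end Transport

end FlowerAlgebra

end

/-! ### Assembly of the theorem. -/

theorem mainTheorem1 {E G : Type*} [NormedAddCommGroup E] [NormedSpace ℝ E]
    [FiniteDimensional ℝ E] [TopologicalSpace G] [ChartedSpace E G] [Group G]
    [LieGroup 𝓘(ℝ, E) ∞ G] {d : ℕ} (b : Module.Basis (Fin d) ℝ (LieAlg E G)) (n g : ℕ) :
    -- the flower algebra is a Poisson algebra
    IsPoissonBracket (flowerBracket (n := n) (g := g) b) ∧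
    -- `K` is bijective, with the explicit inverse
    Function.LeftInverse (decouplingInv (n := n) (g := g) b) (decoupling b) ∧
    Function.RightInverse (decouplingInv (n := n) (g := g) b) (decoupling b) ∧
    -- the transformed generators are the images of the generators under `K`, which fixes functions
    (∀ (X : Loop n g) (x : Fin d), decoupling b (gen b X x) = primed b X x) ∧
    (∀ F : Fun E G n g, decoupling b (fn F) = fn F) ∧
    -- the brackets of functions
    (∀ F F' : Fun E G n g, flowerBracket b (fn F) (fn F') = 0) ∧
    -- the brackets of the punctures
    (∀ (i k : Fin n) (x y : Fin d),
      flowerBracket b (primed b (M i : Loop n g) x) (primed b (M k) y) =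
        if i = k then -∑ z, structConst b x y z • primed b (M i) z else 0) ∧
    (∀ (i : Fin n) (x : Fin d) (F : Fun E G n g),
      flowerBracket b (primed b (M i) x) (fn F) =
        -fn (derivR (M i) (b x) F + derivL (M i) (b x) F)) ∧
    -- the brackets of the handles
    (∀ (i k : Fin g) (x y : Fin d),
      flowerBracket b (primed b (A i : Loop n g) x) (primed b (A k) y) =
        if i = k then -∑ z, structConst b x y z • primed b (A i) z else 0) ∧
    (∀ (i k : Fin g) (x y : Fin d),
      flowerBracket b (primed b (B i : Loop n g) x) (primed b (B k) y) =
        if i = k then -∑ z, structConst b x y z • primed b (B i) z else 0) ∧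
    (∀ (i k : Fin g) (x y : Fin d),
      flowerBracket b (primed b (A i : Loop n g) x) (primed b (B k) y) =
        if i = k then -∑ z, structConst b x y z • primed b (B i) z else 0) ∧
    (∀ (i : Fin g) (x : Fin d) (F : Fun E G n g),
      flowerBracket b (primed b (A i) x) (fn F) =
        -fn (derivR (A i) (b x) F) - fn (derivR (B i) (b x) F
          + ∑ y, adFun b ((hol (B i))⁻¹ * hol (A i)) x y * derivR (B i) (b y) F)) ∧
    (∀ (i : Fin g) (x : Fin d) (F : Fun E G n g),
      flowerBracket b (primed b (B i) x) (fn F) = -fn (derivR (B i) (b x) F)) ∧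
    -- punctures and handles Poisson-commute
    (∀ (i : Fin n) (k : Fin g) (x y : Fin d),
      flowerBracket b (primed b (M i) x) (primed b (A k) y) = 0 ∧
      flowerBracket b (primed b (M i) x) (primed b (B k) y) = 0) ∧
    -- under the realization by functions on `H^(n+2g)`, the bracket transported by `K` is the direct
    -- sum of `n` copies of the Poisson structure of `H*` and `g` copies of that of `D_+(H)`
    Function.Injective (realize (E := E) (G := G) (n := n) (g := g)) ∧
    ∀ φ ψ : Flower E G n g,
      realize (decouplingInv b (flowerBracket b (decoupling b φ) (decoupling b ψ))) =
        directSumBracket b (realize φ) (realize ψ) := by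
  have self : ∀ (X : Loop n g) (x y : Fin d), decGenGen b (primed b) X X x y
      = -∑ z, structConst b x y z • primed b X z := fun X x y => if_pos (Or.inl rfl)
  refine ⟨isPoissonBracket_flowerBracket b, leftInverse_decouplingInv b, rightInverse_decouplingInv b,
    decoupling_gen b, decoupling_fn b, fun F F' => biderivation_fn_fn b F F', fun i k x y => ?_,
    fun i x F => (flowerBracket_primed_fn b (M i) x F).trans (fn_neg _), fun i k x y => ?_,
    fun i k x y => ?_, fun i k x y => ?_, flowerBracket_primed_A_fn b,
    fun i x F => (flowerBracket_primed_fn b (B i) x F).trans (fn_neg _), fun i k x y => ⟨?_, ?_⟩,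
    realize_injective b, realize_transported b⟩
  · rw [flowerBracket_primed]
    split_ifs with h
    · rw [← h, self]
    · refine IsDecoupled.decGenGen_of_ne x y (by simpa using h) ?_ ?_ <;> rintro ⟨j, hj, -⟩ <;> cases hj
  · rw [flowerBracket_primed]
    split_ifs with h
    · rw [← h, self]
    · refine IsDecoupled.decGenGen_of_ne x y (by simpa using h) ?_ ?_ <;> rintro ⟨j, -, hj⟩ <;> cases hj
  · rw [flowerBracket_primed]
    split_ifs with h
    · rw [← h, self]
    · refine IsDecoupled.decGenGen_of_ne x y (by simpa using h) ?_ ?_ <;> rintro ⟨j, hj, -⟩ <;> cases hj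
  · rw [flowerBracket_primed]
    split_ifs with h
    · subst h
      exact if_pos (Or.inr (isHandlePair_A_B i))
    · refine IsDecoupled.decGenGen_of_ne x y (by simp) (fun h' => h (isHandlePair_A_B_iff.1 h')) ?_
      rintro ⟨j, hj, -⟩
      cases hj
  · rw [flowerBracket_primed]
    refine IsDecoupled.decGenGen_of_ne x y (by simp) ?_ ?_
    · rintro ⟨j, hj, -⟩
      cases hj
    · rintro ⟨j, -, hj⟩
      cases hj
  · rw [flowerBracket_primed]
    refine IsDecoupled.decGenGen_of_ne x y (by simp) ?_ ?_
    · rintro ⟨j, hj, -⟩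
      cases hj
    · rintro ⟨j, hj, -⟩
      cases hj
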